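/- **Setting.** Let $\mathfrak g$ be a simply-laced simple complex Lie algebra with Cartan subalgebra $\mathfrak h$, Chevalley generators $e_i,\alpha_i^\vee,f_i$ ($i\in I$), Cartan matrix $C$, and dual Coxeter number $h^\vee$. Put $f=\sum_i f_i$ and let $\rho^\vee\in\mathfrak h$ be the element with $\alpha_i(\rho^\vee)=1$ for all $i$. Put $\mathfrak g^d=\{x:[\rho^\vee,x]=dx\}$, let $\mathfrak n_+$ be the subalgebra generated by the $e_i$, and put $\mathfrak b_+=\mathfrak h\oplus\mathfrak n_+$. Fix an $\operatorname{ad}\rho^\vee$-invariant subspace $\mathfrak s\subset\mathfrak b_+$ with $\mathfrak b_+=[f,\mathfrak n_+]\oplus\mathfrak s$, and write $\mathfrak s^d=\mathfrak s\cap\mathfrak g^d$. Let $e_\theta$ be a highest root vector, $r\in\mathfrak h$, $\hat k\in(0,1)$ real. Let $\bar r=\sum_d\bar r^d$ with $\bar r^d\in\mathfrak s^d$ be the element of $\mathfrak s$ such that $f-\rho^\vee+\bar r$ is conjugate to $f-\rho^\vee+r$ under $\exp(\operatorname{ad}\mathfrak n_+)$. Let $\{w_j\}_{j\in J}\subset\mathbb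 C^*$ be a finite (possibly empty) set, let $s^d_l(j)\in\mathfrak s^d$ for $0\le l\le d$, and let $$\mathcal L(z,\lambda)=\partial_z+f+\sum_d\frac{\bar r^d}{z^{d+1}}+z^{1-h^\vee}(1+\lambda z^{-\hat k})e_\theta+\sum_d s^d(z),\qquad s^d(z)=z^{-d}\sum_{j\in J}\sum_{l=0}^{d}\frac{s^d_l(j)}{(z-w_j)^{d+1-l}},$$ where $d$ runs over the integers $0\le d\le h^\vee-1$. Assume that for every $\lambda\in\mathbb C$ and every finite-dimensional $\mathfrak g$-module, the equation $\mathcal L\psi=0$ has trivial monodromy at each $w_j$. Let $p:I\to\mathbb Z/2$ satisfy $p(j)=p(i)+1$ whenever $C_{ij}<0$. Fix $i\in I$ and put $$\mathcal L^{p(i)/2}(z,\lambda)=\partial_z+f+\sum_d\frac{\bar r^d}{z^{d+1}}+(-1)^{p(i)}z^{1-h^\vee}(1+\lambda z^{-\hat k})e_\theta+\sum_d(-1)^{p(i)(d+1)}s^d\big((-1)^{p(i)}z\big).$$ Let $L(\omega_i)$ be the $i$-th fundamental representation, with set of weights $P_{\omega_i}$. Let $\widehat{\mathbb C}$ be the universal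 cover of $\mathbb C^*$ minus the lifts of the points $(-1)^{p(i)}w_j$. Let $V^i(\lambda)$ be the set of analytic functions $\psi:\widehat{\mathbb C}\times\mathbb C\to L(\omega_i)$, $(z,\lambda)\mapsto\psi(z,\lambda)$ (so $\psi$ is entire in $\lambda$), with $\mathcal L^{p(i)/2}\psi=0$. The monodromy operator is $M(\psi)(z,\lambda)=e^{2\pi i\rho^\vee}\psi(e^{2\pi i}z,e^{2\pi i\hat k}\lambda)$. Write $\ell=r-\rho^\vee$. The pair $(r,\hat k)$ is *generic* if, for every $i'\in I$, every $\omega\in P_{\omega_{i'}}$ and every eigenvalue $\mu$ of $\ell$ in $L(\omega_{i'})$: when $\hat k$ is irrational, $\mu-\omega(\ell)\ne m+n\hat k$ for all $(m,n)\in\mathbb Z^2\setminus\{(0,0)\}$; when $\hat k=p'/q$ in lowest terms, $q(\mu-\omega(\ell))$ is not a positive integer. **Proposition.** Let $(r,\hat k)$ be generic (rational or irrational $\hat k$). Let $\omega\in P_{\omega_i}$ and let $\chi_\omega\in L(\omega_i)$ be an eigenvector of $f-\rho^\vee+\bar r$ with eigenvalue $\omega(r-\rho^\vee)$. Then there is a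 unique solution $\chi_\omega(z,\lambda)\in V^i(\lambda)$ such that, for all $z$ sufficiently close to $0$ and all $\lambda\in\mathbb C$, $$\chi_\omega(z,\lambda)=z^{-\rho^\vee}z^{-\omega(r-\rho^\vee)}F(z,\lambda z^{-\hat k})$$ for an $L(\omega_i)$-valued function $F(z,w)$ which is analytic in a neighbourhood of $(0,0)$ and satisfies $\lim_{z\to0}F(z,\lambda z^{-\hat k})=\chi_\omega$ for every $\lambda$. For this solution $F$ can be chosen analytic on $\big(\mathbb C\setminus\{(-1)^{p(i)}w_j\}_{j\in J}\big)\times\mathbb C$, and then the formula holds on all of $\widehat{\mathbb C}\times\mathbb C$. In particular $F$ is an entire function of two variables if $J=\emptyset$. Moreover $$M(\chi_\omega)(z,\lambda)=e^{-2\pi i\,\omega(r-\rho^\vee)}\chi_\omega(z,\lambda),$$ so that $\chi_\omega$ is an eigenfunction of the monodromy operator $M$. -/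

import Mathlib

open Filter Topology

universe u v

noncomputable section

namespace KdVOper

section Algebra

variable {ι : Type*} [Fintype ι] [DecidableEq ι] {L : Type u} [LieRing L] [LieAlgebra ℂ L]
  {H : LieSubalgebra ℂ L}

/-- The principal nilpotent element `f = ∑ i, f i`. -/
def principalF (b : LieAlgebra.Basis ι H) : L := ∑ i, b.f i

/-- The element `ρ^∨ = ∑ i j, (C⁻¹) i j α_j^∨` of the Cartan subalgebra, where `C` is the Cartan
matrix; with the index convention of `LieAlgebra.Basis` one has `C i j = b.A j i`. -/
def rhoCheck (b : LieAlgebra.Basis ι H) : H :=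
  ∑ i, ∑ j, ((b.A.map (Int.cast : ℤ → ℂ))⁻¹) j i • b.h' j

/-- The component of degree `d` of the principal gradation: `{x | [ρ^∨, x] = d x}`. -/
def principalDegree (b : LieAlgebra.Basis ι H) (d : ℤ) : Submodule ℂ L where
  carrier := {x | ⁅(rhoCheck b : L), x⁆ = (d : ℂ) • x}
  add_mem' := by
    intro x y hx hy
    simp only [Set.mem_ofPred_eq] at hx hy ⊢
    rw [lie_add, hx, hy, smul_add]
  zero_mem' := by simp
  smul_mem' := by
    intro c x hx
    simp only [Set.mem_ofPred_eq] at hx ⊢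
    rw [lie_smul, hx, smul_comm]

/-- The subalgebra `n_+` generated by the `e i`. -/
def nPlus (b : LieAlgebra.Basis ι H) : Submodule ℂ L :=
  (LieSubalgebra.lieSpan ℂ L (Set.range b.e)).toSubmodule

/-- The Borel subalgebra `b_+ = h ⊕ n_+`. -/
def bPlus (b : LieAlgebra.Basis ι H) : Submodule ℂ L := H.toSubmodule ⊔ nPlus b

/-- The (dual) Coxeter number of a simply-laced simple Lie algebra: one plus the largest degree
that occurs in the principal gradation (that is, one plus the height of the highest root). -/
def coxeterNumber (b : LieAlgebra.Basis ι H) : ℕ :=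
  sSup {d : ℕ | principalDegree b (d : ℤ) ≠ ⊥} + 1

/-- `x` is a highest root vector: a nonzero element annihilated by all `ad (e i)`. -/
def IsHighestRootVector (b : LieAlgebra.Basis ι H) (x : L) : Prop :=
  x ≠ 0 ∧ ∀ i, ⁅b.e i, x⁆ = 0

/-- A transversal space: an `ad ρ^∨`-invariant subspace `s` with `b_+ = [f, n_+] ⊕ s`. -/
structure IsTransversal (b : LieAlgebra.Basis ι H) (s : Submodule ℂ L) : Prop where
  invariant : ∀ x ∈ s, ⁅(rhoCheck b : L), x⁆ ∈ s
  disjoint : Disjoint ((nPlus b).map (LieAlgebra.ad ℂ L (principalF b))) s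
  sup_eq : (nPlus b).map (LieAlgebra.ad ℂ L (principalF b)) ⊔ s = bPlus b

/-- `x` and `y` are conjugated by an element `exp (ad n)`, `n ∈ n_+`, of the unipotent group. The
sum is the full exponential series, since `ad n` is nilpotent and so `(ad n) ^ (dim L) = 0`. -/
def UnipotentConj (b : LieAlgebra.Basis ι H) (x y : L) : Prop :=
  ∃ n ∈ nPlus b, y = ∑ m ∈ Finset.range (Module.finrank ℂ L),
    ((m.factorial : ℂ)⁻¹) • ((LieAlgebra.ad ℂ L n) ^ m) x

/-- `W` is (a model of) the `i`-th fundamental representation `L(ω_i)`: it is irreducible, with a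
highest weight vector of weight `ω_i`, where `ω_i (α_j^∨) = δ_{ij}`. -/
def IsFundamentalModule (b : LieAlgebra.Basis ι H) (i : ι) (W : Type v) [AddCommGroup W]
    [Module ℂ W] [LieRingModule L W] [LieModule ℂ L W] : Prop :=
  LieModule.IsIrreducible ℂ L W ∧
    ∃ w : W, w ≠ 0 ∧ (∀ j, ⁅b.e j, w⁆ = 0) ∧ ∀ j, ⁅b.h j, w⁆ = if j = i then w else 0

/-- `ω` is a weight of the module `W`. -/
def IsWeight (H : LieSubalgebra ℂ L) (W : Type v) [AddCommGroup W] [Module ℂ W]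
    [LieRingModule L W] (ω : Module.Dual ℂ H) : Prop :=
  ∃ w : W, w ≠ 0 ∧ ∀ h : H, ⁅(h : L), w⁆ = ω h • w

/-- Genericity of the pair `(r, k)`. Writing `ℓ = r - ρ^∨`:
if `k` is irrational, for every weight `ω` of every fundamental representation, no `μ - ω(ℓ)` with
`μ` in the spectrum of `ℓ` is of the form `m + n k` with `(m, n) ∈ ℤ² ∖ {(0, 0)}`;
if `k = p / q` in lowest terms, no `q (μ - ω(ℓ))` is a positive integer. -/
def IsGeneric (b : LieAlgebra.Basis ι H) (r : H) (k : ℝ) : Prop :=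
  ∀ (i : ι) (W : Type v) [AddCommGroup W] [Module ℂ W] [FiniteDimensional ℂ W]
    [LieRingModule L W] [LieModule ℂ L W], IsFundamentalModule b i W →
    ∀ ω : Module.Dual ℂ H, IsWeight H W ω →
      ∀ μ ∈ spectrum ℂ (LieModule.toEnd ℂ L W ((r - rhoCheck b : H) : L)),
        (Irrational k → ∀ m n : ℤ, (m, n) ≠ (0, 0) →
          μ - ω (r - rhoCheck b) ≠ (m : ℂ) + (n : ℂ) * (k : ℂ)) ∧
        (∀ c : ℚ, (c : ℝ) = k → ∀ N : ℕ, 0 < N →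
          (c.den : ℂ) * (μ - ω (r - rhoCheck b)) ≠ (N : ℂ))

/-- The parameters of the operator
`ℒ(z, λ) = ∂_z + f + ∑_d r̄^d / z^(d+1) + z^(1-h) (1 + λ z^(-k)) e_θ
  + ∑_{w ∈ sing} ∑_d z^(-d) ∑_{l ≤ d} s w d l / (z - w)^(d+1-l)`.
The sums over `d` run over the degrees `0 ≤ d < h`; only exponents contribute, since the degree `d`
part of the transversal space vanishes for the other `d`. -/
structure OperData (b : LieAlgebra.Basis ι H) where
  /-- the transversal space -/
  transversal : Submodule ℂ L
  isTransversal : IsTransversal b transversal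
  /-- the parameter `k`, a real number in `(0, 1)` -/
  k : ℝ
  k_pos : 0 < k
  k_lt_one : k < 1
  /-- the highest root vector `e_θ` -/
  eTheta : L
  isHighestRootVector : IsHighestRootVector b eTheta
  /-- the parameter `r` in the Cartan subalgebra -/
  r : H
  /-- the components `r̄^d` of the element `r̄` of the transversal space -/
  rBar : ℕ → L
  rBar_mem : ∀ d : ℕ, rBar d ∈ transversal ⊓ principalDegree b (d : ℤ)
  rBar_conj : UnipotentConj b (principalF b - (rhoCheck b : L) + (r : L))
    (principalF b - (rhoCheck b : L) + ∑ d ∈ Finset.range (coxeterNumber b), rBar d)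
  /-- the finite set of additional singularities -/
  sing : Finset ℂ
  zero_notMem : (0 : ℂ) ∉ sing
  /-- the coefficients at the additional singularities -/
  s : ℂ → ℕ → ℕ → L
  s_mem : ∀ (w : ℂ) (d l : ℕ), s w d l ∈ transversal ⊓ principalDegree b (d : ℤ)

/-- The sign `(-1)^p`, `p ∈ ℤ/2`. -/
def sgn (p : ZMod 2) : ℂ := (-1) ^ p.val

variable {b : LieAlgebra.Basis ι H}

namespace OperData

/-- The principal coefficient `f - ρ^∨ + r̄` of the singularity at `0`. -/
def principalCoeff (D : OperData b) : L :=
  principalF b - (rhoCheck b : L) + ∑ d ∈ Finset.range (coxeterNumber b), D.rBar d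

/-- The `𝔤^d`-valued rational function
`s^d(z) = z^(-d) ∑_{w ∈ sing} ∑_{l=0}^{d} s w d l / (z - w)^(d+1-l)`. -/
def sFun (D : OperData b) (d : ℕ) (z : ℂ) : L :=
  (z ^ d)⁻¹ • ∑ w ∈ D.sing, ∑ l ∈ Finset.range (d + 1), ((z - w) ^ (d + 1 - l))⁻¹ • D.s w d l

/-- The coefficient `B(ζ, λ)` of the operator `ℒ^{p/2}(z, λ) = ∂_z + B`, at the point of the
universal cover of `ℂ^*` with coordinate `ζ`, `z = exp ζ` (so `z^(-k) = exp (-k ζ)`):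
`B = f + ∑_d r̄^d / z^(d+1) + (-1)^p z^(1-h) (1 + λ z^(-k)) e_θ + ∑_d (-1)^{p(d+1)} s^d((-1)^p z)`.
For `p = 0` this is `ℒ` itself. For `p = 1` it is the operator obtained from `ℒ(z, λ)` by the
rotation `(z, λ) ↦ (e^{iπ} z, e^{iπk} λ)`, a component of principal degree `d` being multiplied by
`e^{iπ(d+1)}`. -/
def coeff (D : OperData b) (p : ZMod 2) (ζ lam : ℂ) : L :=
  principalF b
    + ∑ d ∈ Finset.range (coxeterNumber b), (Complex.exp (-((d : ℂ) + 1) * ζ)) • D.rBar d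
    + (sgn p * Complex.exp ((1 - (coxeterNumber b : ℂ)) * ζ)
        * (1 + lam * Complex.exp (-(D.k : ℂ) * ζ))) • D.eTheta
    + ∑ d ∈ Finset.range (coxeterNumber b),
        (sgn p ^ (d + 1)) • D.sFun d (sgn p * Complex.exp ζ)

/-- The universal cover of `ℂ^*`, minus the lifts of the additional singular points `(-1)^p w` of
`ℒ^{p/2}`, in the coordinate `ζ` with `z = exp ζ`. -/
def cover (D : OperData b) (p : ZMod 2) : Set ℂ :=
  {ζ | sgn p * Complex.exp ζ ∉ D.sing}

variable {V : Type v} [NormedAddCommGroup V] [NormedSpace ℂ V] [LieRingModule L V]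

/-- `∂_z ψ + B ψ = 0` at the point `ζ`, in the coordinate `ζ` (where `∂_z = exp (-ζ) ∂_ζ`). -/
def SolvesAt (D : OperData b) (p : ZMod 2) (lam : ℂ) (ψ : ℂ → V) (ζ : ℂ) : Prop :=
  HasDerivAt ψ (-(Complex.exp ζ • ⁅D.coeff p ζ lam, ψ ζ⁆)) ζ

/-- All additional singular points of `ℒ(z, λ)` have trivial monodromy for every `λ`: in every
finite-dimensional module, near each lift of an additional singular point, every initial value at
a point of a punctured disc is attained by a solution that is single-valued there. -/
def TrivialMonodromy (D : OperData b) : Prop :=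
  ∀ (W : Type v) [NormedAddCommGroup W] [NormedSpace ℂ W] [FiniteDimensional ℂ W]
    [LieRingModule L W] [LieModule ℂ L W] (lam ζ₀ : ℂ), Complex.exp ζ₀ ∈ D.sing →
    ∃ ε > 0, ∀ ζ₁ ∈ Metric.ball ζ₀ ε \ {ζ₀}, ∀ w : W, ∃ ψ : ℂ → W, ψ ζ₁ = w ∧
      ∀ ζ ∈ Metric.ball ζ₀ ε \ {ζ₀}, D.SolvesAt 0 lam ψ ζ

variable (V) in
/-- The space of solutions of `ℒ^{p/2}(z, λ) ψ(z, λ) = 0` with values in `V` that are analytic on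
the punctured universal cover and entire in `λ`. The argument of `ψ` is the pair `(ζ, λ)`. -/
def solutions (D : OperData b) (p : ZMod 2) : Set (ℂ × ℂ → V) :=
  {ψ | AnalyticOnNhd ℂ ψ (D.cover p ×ˢ Set.univ) ∧
    ∀ ζ ∈ D.cover p, ∀ lam, D.SolvesAt p lam (fun ζ' => ψ (ζ', lam)) ζ}

end OperData

variable {V : Type v} [NormedAddCommGroup V] [NormedSpace ℂ V] [FiniteDimensional ℂ V]
  [LieRingModule L V] [LieModule ℂ L V]

variable (V) in
/-- The operator `exp (c ρ^∨)` on the representation `V`. -/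
def expRho (b : LieAlgebra.Basis ι H) (c : ℂ) : V →L[ℂ] V :=
  NormedSpace.exp
    (c • LinearMap.toContinuousLinearMap (LieModule.toEnd ℂ L V (rhoCheck b : L)))

/-- The monodromy operator `M ψ (z, λ) = e^{2πiρ^∨} ψ(e^{2πi} z, e^{2πik} λ)`. -/
def monodromy (b : LieAlgebra.Basis ι H) (k : ℝ) (ψ : ℂ × ℂ → V) : ℂ × ℂ → V := fun x =>
  expRho V b (2 * Real.pi * Complex.I)
    (ψ (x.1 + 2 * Real.pi * Complex.I, Complex.exp (2 * Real.pi * Complex.I * k) * x.2))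

/-- The function `z^(-ρ^∨) z^(-a) F(z, λ z^(-k))` of `(ζ, λ)`, where `z = exp ζ`. -/
def frobeniusForm (b : LieAlgebra.Basis ι H) (k : ℝ) (a : ℂ) (F : ℂ × ℂ → V) : ℂ × ℂ → V :=
  fun x => expRho V b (-x.1) (Complex.exp (-a * x.1) •
    F (Complex.exp x.1, x.2 * Complex.exp (-(k : ℂ) * x.1)))

/-- `χ(z, λ) = z^(-ρ^∨) z^(-a) F(z, λ z^(-k))` for `z` near `0` and all `λ`, where `F` is analytic
at `(0, 0)` and `F(z, λ z^(-k)) → χ₀` as `z → 0` (that is, as `Re ζ → -∞`), for every `λ`. -/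
def IsFrobeniusExpansion (b : LieAlgebra.Basis ι H) (k : ℝ) (a : ℂ) (χ₀ : V)
    (χ F : ℂ × ℂ → V) : Prop :=
  AnalyticAt ℂ F (0, 0) ∧
  (∃ R > 0, ∀ ζ lam : ℂ, ‖Complex.exp ζ‖ < R → χ (ζ, lam) = frobeniusForm b k a F (ζ, lam)) ∧
  ∀ lam : ℂ, Tendsto (fun ζ : ℂ => F (Complex.exp ζ, lam * Complex.exp (-(k : ℂ) * ζ)))
    (comap Complex.re atBot) (𝓝 χ₀)

end Algebra

end KdVOper

end

/-! Write `z = exp ζ` and `a = ω(r - ρ^∨)`. Gauging `ψ` by `z^a z^(ρ^∨)` uses the principal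
gradation: `f` has degree `-1`, `r̄^d` degree `d` and `e_θ` degree `h^∨ - 1` (`singularSpace_le`),
so all powers of `z` cancel except a simple pole at `z = 0` (`exp_smul_expRho_mul_rep_coeff`). What
remains is `φ' = -(Q + z ((1 + λ z⁻ᵏ) E + S(z))) φ` in `ζ`, with residue `Q = f - ρ^∨ + r̄ - a` and
`Q χ₀ = 0`.

Existence. In the variables `z` and `u = λ z^(1-k)` the coefficient is `-(Q + z (E + S(z)) + u E)`.
A gauge `Ψ(z, u)` with `Ψ(0) = 1` removing everything but `Q` is a double power series whose
coefficients solve `(m + (1-k) n) g + [Q, g] =` known terms. Eigenvalues of `Q` are shifted values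
of weights at `r - ρ^∨`, so genericity makes these equations solvable (`nonResonant_rep`), with a
uniform bound (`exists_uniform_resolvent`) and hence convergence (`exists_frobenius_solution`).
Since `Q χ₀ = 0`, `Ψ(z, u) χ₀` is a solution near `0`; in terms of `w = λ z⁻ᵏ` it is `Ψ(z, z w) χ₀`,
analytic near `(0, w)` for every `w`. Trivial monodromy continues it over the plane of `ζ` minus the
lifts of the singular points (`exists_global_solution`). The equation is invariant under `(ζ, λ) ↦
(ζ + 2πi, e^(2πik) λ)`, so by uniqueness the continuation is a function `F` of `(z, w)`
(`exists_regular_solution`). Its invariance leaves only `z^(-a)` to produce the eigenvalue of `M`.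

Uniqueness. The gauged difference `δ` of two solutions is `Ψ exp(-ζ Q) c(λ)` near `0` with `c`
entire. Single-valuedness in `(z, w)` gives `c(e^(2πik) λ) = exp(2πi Q) c(λ)`, so the `n`-th Taylor
coefficient of `c` is an eigenvector of `exp(2πi Q)` with eigenvalue `e^(2πikn)`. Nonresonance puts
it in the kernel of `Q` (`apply_eq_zero_of_exp_apply`). Then `δ = Ψ c(λ)` tends to `c(λ)`, and `δ →
0` forces `c = 0` (`eq_zero_of_tendsto_zero`). -/

noncomputable section

namespace KdVOper

/-! ### Convergence of double power series. -/

section DoubleSeries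

variable {E : Type*} [NormedAddCommGroup E] [NormedSpace ℂ E]

/-- The multilinear map `v ↦ ∏_{i < m} (v i).1 ∏_{m ≤ i} (v i).2 • g`. -/
def bivariateMonomial (N m : ℕ) (g : E) :
    ContinuousMultilinearMap ℂ (fun _ : Fin N => ℂ × ℂ) E :=
  ((ContinuousMultilinearMap.mkPiAlgebra ℂ (Fin N) ℂ).compContinuousLinearMap
    (fun i => if (i : ℕ) < m then ContinuousLinearMap.fst ℂ ℂ ℂ
      else ContinuousLinearMap.snd ℂ ℂ ℂ)).smulRight g

lemma norm_bivariateMonomial_le (N m : ℕ) (g : E) : ‖bivariateMonomial N m g‖ ≤ ‖g‖ := by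
  rw [bivariateMonomial, ContinuousMultilinearMap.norm_smulRight]
  refine mul_le_of_le_one_left (norm_nonneg _) ?_
  refine (ContinuousMultilinearMap.norm_compContinuousLinearMap_le _ _).trans ?_
  refine mul_le_one₀ ?_ (Finset.prod_nonneg fun _ _ => norm_nonneg _)
    (Finset.prod_le_one (fun _ _ => norm_nonneg _) fun i _ => ?_)
  · refine ContinuousMultilinearMap.opNorm_le_bound zero_le_one fun v => ?_
    simp [norm_prod]
  · split_ifs
    · exact ContinuousLinearMap.norm_fst_le ℂ ℂ ℂ
    · exact ContinuousLinearMap.norm_snd_le ℂ ℂ ℂ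

lemma bivariateMonomial_diag (m n : ℕ) (g : E) (v : ℂ × ℂ) :
    bivariateMonomial (m + n) m g (fun _ => v) = (v.1 ^ m * v.2 ^ n) • g := by
  simp only [bivariateMonomial, ContinuousMultilinearMap.smulRight_apply,
    ContinuousMultilinearMap.compContinuousLinearMap_apply,
    ContinuousMultilinearMap.mkPiAlgebra_apply]
  congr 1
  rw [Fin.prod_univ_add]
  simp

-- The terms are dominated by `M` times a product of geometric series of ratios `s / x` and `t / y`.
omit [NormedSpace ℂ E] in
lemma summable_bivariate {g : ℕ × ℕ → E} {x y M : ℝ}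
    (hg : ∀ p, ‖g p‖ * (x ^ p.1 * y ^ p.2) ≤ M) {s t : ℝ} (hs : 0 ≤ s) (hsx : s < x)
    (ht : 0 ≤ t) (hty : t < y) :
    Summable fun p : ℕ × ℕ => ‖g p‖ * (s ^ p.1 * t ^ p.2) := by
  have hx := hs.trans_lt hsx
  have hy := ht.trans_lt hty
  have h1 : Summable fun p : ℕ × ℕ => (s / x) ^ p.1 * (t / y) ^ p.2 :=
    (summable_geometric_of_lt_one (by positivity) ((div_lt_one hx).2 hsx)).mul_of_nonneg
      (summable_geometric_of_lt_one (by positivity) ((div_lt_one hy).2 hty))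
      (fun _ => by positivity) (fun _ => by positivity)
  refine Summable.of_nonneg_of_le (fun p => by positivity) (fun p => ?_) (h1.mul_left M)
  have : ‖g p‖ * (s ^ p.1 * t ^ p.2)
      = (‖g p‖ * (x ^ p.1 * y ^ p.2)) * ((s / x) ^ p.1 * (t / y) ^ p.2) := by
    rw [div_pow, div_pow]; field_simp
  rw [this]
  exact mul_le_mul_of_nonneg_right (hg p) (by positivity)

variable [CompleteSpace E]

/-- Grouping by total degree `N` gives homogeneous polynomials of norm at most `(N + 1) M`, so the
radius of convergence is at least `1`. The unit ball of the sup norm on `ℂ × ℂ` is the polydisc. -/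
lemma analyticOnNhd_bivariate_unit {g : ℕ × ℕ → E} {M : ℝ} (hg : ∀ p, ‖g p‖ ≤ M) :
    AnalyticOnNhd ℂ (fun v : ℂ × ℂ => ∑' p : ℕ × ℕ, (v.1 ^ p.1 * v.2 ^ p.2) • g p)
      (Metric.ball 0 1) := by
  let P : FormalMultilinearSeries ℂ (ℂ × ℂ) E := fun N =>
    ∑ q ∈ Finset.HasAntidiagonal.antidiagonal N, bivariateMonomial N q.1 (g q)
  have hM : 0 ≤ M := (norm_nonneg _).trans (hg 0)
  have hPn : ∀ N, ‖P N‖ ≤ (N + 1) * M := fun N => by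
    refine (norm_sum_le _ _).trans ?_
    refine (Finset.sum_le_card_nsmul _ _ M fun q _ =>
      (norm_bivariateMonomial_le _ _ _).trans (hg q)).trans ?_
    simp
  have hrad : 1 ≤ P.radius := by
    refine ENNReal.le_of_forall_nnreal_lt fun r hr => ?_
    have hr1 : (r : ℝ) < 1 := by exact_mod_cast hr
    refine P.le_radius_of_summable ?_
    have h2 : Summable fun N : ℕ => ((N : ℝ) + 1) * (r : ℝ) ^ N := by
      have ha := summable_pow_mul_geometric_of_norm_lt_one 1
        (show ‖(r : ℝ)‖ < 1 by simpa using hr1)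
      have hb := summable_geometric_of_lt_one r.2 hr1
      simpa [add_mul] using ha.add hb
    refine Summable.of_nonneg_of_le (fun _ => by positivity) (fun N => ?_) (h2.mul_left M)
    calc ‖P N‖ * (r : ℝ) ^ N ≤ ((N + 1) * M) * (r : ℝ) ^ N :=
          mul_le_mul_of_nonneg_right (hPn N) (by positivity)
      _ = _ := by ring
  have key : HasFPowerSeriesOnBall
      (fun v : ℂ × ℂ => ∑' p : ℕ × ℕ, (v.1 ^ p.1 * v.2 ^ p.2) • g p) P 0 1 := by
    refine ⟨hrad, one_pos, fun {v} hv => ?_⟩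
    have hv1 : ‖v‖ < 1 := by
      have := hv
      rw [← ENNReal.ofReal_one, Metric.eball_ofReal] at this
      simpa using this
    have hs : Summable fun p : ℕ × ℕ => (v.1 ^ p.1 * v.2 ^ p.2) • g p := by
      refine Summable.of_norm ?_
      have := summable_bivariate (x := 1) (y := 1) (g := g) (M := M) (by simpa using hg)
        (norm_nonneg v.1) ((norm_fst_le v).trans_lt hv1) (norm_nonneg v.2)
        ((norm_snd_le v).trans_lt hv1)
      refine this.congr fun p => ?_
      simp [norm_smul, mul_comm]
    rw [zero_add]
    have h3 := (Finset.HasAntidiagonal.sigmaAntidiagonalEquivProd (A := ℕ)).hasSum_iff.mpr hs.hasSum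
    refine (h3.sigma (g := fun N => P N fun _ => v) fun N => ?_)
    have h4 := hasSum_fintype (fun q : Finset.HasAntidiagonal.antidiagonal N =>
      ((v.1 ^ (q : ℕ × ℕ).1 * v.2 ^ (q : ℕ × ℕ).2) • g q))
    have h5 : P N (fun _ => v) = ∑ q : Finset.HasAntidiagonal.antidiagonal N,
        ((v.1 ^ (q : ℕ × ℕ).1 * v.2 ^ (q : ℕ × ℕ).2) • g q) := ?_
    · rw [h5]; exact h4
    change (∑ q ∈ Finset.HasAntidiagonal.antidiagonal N, bivariateMonomial N q.1 (g q)) _ = _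
    rw [sum_apply, ← Finset.sum_coe_sort]
    refine Finset.sum_congr rfl fun q _ => ?_
    obtain ⟨⟨m, n⟩, hq⟩ := q
    obtain rfl := (Finset.HasAntidiagonal.mem_antidiagonal.1 hq)
    exact bivariateMonomial_diag m n _ v
  have := key.analyticOnNhd
  rwa [← ENNReal.ofReal_one, Metric.eball_ofReal] at this

/-- A double power series with coefficients bounded by `M x⁻ᵐ y⁻ⁿ` is analytic on the polydisc
of radii `x` and `y`. -/
theorem analyticOnNhd_bivariate {g : ℕ × ℕ → E} {x y M : ℝ} (hx : 0 < x) (hy : 0 < y)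
    (hg : ∀ p, ‖g p‖ * (x ^ p.1 * y ^ p.2) ≤ M) :
    AnalyticOnNhd ℂ (fun v : ℂ × ℂ => ∑' p : ℕ × ℕ, (v.1 ^ p.1 * v.2 ^ p.2) • g p)
      (Metric.ball 0 x ×ˢ Metric.ball 0 y) := by
  have hxc : (x : ℂ) ≠ 0 := by exact_mod_cast hx.ne'
  have hyc : (y : ℂ) ≠ 0 := by exact_mod_cast hy.ne'
  have h1 := analyticOnNhd_bivariate_unit
    (g := fun p => ((x : ℂ) ^ p.1 * (y : ℂ) ^ p.2) • g p) (M := M) (fun p => by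
      rw [norm_smul, norm_mul, norm_pow, norm_pow, Complex.norm_real, Complex.norm_real,
        Real.norm_of_nonneg hx.le, Real.norm_of_nonneg hy.le, mul_comm]
      exact hg p)
  have h2 : AnalyticOnNhd ℂ (fun v : ℂ × ℂ => ((x : ℂ)⁻¹ * v.1, (y : ℂ)⁻¹ * v.2))
      (Metric.ball 0 x ×ˢ Metric.ball 0 y) :=
    (analyticOnNhd_const.mul analyticOnNhd_fst).prod (analyticOnNhd_const.mul analyticOnNhd_snd)
  have h3 := h1.comp h2 (fun v hv => by
    simp only [Set.mem_prod, Metric.mem_ball, dist_zero_right] at hv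
    rw [mem_ball_zero_iff, Prod.norm_def, max_lt_iff]
    simp only [norm_mul, norm_inv, Complex.norm_real, Real.norm_of_nonneg hx.le,
      Real.norm_of_nonneg hy.le]
    rw [inv_mul_lt_iff₀ hx, inv_mul_lt_iff₀ hy, mul_one, mul_one]
    exact hv)
  refine h3.congr (Metric.isOpen_ball.prod Metric.isOpen_ball) fun v _ => ?_
  refine tsum_congr fun p => ?_
  rw [smul_smul]
  congr 1
  calc ((x : ℂ)⁻¹ * v.1) ^ p.1 * ((y : ℂ)⁻¹ * v.2) ^ p.2 * ((x : ℂ) ^ p.1 * (y : ℂ) ^ p.2)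
      = ((x : ℂ)⁻¹ * x) ^ p.1 * v.1 ^ p.1 * (((y : ℂ)⁻¹ * y) ^ p.2 * v.2 ^ p.2) := by ring
    _ = _ := by rw [inv_mul_cancel₀ hxc, inv_mul_cancel₀ hyc, one_pow, one_pow, one_mul, one_mul]

end DoubleSeries

/-! ### Recursion for the coefficients, and its majorant. -/

section Recursion

variable {𝔸 : Type*} [NormedRing 𝔸]

/-- The coefficient at `zᵐ uⁿ` of the product `(∑ αᵢ zⁱ + u ∑ βᵢ zⁱ) (∑ g (m, n) zᵐ uⁿ)`. -/
def mulCoeff (α β : ℕ → 𝔸) (g : ℕ × ℕ → 𝔸) : ℕ × ℕ → 𝔸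
  | (m, 0) => ∑ q ∈ Finset.HasAntidiagonal.antidiagonal m, α q.1 * g (q.2, 0)
  | (m, n + 1) => ∑ q ∈ Finset.HasAntidiagonal.antidiagonal m, α q.1 * g (q.2, n + 1)
      + ∑ q ∈ Finset.HasAntidiagonal.antidiagonal m, β q.1 * g (q.2, n)

/-- The only term involving `g p` itself carries the factor `α 0 = 0`; this is what makes the
equation for the coefficients a recursion along the product order. -/
lemma mulCoeff_congr {α β : ℕ → 𝔸} (hα : α 0 = 0) {g g' : ℕ × ℕ → 𝔸} {p : ℕ × ℕ}
    (h : ∀ q < p, g q = g' q) : mulCoeff α β g p = mulCoeff α β g' p := by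
  have h1 : ∀ m n, (∀ q < (m, n), g q = g' q) →
      ∑ q ∈ Finset.HasAntidiagonal.antidiagonal m, α q.1 * g (q.2, n)
        = ∑ q ∈ Finset.HasAntidiagonal.antidiagonal m, α q.1 * g' (q.2, n) := fun m n h => by
    refine Finset.sum_congr rfl fun q hq => ?_
    have := Finset.HasAntidiagonal.mem_antidiagonal.1 hq
    rcases Nat.eq_zero_or_pos q.1 with h0 | h0
    · rw [h0, hα, zero_mul, zero_mul]
    · rw [h _ (Prod.mk_lt_mk_iff_left.2 (by lia))]
  obtain ⟨m, n⟩ := p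
  cases n with
  | zero => exact h1 m 0 h
  | succ n =>
    refine congrArg₂ (· + ·) (h1 m (n + 1) h) (Finset.sum_congr rfl fun q hq => ?_)
    have := Finset.HasAntidiagonal.mem_antidiagonal.1 hq
    rw [h _ (Prod.mk_lt_mk.2 (Or.inr ⟨by lia, by lia⟩))]

theorem exists_recursive_solution {α β : ℕ → 𝔸} (hα : α 0 = 0) (R : ℕ × ℕ → 𝔸 → 𝔸) (g₀ : 𝔸) :
    ∃ g : ℕ × ℕ → 𝔸, g 0 = g₀ ∧ ∀ p ≠ 0, g p = R p (mulCoeff α β g p) := by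
  classical
  -- The default `0` outside `q < p` is harmless by `mulCoeff_congr`.
  let Φ : ∀ p : ℕ × ℕ, (∀ q, q < p → 𝔸) → 𝔸 := fun p ih =>
    if p = 0 then g₀ else R p (mulCoeff α β (fun q => if h : q < p then ih q h else 0) p)
  let g : ℕ × ℕ → 𝔸 := wellFounded_lt.fix Φ
  have hg : ∀ p, g p = Φ p (fun q _ => g q) := fun p => WellFounded.fix_eq _ _ _
  refine ⟨g, by rw [hg]; simp [Φ], fun p hp => ?_⟩
  rw [hg]
  simp only [Φ, hp, if_false]
  congr 1
  refine mulCoeff_congr hα fun q hq => ?_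
  simp [hq]

/-- Majorant argument: in the weighted norms `‖g (m, n)‖ xᵐ yⁿ`, multiplication by `α + u β` costs a
factor `a + y b`, the `y` coming from the shift of `n` by one. The solution operators cost `C`,
uniformly in `p`, so the induction closes without loss when `C (a + y b) ≤ 1`. -/
theorem norm_recursive_le {α β : ℕ → 𝔸} (hα : α 0 = 0) {R : ℕ × ℕ → 𝔸 → 𝔸} {g : ℕ × ℕ → 𝔸}
    (hg : ∀ p ≠ 0, g p = R p (mulCoeff α β g p)) {C a b x y : ℝ} (hC : 0 ≤ C) (hx : 0 < x)
    (hy : 0 < y) (hR : ∀ p X, ‖R p X‖ ≤ C * ‖X‖)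
    (ha : ∀ m, ∑ i ∈ Finset.range (m + 1), ‖α i‖ * x ^ i ≤ a)
    (hb : ∀ m, ∑ i ∈ Finset.range (m + 1), ‖β i‖ * x ^ i ≤ b) (hab : C * (a + y * b) ≤ 1)
    (p : ℕ × ℕ) : ‖g p‖ * (x ^ p.1 * y ^ p.2) ≤ ‖g 0‖ := by
  have ha0 : 0 ≤ a := le_trans (by positivity) (ha 0)
  have hb0 : 0 ≤ b := le_trans (by positivity) (hb 0)
  have conv : ∀ (γ : ℕ → 𝔸) (c : ℝ) (_ : ∀ m, ∑ i ∈ Finset.range (m + 1), ‖γ i‖ * x ^ i ≤ c)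
      (m n : ℕ) (_ : ∀ q ∈ Finset.HasAntidiagonal.antidiagonal m, ‖γ q.1‖ *
        (‖g (q.2, n)‖ * (x ^ q.2 * y ^ n)) ≤ ‖γ q.1‖ * ‖g 0‖),
      ‖∑ q ∈ Finset.HasAntidiagonal.antidiagonal m, γ q.1 * g (q.2, n)‖ * (x ^ m * y ^ n)
        ≤ c * ‖g 0‖ := by
    intro γ c hc m n h
    calc _ ≤ (∑ q ∈ Finset.HasAntidiagonal.antidiagonal m, ‖γ q.1‖ * ‖g (q.2, n)‖) *
          (x ^ m * y ^ n) := by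
          refine mul_le_mul_of_nonneg_right ((norm_sum_le _ _).trans
            (Finset.sum_le_sum fun _ _ => norm_mul_le _ _)) (by positivity)
      _ = ∑ q ∈ Finset.HasAntidiagonal.antidiagonal m, x ^ q.1 *
            (‖γ q.1‖ * (‖g (q.2, n)‖ * (x ^ q.2 * y ^ n))) := by
          rw [Finset.sum_mul]
          refine Finset.sum_congr rfl fun q hq => ?_
          rw [← Finset.HasAntidiagonal.mem_antidiagonal.1 hq, pow_add]; ring
      _ ≤ ∑ q ∈ Finset.HasAntidiagonal.antidiagonal m, x ^ q.1 * (‖γ q.1‖ * ‖g 0‖) :=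
          Finset.sum_le_sum fun q hq => mul_le_mul_of_nonneg_left (h q hq) (by positivity)
      _ = (∑ i ∈ Finset.range (m + 1), ‖γ i‖ * x ^ i) * ‖g 0‖ := by
          rw [Finset.Nat.sum_antidiagonal_eq_sum_range_succ_mk, Finset.sum_mul]
          exact Finset.sum_congr rfl fun i _ => by ring
      _ ≤ _ := mul_le_mul_of_nonneg_right (hc m) (norm_nonneg _)
  induction p using WellFoundedLT.induction with
  | ind p ih =>
  rcases eq_or_ne p 0 with rfl | hp
  · simp
  have h1 : ∀ m n, (∀ q < (m, n), ‖g q‖ * (x ^ q.1 * y ^ q.2) ≤ ‖g 0‖) →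
      ∀ q ∈ Finset.HasAntidiagonal.antidiagonal m, ‖α q.1‖ *
        (‖g (q.2, n)‖ * (x ^ q.2 * y ^ n)) ≤ ‖α q.1‖ * ‖g 0‖ := fun m n h q hq => by
    have := Finset.HasAntidiagonal.mem_antidiagonal.1 hq
    rcases Nat.eq_zero_or_pos q.1 with h0 | h0
    · rw [h0, hα]; simp
    · exact mul_le_mul_of_nonneg_left (h (q.2, n) (Prod.mk_lt_mk_iff_left.2 (by lia)))
        (norm_nonneg _)
  have h2 : ‖mulCoeff α β g p‖ * (x ^ p.1 * y ^ p.2) ≤ (a + y * b) * ‖g 0‖ := by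
    obtain ⟨m, n⟩ := p
    cases n with
    | zero =>
      refine (conv α a ha m 0 (h1 m 0 ih)).trans ?_
      have := mul_nonneg (mul_nonneg hy.le hb0) (norm_nonneg (g 0))
      linarith
    | succ n =>
      have hα' := conv α a ha m (n + 1) (h1 m (n + 1) ih)
      have hβ' := conv β b hb m n (fun q hq => by
        have := Finset.HasAntidiagonal.mem_antidiagonal.1 hq
        exact mul_le_mul_of_nonneg_left
          (ih (q.2, n) (Prod.mk_lt_mk.2 (Or.inr ⟨by lia, by lia⟩))) (norm_nonneg _))
      refine (mul_le_mul_of_nonneg_right (norm_add_le _ _) (by positivity)).trans ?_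
      have := mul_le_mul_of_nonneg_left hβ' hy.le
      simp only [pow_succ] at hα' ⊢
      linarith
  calc ‖g p‖ * (x ^ p.1 * y ^ p.2) ≤ (C * ‖mulCoeff α β g p‖) * (x ^ p.1 * y ^ p.2) := by
        refine mul_le_mul_of_nonneg_right ?_ (by positivity)
        conv_lhs => rw [hg p hp]
        exact hR p _
    _ = C * (‖mulCoeff α β g p‖ * (x ^ p.1 * y ^ p.2)) := by ring
    _ ≤ C * ((a + y * b) * ‖g 0‖) := mul_le_mul_of_nonneg_left h2 hC
    _ = (C * (a + y * b)) * ‖g 0‖ := by ring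
    _ ≤ ‖g 0‖ := mul_le_of_le_one_left (norm_nonneg _) hab

end Recursion

/-! ### Double power series as solutions of an Euler-type equation. -/

section Euler

variable {𝔸 : Type*} [NormedRing 𝔸] [NormedAlgebra ℂ 𝔸] [CompleteSpace 𝔸]

omit [CompleteSpace 𝔸] in
lemma summable_norm_of_sum_range_le {α : ℕ → 𝔸} {a x : ℝ} (hx : 0 < x)
    (ha : ∀ m, ∑ i ∈ Finset.range (m + 1), ‖α i‖ * x ^ i ≤ a) {z : ℂ} (hz : ‖z‖ ≤ x) :
    Summable fun i => ‖z ^ i • α i‖ := by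
  have h1 : Summable fun i => ‖α i‖ * x ^ i :=
    summable_of_sum_range_le (fun _ => by positivity) (c := a) fun n => by
      refine le_trans (Finset.sum_le_sum_of_subset_of_nonneg
        (Finset.range_mono (Nat.le_succ n)) fun _ _ _ => by positivity) (ha n)
  refine Summable.of_nonneg_of_le (fun _ => norm_nonneg _) (fun i => ?_) h1
  rw [norm_smul, norm_pow, mul_comm]
  gcongr

/-- The value of the product of a power series in `z` with a double power series. -/
lemma hasSum_mul_bivariate {γ : ℕ → 𝔸} {g : ℕ × ℕ → 𝔸} {z u : ℂ}
    (hγ : Summable fun i => ‖z ^ i • γ i‖)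
    (hg : Summable fun p : ℕ × ℕ => ‖(z ^ p.1 * u ^ p.2) • g p‖) :
    HasSum (fun p : ℕ × ℕ => (z ^ p.1 * u ^ p.2) •
      ∑ q ∈ Finset.HasAntidiagonal.antidiagonal p.1, γ q.1 * g (q.2, p.2))
      ((∑' i, z ^ i • γ i) * ∑' p : ℕ × ℕ, (z ^ p.1 * u ^ p.2) • g p) := by
  have h1 := (summable_mul_of_summable_norm hγ hg).hasSum
  rw [← tsum_mul_tsum_of_summable_norm hγ hg] at h1
  -- The triples `(i, (j, n))` are fibred over `(m, n)` with `m = i + j`.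
  let e : (ℕ × ℕ) × ℕ ≃ ℕ × (ℕ × ℕ) := Equiv.prodAssoc ℕ ℕ ℕ
  let e' : ((Σ n : ℕ, Finset.HasAntidiagonal.antidiagonal n) × ℕ) ≃ (ℕ × ℕ) × ℕ :=
    (Finset.HasAntidiagonal.sigmaAntidiagonalEquivProd (A := ℕ)).prodCongr (Equiv.refl ℕ)
  let e'' : (Σ p : ℕ × ℕ, Finset.HasAntidiagonal.antidiagonal p.1) ≃
      ((Σ n : ℕ, Finset.HasAntidiagonal.antidiagonal n) × ℕ) :=
    { toFun := fun x => (⟨x.1.1, x.2⟩, x.1.2)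
      invFun := fun x => ⟨(x.1.1, x.2), x.1.2⟩
      left_inv := fun _ => rfl
      right_inv := fun _ => rfl }
  have h2 := (((e''.trans e').trans e).hasSum_iff.mpr h1)
  refine h2.sigma fun p => ?_
  convert hasSum_fintype _ using 1
  rw [← Finset.sum_coe_sort, Finset.smul_sum]
  refine Finset.sum_congr rfl fun q _ => ?_
  obtain ⟨⟨i, j⟩, hq⟩ := q
  obtain ⟨m, n⟩ := p
  obtain rfl := Finset.HasAntidiagonal.mem_antidiagonal.1 hq
  change _ = (z ^ i • γ i) * ((z ^ j * u ^ n) • g (j, n))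
  rw [smul_mul_smul_comm, pow_add]
  congr 1
  ring

/-- A double power series whose coefficients satisfy
`(m + c n) g (m, n) + P (g (m, n)) = [(α + u β) g] (m, n)` solves
`(z ∂_z + c u ∂_u) Y + P Y = (α(z) + u β(z)) Y`. -/
theorem hasDerivAt_bivariate_flow {α β : ℕ → 𝔸} {g : ℕ × ℕ → 𝔸} {P : 𝔸 →L[ℂ] 𝔸} {c : ℝ}
    {a b x y M : ℝ} (hx : 0 < x)
    (hrec : ∀ p : ℕ × ℕ, ((p.1 : ℂ) + c * p.2) • g p + P (g p) = mulCoeff α β g p)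
    (hg : ∀ p, ‖g p‖ * (x ^ p.1 * y ^ p.2) ≤ M)
    (ha : ∀ m, ∑ i ∈ Finset.range (m + 1), ‖α i‖ * x ^ i ≤ a)
    (hb : ∀ m, ∑ i ∈ Finset.range (m + 1), ‖β i‖ * x ^ i ≤ b)
    {z u : ℂ} (hz : ‖z‖ < x) (hu : ‖u‖ < y) :
    HasDerivAt (fun s : ℂ => ∑' p : ℕ × ℕ,
        ((Complex.exp s * z) ^ p.1 * (Complex.exp (c * s) * u) ^ p.2) • g p)
      (((∑' i, z ^ i • α i) + u • ∑' i, z ^ i • β i) *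
          (∑' p : ℕ × ℕ, (z ^ p.1 * u ^ p.2) • g p)
        - P (∑' p : ℕ × ℕ, (z ^ p.1 * u ^ p.2) • g p)) 0 := by
  obtain ⟨x', hzx', hx'⟩ := exists_between hz
  obtain ⟨y', huy', hy'⟩ := exists_between hu
  have hx'0 : 0 ≤ x' := (norm_nonneg z).trans hzx'.le
  have hy'0 : 0 ≤ y' := (norm_nonneg u).trans huy'.le
  have hsum := summable_bivariate hg hx'0 hx' hy'0 hy'
  have hgs : Summable fun p : ℕ × ℕ => ‖(z ^ p.1 * u ^ p.2) • g p‖ := by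
    refine Summable.of_nonneg_of_le (fun _ => norm_nonneg _) (fun p => ?_) hsum
    rw [norm_smul, norm_mul, norm_pow, norm_pow, mul_comm]
    gcongr
  -- Times for which the flow stays in a slightly smaller polydisc; there the series is uniformly
  -- dominated and can be differentiated termwise.
  let U : Set ℂ := {s | ‖Complex.exp s * z‖ < x' ∧ ‖Complex.exp (c * s) * u‖ < y'}
  have hU : IsOpen U := by
    have h1 : Continuous fun s : ℂ => ‖Complex.exp s * z‖ := by fun_prop
    have h2 : Continuous fun s : ℂ => ‖Complex.exp (c * s) * u‖ := by fun_prop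
    exact (isOpen_lt h1 continuous_const).inter (isOpen_lt h2 continuous_const)
  have h0 : (0 : ℂ) ∈ U := by simpa [U] using ⟨hzx', huy'⟩
  let F : ℕ × ℕ → ℂ → 𝔸 := fun p s =>
    ((Complex.exp s * z) ^ p.1 * (Complex.exp (c * s) * u) ^ p.2) • g p
  have hFd : ∀ p, Differentiable ℂ (F p) := fun p => by
    refine Differentiable.smul_const ?_ _
    fun_prop
  have hFle : ∀ p, ∀ s ∈ U, ‖F p s‖ ≤ ‖g p‖ * (x' ^ p.1 * y' ^ p.2) := fun p s hs => by
    simp only [F]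
    rw [norm_smul, norm_mul, norm_pow, norm_pow, mul_comm]
    have h1 := hs.1.le
    have h2 := hs.2.le
    gcongr
  -- The flow multiplies `zᵐ uⁿ` by `exp ((m + c n) s)`: monomials are eigenvectors of `z ∂_z + c u
  -- ∂_u`.
  have hF' : ∀ p, deriv (F p) 0 = (z ^ p.1 * u ^ p.2) • (((p.1 : ℂ) + c * p.2) • g p) := fun p => by
    have h1 : HasDerivAt (fun s : ℂ => (z ^ p.1 * u ^ p.2) *
        Complex.exp (((p.1 : ℂ) + c * p.2) * s))
        ((z ^ p.1 * u ^ p.2) * ((p.1 : ℂ) + c * p.2)) 0 := by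
      have := ((((hasDerivAt_id (0 : ℂ)).const_mul ((p.1 : ℂ) + c * p.2)).cexp).const_mul
        (z ^ p.1 * u ^ p.2))
      simpa using this
    have h2 : F p = fun s => ((z ^ p.1 * u ^ p.2) *
        Complex.exp (((p.1 : ℂ) + c * p.2) * s)) • g p := by
      funext s
      simp only [F]
      congr 1
      rw [mul_pow, mul_pow, ← Complex.exp_nat_mul, ← Complex.exp_nat_mul, add_mul, Complex.exp_add]
      ring_nf
    rw [h2, (h1.smul_const (g p)).deriv, smul_smul]
  have hd := Complex.hasSum_deriv_of_summable_norm hsum (fun p => (hFd p).differentiableOn) hU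
    hFle h0
  have hdiff : HasDerivAt (fun s => ∑' p, F p s) (deriv (fun s => ∑' p, F p s) 0) 0 :=
    ((Complex.differentiableOn_tsum_of_summable_norm hsum (fun p => (hFd p).differentiableOn) hU
      hFle).differentiableAt (hU.mem_nhds h0)).hasDerivAt
  have hα := summable_norm_of_sum_range_le hx ha hz.le
  have hβ := summable_norm_of_sum_range_le hx hb hz.le
  have hA := hasSum_mul_bivariate hα hgs
  have hB := (hasSum_mul_bivariate hβ hgs).const_smul u
  have hP : HasSum (fun p : ℕ × ℕ => (z ^ p.1 * u ^ p.2) • P (g p))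
      (P (∑' p : ℕ × ℕ, (z ^ p.1 * u ^ p.2) • g p)) := by
    have := P.hasSum hgs.of_norm.hasSum
    simpa only [map_smul] using this
  -- The `β`-part of `mulCoeff` vanishes for `n = 0` and is otherwise the convolution with `β`
  -- shifted by one in `n`, which accounts for the factor `u`.
  have hBs : HasSum (fun p : ℕ × ℕ => (z ^ p.1 * u ^ p.2) •
      (mulCoeff α β g p - ∑ q ∈ Finset.HasAntidiagonal.antidiagonal p.1, α q.1 * g (q.2, p.2)))
      (u • ((∑' i, z ^ i • β i) * ∑' p : ℕ × ℕ, (z ^ p.1 * u ^ p.2) • g p)) := by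
    have hinj : Function.Injective (fun p : ℕ × ℕ => (p.1, p.2 + 1)) := fun p q h => by
      simpa [Prod.ext_iff] using h
    refine (hinj.hasSum_iff ?_).1 ?_
    · rintro ⟨m, n⟩ hp
      cases n with
      | zero => simp [mulCoeff]
      | succ n => exact absurd ⟨(m, n), rfl⟩ hp
    · refine hB.congr_fun fun p => ?_
      simp only [Function.comp, mulCoeff, add_sub_cancel_left]
      rw [smul_smul, pow_succ]
      congr 1
      ring
  have htot := (hA.add hBs).sub hP
  have heq : ∀ p : ℕ × ℕ, (z ^ p.1 * u ^ p.2) • (∑ q ∈ Finset.HasAntidiagonal.antidiagonal p.1,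
        α q.1 * g (q.2, p.2)) + (z ^ p.1 * u ^ p.2) • (mulCoeff α β g p -
        ∑ q ∈ Finset.HasAntidiagonal.antidiagonal p.1, α q.1 * g (q.2, p.2))
        - (z ^ p.1 * u ^ p.2) • P (g p) = deriv (F p) 0 := fun p => by
    rw [hF', ← smul_add, ← smul_sub, add_sub_cancel, ← hrec, add_sub_cancel_right]
  have := hd.unique (htot.congr_fun fun p => (heq p).symm)
  rw [this] at hdiff
  rw [add_mul, smul_mul_assoc]
  exact hdiff

end Euler

/-! ### Connectedness after removal of a countable set. -/

/-- A convex open subset of the plane remains connected after removal of a countable set. -/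
theorem isPreconnected_convex_diff_countable {C s : Set ℂ} (hC : Convex ℝ C) (hCo : IsOpen C)
    (hs : s.Countable) : IsPreconnected (C \ s) := by
  refine isPreconnected_of_forall_pair fun a ha b hb => ?_
  rcases eq_or_ne a b with rfl | hab
  · exact ⟨{a}, by simpa using ha, rfl, rfl, isPreconnected_singleton⟩
  let c := (2 : ℝ)⁻¹ • (a + b)
  let x := (2 : ℝ)⁻¹ • (b - a)
  have Ia : c - x = a := by simp only [c, x]; module
  have Ib : c + x = b := by simp only [c, x]; module
  have hcC : c ∈ C := by
    have := hC ha.1 hb.1 (show (0 : ℝ) ≤ 2⁻¹ by norm_num) (show (0 : ℝ) ≤ 2⁻¹ by norm_num)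
      (by norm_num)
    simpa only [c, smul_add] using this
  have x_ne_zero : x ≠ 0 := by simpa [x] using sub_ne_zero.2 hab.symm
  obtain ⟨y, hy⟩ : ∃ y, LinearIndependent ℝ ![x, y] :=
    exists_linearIndependent_pair_of_one_lt_rank (by simp) x_ne_zero
  -- For distinct `t` these segments meet only at `c + x ∉ s`, so each point of `s` spoils at most
  -- one `t`. A generic small `t` then gives a broken path from `a` to `b` inside `C \ s`.
  have A : Set.Countable {t : ℝ | (segment ℝ (c + x) (c + t • y) ∩ s).Nonempty} := by
    refine Set.countable_ofPred_nonempty_of_disjoint ?_ (fun t => Set.inter_subset_right) hs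
    intro t t' htt'
    refine Set.disjoint_iff_inter_eq_empty.2 ?_
    have N : {c + x} ∩ s = ∅ := by
      simpa only [Set.singleton_inter_eq_empty, Ib] using hb.2
    rw [Set.inter_assoc, Set.inter_comm s, Set.inter_assoc, Set.inter_self, ← Set.inter_assoc,
      ← Set.subset_empty_iff, ← N]
    refine Set.inter_subset_inter_left _ (Eq.subset ?_)
    exact segment_inter_eq_endpoint_of_linearIndependent_of_ne hy htt'.symm _
  have B : Set.Countable {t : ℝ | (segment ℝ (c - x) (c + t • y) ∩ s).Nonempty} := by
    refine Set.countable_ofPred_nonempty_of_disjoint ?_ (fun t => Set.inter_subset_right) hs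
    intro t t' htt'
    refine Set.disjoint_iff_inter_eq_empty.2 ?_
    have N : {c - x} ∩ s = ∅ := by
      simpa only [Set.singleton_inter_eq_empty, Ia] using ha.2
    rw [Set.inter_assoc, Set.inter_comm s, Set.inter_assoc, Set.inter_self, ← Set.inter_assoc,
      ← Set.subset_empty_iff, ← N]
    refine Set.inter_subset_inter_left _ ?_
    rw [sub_eq_add_neg _ x]
    refine Eq.subset ?_
    refine segment_inter_eq_endpoint_of_linearIndependent_of_ne ?_ htt'.symm _
    convert! hy.units_smul ![-1, 1]
    simp [← List.ofFn_inj]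
  have hopen : IsOpen {t : ℝ | c + t • y ∈ C} := hCo.preimage (by fun_prop)
  obtain ⟨t, htC, ht⟩ := ((A.union B).dense_compl ℝ).inter_open_nonempty _ hopen ⟨0, by simpa⟩
  simp only [Set.compl_union, Set.mem_inter_iff, Set.mem_compl_iff, Set.mem_ofPred_eq,
    Set.not_nonempty_iff_eq_empty] at ht
  have hz : c + t • y ∈ C := htC
  refine ⟨segment ℝ a (c + t • y) ∪ segment ℝ b (c + t • y), ?_, Or.inl (left_mem_segment _ _ _),
    Or.inr (left_mem_segment _ _ _), ?_⟩
  · rw [Ia, Ib] at ht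
    refine Set.union_subset ?_ ?_
    · exact Set.subset_sdiff.2 ⟨hC.segment_subset ha.1 hz, Set.disjoint_iff_inter_eq_empty.2 ht.2⟩
    · exact Set.subset_sdiff.2 ⟨hC.segment_subset hb.1 hz, Set.disjoint_iff_inter_eq_empty.2 ht.1⟩
  · exact IsPreconnected.union _ (right_mem_segment _ _ _) (right_mem_segment _ _ _)
      (convex_segment _ _).isPreconnected (convex_segment _ _).isPreconnected

/-! ### Uniqueness, gluing and continuation for linear differential equations. -/

section LinearODE

variable {V : Type*} [NormedAddCommGroup V] [NormedSpace ℂ V]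

/-- `φ' = B φ` on the set `U`. -/
def IsSolution (B : ℂ → V →L[ℂ] V) (φ : ℂ → V) (U : Set ℂ) : Prop :=
  ∀ ζ ∈ U, HasDerivAt φ (B ζ (φ ζ)) ζ

variable {B : ℂ → V →L[ℂ] V} {φ ψ : ℂ → V} {U W : Set ℂ}

lemma IsSolution.mono (h : IsSolution B φ U) (hW : W ⊆ U) : IsSolution B φ W :=
  fun ζ hζ => h ζ (hW hζ)

lemma IsSolution.sub (h : IsSolution B φ U) (h' : IsSolution B ψ U) :
    IsSolution B (fun ζ => φ ζ - ψ ζ) U := fun ζ hζ => by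
  rw [map_sub]
  exact (h ζ hζ).sub (h' ζ hζ)

/-- Grönwall's inequality for the difference along the segment from `ζ₁` to `ζ`, where the
coefficient is bounded by compactness. -/
lemma IsSolution.eqOn_of_convex (hU : Convex ℝ U) (hB : ContinuousOn B U)
    (h : IsSolution B φ U) (h' : IsSolution B ψ U) {ζ₁ : ℂ} (h₁ : ζ₁ ∈ U) (he : φ ζ₁ = ψ ζ₁) :
    Set.EqOn φ ψ U := by
  intro ζ hζ
  have hd := h.sub h'
  let γ : ℝ → ℂ := fun t => ζ₁ + t * (ζ - ζ₁)
  have hγ : ∀ t ∈ Set.Icc (0 : ℝ) 1, γ t ∈ U := fun t ht => by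
    have := hU h₁ hζ (sub_nonneg.2 ht.2) ht.1 (by ring)
    convert this using 1
    simp only [γ, Complex.real_smul]; push_cast; ring
  have hγd : ∀ t : ℝ, HasDerivAt γ (ζ - ζ₁) t := fun t => by
    have := ((Complex.ofRealCLM.hasDerivAt (x := t)).mul_const (ζ - ζ₁)).const_add ζ₁
    rw [Complex.ofRealCLM_apply, Complex.ofReal_one, one_mul] at this
    exact this
  have hγc : Continuous γ := by fun_prop
  obtain ⟨K, hK⟩ := (isCompact_Icc (a := (0 : ℝ)) (b := 1)).exists_bound_of_continuousOn
    (hB.comp hγc.continuousOn hγ)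
  have hder : ∀ t ∈ Set.Icc (0 : ℝ) 1, HasDerivAt (fun t => φ (γ t) - ψ (γ t))
      ((ζ - ζ₁) • B (γ t) (φ (γ t) - ψ (γ t))) t := fun t ht => by
    exact (hd _ (hγ t ht)).scomp t (hγd t)
  have := eq_zero_of_abs_deriv_le_mul_abs_self_of_eq_zero_right (K := ‖ζ - ζ₁‖ * K)
    (fun t ht => (hder t ht).continuousAt.continuousWithinAt)
    (fun t ht => (hder t ⟨ht.1, ht.2.le⟩).hasDerivWithinAt) (by simp [γ, he])
    (fun t ht => by
      rw [norm_smul, mul_assoc]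
      refine mul_le_mul_of_nonneg_left ?_ (norm_nonneg _)
      exact (ContinuousLinearMap.le_opNorm _ _).trans
        (mul_le_mul_of_nonneg_right (hK t ⟨ht.1, ht.2.le⟩) (norm_nonneg _)))
    1 ⟨zero_le_one, le_rfl⟩
  simpa [γ, sub_eq_zero] using this

variable [CompleteSpace V]

lemma IsSolution.analyticOnNhd (hU : IsOpen U) (h : IsSolution B φ U) : AnalyticOnNhd ℂ φ U :=
  DifferentiableOn.analyticOnNhd
    (fun ζ hζ => (h ζ hζ).differentiableAt.differentiableWithinAt) hU

/-- Agreement on a small disc by the convex case spreads by the identity theorem. -/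
theorem IsSolution.eqOn_of_isPreconnected (hU : IsOpen U) (hU' : IsPreconnected U)
    (hB : ContinuousOn B U) (h : IsSolution B φ U) (h' : IsSolution B ψ U) {ζ₁ : ℂ}
    (h₁ : ζ₁ ∈ U) (he : φ ζ₁ = ψ ζ₁) : Set.EqOn φ ψ U := by
  obtain ⟨ε, hε, hεU⟩ := Metric.isOpen_iff.1 hU ζ₁ h₁
  refine (h.analyticOnNhd hU).eqOn_of_preconnected_of_eventuallyEq (h'.analyticOnNhd hU) hU' h₁ ?_
  filter_upwards [Metric.ball_mem_nhds ζ₁ hε] with ζ hζ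
  exact IsSolution.eqOn_of_convex (convex_ball ζ₁ ε) (hB.mono hεU) (h.mono hεU) (h'.mono hεU)
    (Metric.mem_ball_self hε) he hζ

omit [CompleteSpace V] in
/-- Solutions on open sets which agree on overlaps glue. -/
lemma IsSolution.exists_glue {ι : Type*} {U : ι → Set ℂ} (hU : ∀ i, IsOpen (U i))
    {φ : ι → ℂ → V} (h : ∀ i, IsSolution B (φ i) (U i))
    (hag : ∀ i j, Set.EqOn (φ i) (φ j) (U i ∩ U j)) :
    ∃ ψ : ℂ → V, IsSolution B ψ (⋃ i, U i) ∧ ∀ i, Set.EqOn ψ (φ i) (U i) := by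
  classical
  let ψ : ℂ → V := fun ζ => if hζ : ∃ i, ζ ∈ U i then φ hζ.choose ζ else 0
  have hψ : ∀ i, Set.EqOn ψ (φ i) (U i) := fun i ζ hζ => by
    have hex : ∃ i, ζ ∈ U i := ⟨i, hζ⟩
    simp only [ψ, hex, dif_pos]
    exact hag _ _ ⟨hex.choose_spec, hζ⟩
  refine ⟨ψ, fun ζ hζ => ?_, hψ⟩
  obtain ⟨i, hi⟩ := Set.mem_iUnion.1 hζ
  have hev : ψ =ᶠ[𝓝 ζ] φ i := (hψ i).eventuallyEq_of_mem ((hU i).mem_nhds hi)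
  rw [hψ i hi]
  exact (h i ζ hi).congr_of_eventuallyEq hev

/-- A linear differential equation on the plane minus a closed countable set, all of whose
local solutions are single-valued, has global single-valued solutions. -/
theorem exists_global_solution {Z : Set ℂ} (hZ : IsClosed Z) (hZc : Z.Countable)
    (hB : ContinuousOn B Zᶜ)
    (hloc : ∀ ζ₀ : ℂ, ∃ ε > 0, ∀ ζ₁ ∈ Metric.ball ζ₀ ε \ Z, ∀ w : V, ∃ ψ : ℂ → V, ψ ζ₁ = w ∧
      IsSolution B ψ (Metric.ball ζ₀ ε \ Z))
    {c : ℂ} (hc : c ∉ Z) (w : V) : ∃ ψ : ℂ → V, ψ c = w ∧ IsSolution B ψ Zᶜ := by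
  -- The set of radii of discs about `c` carrying the solution. It is nonempty, contains its
  -- supremum if bounded, and has no largest element; hence it is unbounded.
  let T : Set ℝ := {R | 0 < R ∧ ∃ ψ : ℂ → V, ψ c = w ∧ IsSolution B ψ (Metric.ball c R \ Z)}
  have huniq : ∀ {U : Set ℂ} {φ ψ : ℂ → V}, Convex ℝ U → IsOpen U → IsSolution B φ (U \ Z) →
      IsSolution B ψ (U \ Z) → ∀ {ζ}, ζ ∈ U \ Z → φ ζ = ψ ζ → Set.EqOn φ ψ (U \ Z) :=
    fun hU hUo h h' ζ hζ he => h.eqOn_of_isPreconnected (hUo.sdiff hZ)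
      (isPreconnected_convex_diff_countable hU hUo hZc) (hB.mono fun x hx => hx.2) h' hζ he
  have hdense : ∀ {U : Set ℂ}, IsOpen U → U.Nonempty → (U \ Z).Nonempty := fun hU hne =>
    (hZc.dense_compl ℝ).inter_open_nonempty _ hU hne
  have hsup : ∀ S : Set ℝ, S.Nonempty → S ⊆ T → ∃ ψ : ℂ → V, ψ c = w ∧
      IsSolution B ψ (⋃ R : S, Metric.ball c R \ Z) := fun S hS hST => by
    choose φ hφc hφ using fun R : S => (hST R.2).2
    obtain ⟨ψ, hψ, hψ'⟩ := IsSolution.exists_glue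
      (fun R : S => (Metric.isOpen_ball (x := c) (ε := (R : ℝ))).sdiff hZ) hφ (fun R R' => by
        have : (Metric.ball c R \ Z) ∩ (Metric.ball c R' \ Z)
            = (Metric.ball c R ∩ Metric.ball c R') \ Z := by
          ext; simp only [Set.mem_inter_iff, Set.mem_sdiff]; tauto
        rw [this]
        refine huniq ((convex_ball _ _).inter (convex_ball _ _))
          (Metric.isOpen_ball.inter Metric.isOpen_ball)
          ((hφ R).mono fun x hx => ⟨hx.1.1, hx.2⟩) ((hφ R').mono fun x hx => ⟨hx.1.2, hx.2⟩)
          (ζ := c) ⟨⟨?_, ?_⟩, hc⟩ ((hφc R).trans (hφc R').symm)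
        · exact Metric.mem_ball_self (hST R.2).1
        · exact Metric.mem_ball_self (hST R'.2).1)
    obtain ⟨R, hR⟩ := hS
    refine ⟨ψ, ?_, hψ⟩
    rw [hψ' ⟨R, hR⟩ ⟨Metric.mem_ball_self (hST hR).1, hc⟩]
    exact hφc _
  have hT0 : T.Nonempty := by
    obtain ⟨ε, hε, h⟩ := hloc c
    exact ⟨ε, hε, h c ⟨Metric.mem_ball_self hε, hc⟩ w⟩
  -- Around each point of the boundary circle a local solution is matched with `ψ` at one point
  -- inside the disc; these extensions have to agree with each other.
  have hstep : ∀ R ∈ T, ∃ R' ∈ T, R < R' := by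
    rintro R ⟨hR, ψ, hψc, hψ⟩
    choose ε hε hε' using hloc
    have hmeet : ∀ p : Metric.sphere c R,
        ((Metric.ball (p : ℂ) (ε p) ∩ Metric.ball c R) \ Z).Nonempty := fun p => by
      refine hdense (Metric.isOpen_ball.inter Metric.isOpen_ball) ?_
      have : (p : ℂ) ∈ closure (Metric.ball c R) := by
        rw [closure_ball _ hR.ne']; exact Metric.sphere_subset_closedBall p.2
      exact mem_closure_iff.1 this _ Metric.isOpen_ball (Metric.mem_ball_self (hε _))
    choose q hq using hmeet
    choose φ hφq hφ using fun p : Metric.sphere c R =>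
      hε' p (q p) ⟨(hq p).1.1, (hq p).2⟩ (ψ (q p))
    have hag1 : ∀ p, Set.EqOn (φ p) ψ ((Metric.ball (p : ℂ) (ε p) ∩ Metric.ball c R) \ Z) :=
      fun p => huniq ((convex_ball _ _).inter (convex_ball _ _))
        (Metric.isOpen_ball.inter Metric.isOpen_ball)
        ((hφ p).mono fun x hx => ⟨hx.1.1, hx.2⟩) (hψ.mono fun x hx => ⟨hx.1.2, hx.2⟩)
        (hq p) (hφq p)
    have hag2 : ∀ p p', Set.EqOn (φ p) (φ p')
        ((Metric.ball (p : ℂ) (ε p) ∩ Metric.ball (p' : ℂ) (ε p')) \ Z) := fun p p' => by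
      rcases eq_or_ne p p' with rfl | hne
      · exact fun _ _ => rfl
      intro ζ hζ
      have hlt : dist (p : ℂ) p' < ε p + ε p' := by
        have h1 := hζ.1.1; have h2 := hζ.1.2
        rw [Metric.mem_ball, dist_comm] at h1
        rw [Metric.mem_ball] at h2
        exact (dist_triangle _ _ _).trans_lt (add_lt_add h1 h2)
      have hne' : (p : ℂ) ≠ p' := fun h => hne (Subtype.ext h)
      -- The point dividing the chord from `p` to `p'` in the ratio of the radii lies in both balls,
      -- and by strict convexity inside the disc. So overlapping balls also overlap within the disc,
      -- where both extensions equal `ψ`.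
      have hx : ((Metric.ball (p : ℂ) (ε p) ∩ Metric.ball (p' : ℂ) (ε p'))
          ∩ Metric.ball c R).Nonempty := by
        have hs : 0 < ε p + ε p' := add_pos (hε _) (hε _)
        let t := ε p' / (ε p + ε p')
        have ht0 : 0 < t := div_pos (hε _) hs
        have ht1 : ε p / (ε p + ε p') = 1 - t := by simp only [t]; field_simp; ring
        have ht1' : 0 < 1 - t := ht1 ▸ div_pos (hε _) hs
        have hd : dist (p : ℂ) p' = ‖(p' : ℂ) - p‖ := by rw [dist_comm, dist_eq_norm]
        refine ⟨t • (p : ℂ) + (1 - t) • (p' : ℂ), ⟨?_, ?_⟩, ?_⟩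
        · rw [Metric.mem_ball, dist_eq_norm,
            show t • (p : ℂ) + (1 - t) • (p' : ℂ) - p = (1 - t) • ((p' : ℂ) - p) by module,
            norm_smul, Real.norm_of_nonneg ht1'.le, ← hd, ← ht1, div_mul_eq_mul_div,
            div_lt_iff₀ hs]
          exact mul_lt_mul_of_pos_left hlt (hε _)
        · rw [Metric.mem_ball, dist_eq_norm,
            show t • (p : ℂ) + (1 - t) • (p' : ℂ) - p' = (-t) • ((p' : ℂ) - p) by module,
            norm_smul, norm_neg, Real.norm_of_nonneg ht0.le, ← hd, div_mul_eq_mul_div,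
            div_lt_iff₀ hs]
          exact mul_lt_mul_of_pos_left hlt (hε _)
        · have := (strictConvex_closedBall ℝ c R)
            (Metric.sphere_subset_closedBall p.2) (Metric.sphere_subset_closedBall p'.2) hne'
            ht0 ht1' (by ring)
          rwa [interior_closedBall _ hR.ne'] at this
      obtain ⟨ξ, hξ⟩ := hdense
        ((Metric.isOpen_ball.inter Metric.isOpen_ball).inter Metric.isOpen_ball) hx
      refine huniq ((convex_ball _ _).inter (convex_ball _ _))
        (Metric.isOpen_ball.inter Metric.isOpen_ball)
        ((hφ p).mono fun x hx => ⟨hx.1.1, hx.2⟩) ((hφ p').mono fun x hx => ⟨hx.1.2, hx.2⟩)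
        (ζ := ξ) ⟨hξ.1.1, hξ.2⟩ ?_ hζ
      rw [hag1 p ⟨⟨hξ.1.1.1, hξ.1.2⟩, hξ.2⟩, hag1 p' ⟨⟨hξ.1.1.2, hξ.1.2⟩, hξ.2⟩]
    let U : Option (Metric.sphere c R) → Set ℂ := fun o =>
      o.elim (Metric.ball c R) fun p => Metric.ball (p : ℂ) (ε p)
    let Φ : Option (Metric.sphere c R) → ℂ → V := fun o => o.elim ψ φ
    have hUo : ∀ o, IsOpen (U o) := by rintro (_ | p) <;> exact Metric.isOpen_ball
    obtain ⟨χ, hχ, hχ'⟩ := IsSolution.exists_glue (B := B) (U := fun o => U o \ Z) (φ := Φ)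
      (fun o => (hUo o).sdiff hZ) (by rintro (_ | p); exacts [hψ, hφ p]) (by
        rintro (_ | p) (_ | p') x ⟨hx, hx'⟩
        · rfl
        · exact (hag1 p' ⟨⟨hx'.1, hx.1⟩, hx.2⟩).symm
        · exact hag1 p ⟨⟨hx.1, hx'.1⟩, hx.2⟩
        · exact hag2 p p' ⟨⟨hx.1, hx'.1⟩, hx.2⟩)
    have hcov : Metric.closedBall c R ⊆ ⋃ o, U o := fun x hx => by
      rcases eq_or_ne (dist x c) R with h | h
      · exact Set.mem_iUnion.2 ⟨some ⟨x, h⟩, Metric.mem_ball_self (hε _)⟩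
      · exact Set.mem_iUnion.2 ⟨none, lt_of_le_of_ne hx h⟩
    -- Compactness turns the cover of the closed disc into a disc of larger radius `δ + R`.
    obtain ⟨δ, hδ, hsub⟩ := (isCompact_closedBall c R).exists_thickening_subset_open
      (isOpen_iUnion hUo) hcov
    rw [thickening_closedBall hδ hR.le] at hsub
    refine ⟨δ + R, ⟨by positivity, χ, ?_, hχ.mono fun x hx => ?_⟩, by linarith⟩
    · rw [hχ' none ⟨Metric.mem_ball_self hR, hc⟩]; exact hψc
    · obtain ⟨o, ho⟩ := Set.mem_iUnion.1 (hsub hx.1)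
      exact Set.mem_iUnion.2 ⟨o, ho, hx.2⟩
  have hunb : ¬ BddAbove T := fun hbdd => by
    have hpos : 0 < sSup T := by
      obtain ⟨R, hR⟩ := hT0
      exact hR.1.trans_le (le_csSup hbdd hR)
    have hmem : sSup T ∈ T := by
      obtain ⟨ψ, hψc, hψ⟩ := hsup T hT0 subset_rfl
      refine ⟨hpos, ψ, hψc, hψ.mono fun x hx => ?_⟩
      obtain ⟨R, hR, hlt⟩ := exists_lt_of_lt_csSup hT0 hx.1
      exact Set.mem_iUnion.2 ⟨⟨R, hR⟩, hlt, hx.2⟩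
    obtain ⟨R', hR', hlt⟩ := hstep _ hmem
    exact absurd (le_csSup hbdd hR') (not_le.2 hlt)
  obtain ⟨ψ, hψc, hψ⟩ := hsup T hT0 subset_rfl
  refine ⟨ψ, hψc, hψ.mono fun x hx => ?_⟩
  obtain ⟨R, hR, hlt⟩ := not_bddAbove_iff.1 hunb (dist x c)
  exact Set.mem_iUnion.2 ⟨⟨R, hR⟩, hlt, hx⟩

end LinearODE

/-! ### Analytic solutions of the Euler-type equation, and local propagators. -/

section Existence

variable {𝔸 : Type*} [NormedRing 𝔸] [NormedAlgebra ℂ 𝔸]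

/-- Taylor coefficients of an analytic function, with a geometric bound. -/
lemma exists_taylor_bound {α : ℂ → 𝔸} (hα : AnalyticAt ℂ α 0) :
    ∃ (c : ℕ → 𝔸) (r A : ℝ), 0 < r ∧ c 0 = α 0 ∧ (∀ z : ℂ, ‖z‖ < r →
      HasSum (fun i => z ^ i • c i) (α z)) ∧
      ∀ x, 0 < x → x ≤ r → ∀ m, ∑ i ∈ Finset.range (m + 1), ‖c i‖ * x ^ i ≤ ‖α 0‖ + x * A := by
  obtain ⟨p, hp⟩ := hα
  obtain ⟨R, hR⟩ := hp
  obtain ⟨r, hr0, hrR⟩ := ENNReal.lt_iff_exists_nnreal_btwn.1 hR.r_pos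
  have hr0' : 0 < (r : ℝ) := by exact_mod_cast hr0
  have hs := p.summable_norm_mul_pow (hrR.trans_le hR.r_le)
  have hc0 : p.coeff 0 = α 0 := by
    have := hR.coeff_zero (fun _ => (0 : ℂ))
    rw [← this, FormalMultilinearSeries.coeff]
    congr 1
    exact Subsingleton.elim _ _
  refine ⟨p.coeff, r, (∑' n, ‖p n‖ * (r : ℝ) ^ n) / r, hr0', hc0, fun z hz => ?_,
    fun x hx hxr m => ?_⟩
  · have hz' : z ∈ Metric.eball (0 : ℂ) R := by
      refine Metric.eball_subset_eball hrR.le ?_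
      rw [Metric.eball_coe]
      simpa using hz
    have := hR.hasSum hz'
    rw [zero_add] at this
    refine this.congr_fun fun n => ?_
    exact (p.apply_eq_pow_smul_coeff ..).symm
  · rw [Finset.sum_range_succ']
    rw [pow_zero, mul_one, hc0, add_comm]
    refine add_le_add_right ?_ _
    have h1 : ∑ i ∈ Finset.range m, ‖p.coeff (i + 1)‖ * (r : ℝ) ^ (i + 1)
        ≤ ∑' n, ‖p n‖ * (r : ℝ) ^ n := by
      have := hs.sum_le_tsum (Finset.range (m + 1)) (fun _ _ => by positivity)
      rw [Finset.sum_range_succ'] at this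
      simp only [FormalMultilinearSeries.norm_apply_eq_norm_coef] at this ⊢
      have h0 : 0 ≤ ‖p.coeff 0‖ * (r : ℝ) ^ 0 := by positivity
      linarith
    -- For `x ≤ r`, `x^(i+1) ≤ (x / r) r^(i+1)`: the tail is linear in `x`, so the bound tends to
    -- `‖α 0‖` as `x → 0`.
    calc ∑ i ∈ Finset.range m, ‖p.coeff (i + 1)‖ * x ^ (i + 1)
        ≤ ∑ i ∈ Finset.range m, (x / r) * (‖p.coeff (i + 1)‖ * (r : ℝ) ^ (i + 1)) := by
          refine Finset.sum_le_sum fun i _ => ?_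
          have h2 : x ^ i ≤ (r : ℝ) ^ i := by gcongr
          have : (x / r) * (‖p.coeff (i + 1)‖ * (r : ℝ) ^ (i + 1))
              = ‖p.coeff (i + 1)‖ * (x * (r : ℝ) ^ i) := by
            rw [pow_succ]; field_simp
          rw [this, pow_succ, mul_comm (x ^ i) x]
          gcongr
      _ = (x / r) * ∑ i ∈ Finset.range m, ‖p.coeff (i + 1)‖ * (r : ℝ) ^ (i + 1) := by
          rw [Finset.mul_sum]
      _ ≤ (x / r) * ∑' n, ‖p n‖ * (r : ℝ) ^ n := by gcongr
      _ = _ := by ring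

variable [CompleteSpace 𝔸]

/-- Existence of analytic solutions of
`(z ∂_z + c u ∂_u) G + P G = (α(z) + u β(z)) G` with `G (0, 0) = 1`. -/
theorem exists_bivariate_flow {α β : ℂ → 𝔸} (hα : AnalyticAt ℂ α 0) (hβ : AnalyticAt ℂ β 0)
    (hα0 : α 0 = 0) {P : 𝔸 →L[ℂ] 𝔸} (hP : P 1 = 0) {c C y : ℝ} (hC : 0 ≤ C) (hy : 0 < y)
    (hCy : C * (y * ‖β 0‖) < 1)
    (hR : ∀ p : ℕ × ℕ, p ≠ 0 → (p.1 = 0 → β 0 ≠ 0) → ∀ X : 𝔸, ∃ Y : 𝔸,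
      ((p.1 : ℂ) + c * p.2) • Y + P Y = X ∧ ‖Y‖ ≤ C * ‖X‖) :
    ∃ x > 0, ∃ G : ℂ × ℂ → 𝔸, AnalyticOnNhd ℂ G (Metric.ball 0 x ×ˢ Metric.ball 0 y) ∧
      G 0 = 1 ∧ (β 0 = 0 → ∀ u, G (0, u) = 1) ∧
      ∀ z u : ℂ, ‖z‖ < x → ‖u‖ < y →
        HasDerivAt (fun s : ℂ => G (Complex.exp s * z, Complex.exp (c * s) * u))
          ((α z + u • β z) * G (z, u) - P (G (z, u))) 0 := by
  classical
  obtain ⟨a, r₁, A, hr₁, ha0, hasum, habd⟩ := exists_taylor_bound hα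
  obtain ⟨b, r₂, B, hr₂, hb0, hbsum, hbbd⟩ := exists_taylor_bound hβ
  rw [hα0] at ha0 habd
  -- The condition of `norm_recursive_le`; at `x = 0` it is the strict inequality `hCy`, since `α 0
  -- = 0`, so it persists for small `x`.
  obtain ⟨x, hx0, hxr₁, hxr₂, hx⟩ : ∃ x : ℝ, 0 < x ∧ x ≤ r₁ ∧ x ≤ r₂ ∧
      C * (x * A + y * (‖β 0‖ + x * B)) ≤ 1 := by
    have hcont : Continuous fun x : ℝ => C * (x * A + y * (‖β 0‖ + x * B)) := by fun_prop
    have h1 : ∀ᶠ x in 𝓝[>] (0 : ℝ), C * (x * A + y * (‖β 0‖ + x * B)) < 1 := by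
      refine nhdsWithin_le_nhds (hcont.continuousAt.eventually_lt continuousAt_const ?_)
      simpa using hCy
    have h2 : ∀ᶠ x in 𝓝[>] (0 : ℝ), x < r₁ := nhdsWithin_le_nhds (eventually_lt_nhds hr₁)
    have h3 : ∀ᶠ x in 𝓝[>] (0 : ℝ), x < r₂ := nhdsWithin_le_nhds (eventually_lt_nhds hr₂)
    obtain ⟨x, hx1, hx2, hx3, hx4⟩ := (h1.and (h2.and (h3.and self_mem_nhdsWithin))).exists
    exact ⟨x, hx4, hx2.le, hx3.le, hx1.le⟩
  choose! R₀ hR₀ hR₀' using hR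
  -- If `β 0 = 0`, the right-hand side vanishes at every `(0, n)`, so `g (0, n) = 0` for `n > 0`
  -- solves the equation there even if the operator is not invertible. This case serves the
  -- propagators, where `c = 0`.
  let R : ℕ × ℕ → 𝔸 → 𝔸 := fun p X => if p ≠ 0 ∧ (p.1 = 0 → β 0 ≠ 0) then R₀ p X else 0
  have hRn : ∀ p X, ‖R p X‖ ≤ C * ‖X‖ := fun p X => by
    simp only [R]
    split_ifs with h
    · exact hR₀' p h.1 h.2 X
    · rw [norm_zero]; positivity
  obtain ⟨g, hg0, hg⟩ := exists_recursive_solution (β := b) ha0 R 1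
  have hbound := norm_recursive_le ha0 hg hC hx0 hy hRn
    (fun m => (habd x hx0 hxr₁ m).trans_eq (by rw [norm_zero, zero_add]))
    (hbbd x hx0 hxr₂) hx
  have hmul0 : β 0 = 0 → ∀ n, mulCoeff a b g (0, n) = 0 := fun h n => by
    rw [h] at hb0
    cases n <;> simp [mulCoeff, ha0, hb0]
  have hrec : ∀ p : ℕ × ℕ, ((p.1 : ℂ) + c * p.2) • g p + P (g p) = mulCoeff a b g p := by
    intro p
    rcases eq_or_ne p 0 with rfl | hp
    · have : mulCoeff a b g 0 = 0 := by
        change mulCoeff a b g (0, 0) = 0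
        simp [mulCoeff, ha0]
      rw [this, hg0, hP]
      simp
    · by_cases h : p.1 = 0 → β 0 ≠ 0
      · have h1 : g p = R₀ p (mulCoeff a b g p) := by
          conv_lhs => rw [hg p hp]
          exact if_pos ⟨hp, h⟩
        conv_lhs => rw [h1]
        exact hR₀ p hp h _
      · have h1 : g p = 0 := by
          rw [hg p hp]
          simp only [R, h, and_false, if_false]
        push Not at h
        obtain ⟨m, n⟩ := p
        obtain rfl : m = 0 := h.1
        rw [h1, hmul0 h.2]
        simp
  refine ⟨x, hx0, fun v => ∑' p : ℕ × ℕ, (v.1 ^ p.1 * v.2 ^ p.2) • g p,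
    analyticOnNhd_bivariate hx0 hy hbound, ?_, fun h0 u => ?_, fun z u hz hu => ?_⟩
  · beta_reduce
    rw [tsum_eq_single 0]
    · simp [hg0]
    · intro p hp
      rcases Nat.eq_zero_or_pos p.1 with h | h
      · have : p.2 ≠ 0 := fun h' => hp (Prod.ext h h')
        simp [this]
      · simp [h.ne']
  · beta_reduce
    rw [tsum_eq_single 0]
    · simp [hg0]
    · rintro ⟨m, n⟩ hp
      rcases Nat.eq_zero_or_pos m with rfl | h
      · have : g (0, n) = 0 := by
          rw [hg _ hp]
          simp [R, h0]
        simp [this]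
      · simp [h.ne']
  · have := hasDerivAt_bivariate_flow hx0 hrec hbound
      (fun m => (habd x hx0 hxr₁ m)) (hbbd x hx0 hxr₂) hz hu
    rw [(hasum z (hz.trans_le hxr₁)).tsum_eq, (hbsum z (hz.trans_le hxr₂)).tsum_eq] at this
    exact this

/-- Local propagators of a linear differential equation depending on a parameter. -/
theorem exists_local_propagator {B₀ B₁ : ℂ → 𝔸} {ζ₀ : ℂ} (h₀ : AnalyticAt ℂ B₀ ζ₀)
    (h₁ : AnalyticAt ℂ B₁ ζ₀) {y : ℝ} (hy : 0 < y) :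
    ∃ ε > 0, ∃ G : ℂ × ℂ → 𝔸, AnalyticOnNhd ℂ G (Metric.ball ζ₀ ε ×ˢ Metric.ball 0 y) ∧
      (∀ u, G (ζ₀, u) = 1) ∧ ∀ ζ ∈ Metric.ball ζ₀ ε, ∀ u ∈ Metric.ball (0 : ℂ) y,
        HasDerivAt (fun ζ' => G (ζ', u)) ((B₀ ζ + u • B₁ ζ) * G (ζ, u)) ζ := by
  have hshift : AnalyticAt ℂ (fun t : ℂ => ζ₀ + t) 0 := by fun_prop
  have hB₀ : AnalyticAt ℂ (fun t : ℂ => B₀ (ζ₀ + t)) 0 :=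
    AnalyticAt.fun_comp (g := B₀) (by simpa using h₀) hshift
  have hB₁ : AnalyticAt ℂ (fun t : ℂ => B₁ (ζ₀ + t)) 0 :=
    AnalyticAt.fun_comp (g := B₁) (by simpa using h₁) hshift
  -- The regular equation multiplied by `t = ζ - ζ₀` is of Euler type. With `c = 0` the parameter
  -- `u` is inert, and as both coefficients vanish at `t = 0`, the radius `y` may be arbitrary.
  obtain ⟨x, hx, G, hG, -, hG1, hGd⟩ := exists_bivariate_flow (P := 0) (c := 0) (C := 1)
    (α := fun t => t • B₀ (ζ₀ + t)) (β := fun t => t • B₁ (ζ₀ + t))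
    (analyticAt_id.smul hB₀) (analyticAt_id.smul hB₁) (by simp) rfl zero_le_one hy (by simp)
    (fun p hp hp' X => by
      have h1 : p.1 ≠ 0 := fun h => hp' h (by simp)
      have h2 : (p.1 : ℂ) ≠ 0 := by exact_mod_cast h1
      refine ⟨(p.1 : ℂ)⁻¹ • X, by simp [smul_smul, h2], ?_⟩
      rw [norm_smul, norm_inv, Complex.norm_natCast]
      refine mul_le_mul_of_nonneg_right (inv_le_one_of_one_le₀ ?_) (norm_nonneg _)
      exact_mod_cast Nat.one_le_iff_ne_zero.2 h1)
  have hball : ∀ {ε u : ℂ} {r : ℝ}, u ∈ Metric.ball ε r ↔ ‖u - ε‖ < r := fun {_ _ _} => by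
    rw [Metric.mem_ball, dist_eq_norm]
  obtain ⟨ε₀, hε₀, hε₀'⟩ := Metric.eventually_nhds_iff_ball.1
    (h₀.eventually_analyticAt.and h₁.eventually_analyticAt)
  let G' : ℂ × ℂ → 𝔸 := fun v => G (v.1 - ζ₀, v.2)
  have hG' : AnalyticOnNhd ℂ G' (Metric.ball ζ₀ x ×ˢ Metric.ball 0 y) := by
    have h2 : AnalyticOnNhd ℂ (fun v : ℂ × ℂ => (v.1 - ζ₀, v.2))
        (Metric.ball ζ₀ x ×ˢ Metric.ball 0 y) :=
      (analyticOnNhd_fst.sub analyticOnNhd_const).prod analyticOnNhd_snd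
    exact hG.comp h2 fun v hv => ⟨by simpa [dist_eq_norm] using hv.1, hv.2⟩
  have han : ∀ u ∈ Metric.ball (0 : ℂ) y, AnalyticOnNhd ℂ (fun ζ => G' (ζ, u))
      (Metric.ball ζ₀ x) := fun u hu => by
    have h2 : AnalyticOnNhd ℂ (fun ζ : ℂ => (ζ, u)) (Metric.ball ζ₀ x) :=
      analyticOnNhd_id.prod analyticOnNhd_const
    exact hG'.comp h2 fun ζ hζ => ⟨hζ, hu⟩
  have hne : ∀ u ∈ Metric.ball (0 : ℂ) y, ∀ ζ ∈ Metric.ball ζ₀ x, ζ ≠ ζ₀ →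
      deriv (fun ζ' => G' (ζ', u)) ζ = (B₀ ζ + u • B₁ ζ) * G' (ζ, u) := by
    intro u hu ζ hζ hζ₀
    have hz : ζ - ζ₀ ≠ 0 := sub_ne_zero.2 hζ₀
    have h1 := hGd (ζ - ζ₀) u (by simpa [dist_eq_norm] using hζ) (by simpa using hu)
    simp only [Complex.ofReal_zero, zero_mul, Complex.exp_zero, one_mul, add_sub_cancel,
      _root_.zero_apply, sub_zero] at h1
    have h2 : HasDerivAt (fun s : ℂ => ζ₀ + Complex.exp s * (ζ - ζ₀)) (ζ - ζ₀) 0 := by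
      have := ((Complex.hasDerivAt_exp 0).mul_const (ζ - ζ₀)).const_add ζ₀
      simpa using this
    have h3 : HasDerivAt (fun ζ' => G' (ζ', u)) (deriv (fun ζ' => G' (ζ', u)) ζ)
        (ζ₀ + Complex.exp 0 * (ζ - ζ₀)) := by
      have := ((han u hu) ζ hζ).differentiableAt.hasDerivAt
      simpa using this
    have h4 := h3.scomp (0 : ℂ) h2
    have h5 : ((fun ζ' => G' (ζ', u)) ∘ fun s : ℂ => ζ₀ + Complex.exp s * (ζ - ζ₀))
        = fun s => G (Complex.exp s * (ζ - ζ₀), u) := by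
      funext s
      simp [G']
    rw [h5] at h4
    have h6 := h4.unique h1
    rw [smul_comm u, ← smul_add, smul_mul_assoc] at h6
    exact smul_right_injective 𝔸 hz h6
  refine ⟨min x ε₀, lt_min hx hε₀, G', hG'.mono (Set.prod_mono
    (Metric.ball_subset_ball (min_le_left _ _)) subset_rfl), fun u => ?_, fun ζ hζ u hu => ?_⟩
  · simp only [G', sub_self]
    exact hG1 (by simp) u
  · have hζx := Metric.ball_subset_ball (min_le_left x ε₀) hζ
    have key : deriv (fun ζ' => G' (ζ', u)) ζ = (B₀ ζ + u • B₁ ζ) * G' (ζ, u) := by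
      rcases eq_or_ne ζ ζ₀ with rfl | h
      -- Division by `t` is not possible at `ζ₀`; there the equation follows by analyticity of both
      -- sides.
      · have hl : AnalyticAt ℂ (deriv fun ζ' => G' (ζ', u)) ζ := (han u hu ζ hζx).deriv
        have hr : AnalyticAt ℂ (fun ζ => (B₀ ζ + u • B₁ ζ) * G' (ζ, u)) ζ :=
          (h₀.add ((analyticAt_const (v := u)).smul h₁)).mul (han u hu ζ hζx)
        refine ((hl.frequently_eq_iff_eventually_eq hr).1 ?_).self_of_nhds
        refine Eventually.frequently ?_
        filter_upwards [self_mem_nhdsWithin,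
          nhdsWithin_le_nhds (Metric.isOpen_ball.mem_nhds hζx)] with ζ' h1 h2
        exact hne u hu ζ' h2 h1
      · exact hne u hu ζ hζx h
    rw [← key]
    exact (han u hu ζ hζx).differentiableAt.hasDerivAt

end Existence

/-! ### The Sylvester equation. -/

section Sylvester

lemma clm_mul_apply {V : Type*} [NormedAddCommGroup V] [NormedSpace ℂ V] (A B : V →L[ℂ] V) (x : V) :
    (A * B) x = A (B x) := rfl

variable {V : Type*} [AddCommGroup V] [Module ℂ V] [FiniteDimensional ℂ V]

/-- Operators with disjoint spectra have no nonzero intertwiner. -/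
theorem eq_zero_of_mul_eq_mul {A B X : Module.End ℂ V}
    (h : ∀ μ, A.HasEigenvalue μ → ¬ B.HasEigenvalue μ) (hX : A * X = X * B) : X = 0 := by
  rcases subsingleton_or_nontrivial V with hV | hV
  · exact LinearMap.ext fun v => Subsingleton.elim _ _
  have hpoly : ∀ p : Polynomial ℂ, Polynomial.aeval A p * X = X * Polynomial.aeval B p := by
    intro p
    induction p using Polynomial.induction_on' with
    | add p q hp hq => rw [map_add, map_add, add_mul, mul_add, hp, hq]
    | monomial n c =>
      have hn : A ^ n * X = X * B ^ n := (show SemiconjBy X B A from hX.symm).pow_right n |>.symm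
      rw [Polynomial.aeval_monomial, Polynomial.aeval_monomial, mul_assoc, hn, ← mul_assoc,
        ← mul_assoc, Algebra.commutes]
  have h1 := hpoly (minpoly ℂ A)
  rw [minpoly.aeval, zero_mul] at h1
  have hne : (spectrum ℂ B).Nonempty := by
    obtain ⟨μ, hμ⟩ := Module.End.exists_eigenvalue B
    exact ⟨μ, hμ.mem_spectrum⟩
  -- The minimal polynomial of `A` has no root among the eigenvalues of `B`, so by spectral mapping
  -- its value at `B` is invertible, whereas `X` times this value is `0`.
  have hunit : IsUnit (Polynomial.aeval B (minpoly ℂ A)) := by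
    by_contra hnu
    have h0 : (0 : ℂ) ∈ spectrum ℂ (Polynomial.aeval B (minpoly ℂ A)) := by
      rw [spectrum.zero_mem_iff]; exact hnu
    rw [spectrum.map_polynomial_aeval_of_nonempty _ _ hne] at h0
    obtain ⟨μ, hμ, hμ'⟩ := h0
    exact h μ (Module.End.hasEigenvalue_iff_isRoot.2 hμ')
      (Module.End.hasEigenvalue_iff_mem_spectrum.2 hμ)
  exact (hunit.mul_left_eq_zero).1 h1.symm

end Sylvester

/-! ### The Frobenius gauge at `z = 0`. -/

section Frobenius

variable {V : Type*} [NormedAddCommGroup V] [NormedSpace ℂ V] [FiniteDimensional ℂ V]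

/-- No two eigenvalues of `Q` differ by a nonzero number of the form `m + n k`. -/
def NonResonant (Q : V →L[ℂ] V) (k : ℝ) : Prop :=
  ∀ μ ν : ℂ, Module.End.HasEigenvalue (Q : V →ₗ[ℂ] V) μ →
    Module.End.HasEigenvalue (Q : V →ₗ[ℂ] V) ν →
    ∀ m n : ℤ, μ - ν = m + n * k → μ = ν

/-- The commutator with `Q`. -/
def commutatorCLM (Q : V →L[ℂ] V) : (V →L[ℂ] V) →L[ℂ] (V →L[ℂ] V) :=
  ContinuousLinearMap.mul ℂ (V →L[ℂ] V) Q - (ContinuousLinearMap.mul ℂ (V →L[ℂ] V)).flip Q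

omit [FiniteDimensional ℂ V] in
@[simp] lemma commutatorCLM_apply (Q X : V →L[ℂ] V) : commutatorCLM Q X = Q * X - X * Q := rfl

/-- An element of the kernel of `s + [Q, ·]` intertwines `Q + s` and `Q`, whose spectra are
disjoint; so the operator is injective, hence invertible in finite dimension. -/
lemma exists_smul_add_commutator_eq {Q : V →L[ℂ] V} {s : ℂ}
    (h : ∀ μ ν : ℂ, Module.End.HasEigenvalue (Q : V →ₗ[ℂ] V) μ →
      Module.End.HasEigenvalue (Q : V →ₗ[ℂ] V) ν → ν - μ ≠ s) :
    ∃ C, 0 ≤ C ∧ ∀ X : V →L[ℂ] V, ∃ Y, s • Y + commutatorCLM Q Y = X ∧ ‖Y‖ ≤ C * ‖X‖ := by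
  let T : (V →L[ℂ] V) →ₗ[ℂ] (V →L[ℂ] V) :=
    (s • ContinuousLinearMap.id ℂ (V →L[ℂ] V) + commutatorCLM Q : _ →L[ℂ] _)
  have hinj : Function.Injective T := by
    rw [← LinearMap.ker_eq_bot, LinearMap.ker_eq_bot']
    intro X hX
    have hX' : s • X + (Q * X - X * Q) = 0 := hX
    have h1 : ((Q : Module.End ℂ V) + algebraMap ℂ _ s) * (X : Module.End ℂ V)
        = (X : Module.End ℂ V) * (Q : Module.End ℂ V) := by
      ext v
      have := congrArg (fun Y : V →L[ℂ] V => Y v) hX'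
      simp only [_root_.add_apply, _root_.smul_apply,
        _root_.sub_apply, clm_mul_apply, _root_.zero_apply] at this
      change Q (X v) + s • X v = X (Q v)
      rw [← sub_eq_zero, ← this]
      abel
    have h2 := eq_zero_of_mul_eq_mul (fun μ hμ hμ' => by
      obtain ⟨v, hv⟩ := hμ.exists_hasEigenvector
      have hv1 := hv.apply_eq_smul
      refine h (μ - s) μ ?_ hμ' (by ring)
      refine Module.End.hasEigenvalue_of_hasEigenvector (x := v)
        ⟨Module.End.mem_eigenspace_iff.2 ?_, hv.2⟩
      have : (Q : Module.End ℂ V) v + s • v = μ • v := hv1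
      rw [sub_smul, ← this, add_sub_cancel_right]) h1
    ext v
    exact congrArg (fun Y : Module.End ℂ V => Y v) h2
  let e := LinearEquiv.ofInjectiveEndo T hinj
  let L : (V →L[ℂ] V) →L[ℂ] (V →L[ℂ] V) := LinearMap.toContinuousLinearMap e.symm.toLinearMap
  refine ⟨‖L‖, norm_nonneg L, fun X => ⟨L X, ?_, L.le_opNorm X⟩⟩
  exact e.apply_symm_apply X

/-- For all but finitely many `p` the scalar `m + (1-k) n` is at least `‖[Q, ·]‖ + 1`, and then `‖Y‖
≤ ‖X‖`. The constants of the finitely many others are added up. -/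
lemma exists_uniform_resolvent {Q : V →L[ℂ] V} {k : ℝ} (hk : k < 1)
    (hQ : NonResonant Q k) :
    ∃ C, 0 ≤ C ∧ ∀ p : ℕ × ℕ, p ≠ 0 → ∀ X : V →L[ℂ] V, ∃ Y,
      ((p.1 : ℂ) + (1 - k : ℝ) * p.2) • Y + commutatorCLM Q Y = X ∧ ‖Y‖ ≤ C * ‖X‖ := by
  have hpos : ∀ p : ℕ × ℕ, p ≠ 0 → 0 < (p.1 : ℝ) + (1 - k) * p.2 := fun p hp => by
    have h1 : 0 < 1 - k := sub_pos.2 hk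
    rcases Nat.eq_zero_or_pos p.1 with h | h
    · have : 0 < p.2 := Nat.pos_of_ne_zero fun h' => hp (Prod.ext h h')
      positivity
    · positivity
  have hex : ∀ p : ℕ × ℕ, ∃ C, 0 ≤ C ∧ (p ≠ 0 → ∀ X : V →L[ℂ] V, ∃ Y,
      ((p.1 : ℂ) + (1 - k : ℝ) * p.2) • Y + commutatorCLM Q Y = X ∧ ‖Y‖ ≤ C * ‖X‖) := fun p => by
    by_cases hp : p = 0
    · exact ⟨0, le_rfl, fun h => absurd hp h⟩
    · obtain ⟨C, hC, h⟩ := exists_smul_add_commutator_eq (Q := Q)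
        (s := (p.1 : ℂ) + (1 - k : ℝ) * p.2) (fun μ ν hμ hν he => by
          -- `m + (1-k) n = (m + n) - n k` is of the form excluded by nonresonance unless it is `0`,
          -- and it is positive.
          have h1 := hQ ν μ hν hμ (p.1 + p.2) (-p.2) (by rw [he]; push_cast; ring)
          rw [h1, sub_self] at he
          have h2 := hpos p hp
          have h3 : (((p.1 : ℝ) + (1 - k) * p.2 : ℝ) : ℂ) = 0 := by rw [he]; push_cast; ring
          rw [Complex.ofReal_eq_zero] at h3
          exact h2.ne' h3)
      exact ⟨C, hC, fun _ => h⟩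
  choose C hC0 hC using hex
  let N : ℝ := ‖commutatorCLM Q‖ + 1
  obtain ⟨n₀, hn₀⟩ := exists_nat_gt (N / (1 - k))
  obtain ⟨m₀, hm₀⟩ := exists_nat_gt N
  let s := Finset.range m₀ ×ˢ Finset.range n₀
  refine ⟨1 + ∑ p ∈ s, C p, add_nonneg zero_le_one (Finset.sum_nonneg fun p _ => hC0 p),
    fun p hp X => ?_⟩
  obtain ⟨Y, hY, hYC⟩ := hC p hp X
  refine ⟨Y, hY, ?_⟩
  have hsum : 0 ≤ ∑ p ∈ s, C p := Finset.sum_nonneg fun p _ => hC0 p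
  by_cases hps : p ∈ s
  · refine hYC.trans (mul_le_mul_of_nonneg_right ?_ (norm_nonneg _))
    have := Finset.single_le_sum (fun p _ => hC0 p) hps
    linarith
  · have hlarge : N ≤ (p.1 : ℝ) + (1 - k) * p.2 := by
      have h1 : 0 < 1 - k := sub_pos.2 hk
      simp only [s, Finset.mem_product, Finset.mem_range, not_and_or, not_lt] at hps
      rcases hps with h | h
      · have h' : (m₀ : ℝ) ≤ p.1 := by exact_mod_cast h
        have : 0 ≤ (1 - k) * p.2 := by positivity
        linarith
      · have h' : (n₀ : ℝ) ≤ p.2 := by exact_mod_cast h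
        rw [div_lt_iff₀ h1] at hn₀
        have : (1 - k) * n₀ ≤ (1 - k) * p.2 := by gcongr
        have : (0 : ℝ) ≤ p.1 := by positivity
        linarith
    have h1 : N * ‖Y‖ ≤ ‖X‖ + ‖commutatorCLM Q‖ * ‖Y‖ := by
      calc N * ‖Y‖ ≤ ((p.1 : ℝ) + (1 - k) * p.2) * ‖Y‖ :=
            mul_le_mul_of_nonneg_right hlarge (norm_nonneg _)
        _ = ‖((p.1 : ℂ) + (1 - k : ℝ) * p.2) • Y‖ := by
            rw [norm_smul]
            congr 1
            have : ((p.1 : ℂ) + (1 - k : ℝ) * p.2) = (((p.1 : ℝ) + (1 - k) * p.2 : ℝ) : ℂ) := by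
              push_cast; ring
            rw [this, Complex.norm_real, Real.norm_of_nonneg (hpos p hp).le]
        _ = ‖X - commutatorCLM Q Y‖ := by rw [← hY, add_sub_cancel_right]
        _ ≤ _ := (norm_sub_le _ _).trans (by gcongr; exact ContinuousLinearMap.le_opNorm _ _)
    have h2 : ‖Y‖ ≤ ‖X‖ := by
      have : N * ‖Y‖ = ‖commutatorCLM Q‖ * ‖Y‖ + ‖Y‖ := by simp only [N]; ring
      linarith
    have := mul_nonneg hsum (norm_nonneg X)
    linarith

/-- The coefficient of the differential equation `φ' = B φ` obtained from `ℒ ψ = 0`. -/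
def gaugedCoeff (Q E : V →L[ℂ] V) (S : ℂ → V →L[ℂ] V) (k : ℝ) (lam ζ : ℂ) : V →L[ℂ] V :=
  -(Q + Complex.exp ζ • ((1 + lam * Complex.exp (-(k : ℂ) * ζ)) • E + S (Complex.exp ζ)))

/-- The Frobenius solution at the singularity `z = 0`. -/
theorem exists_frobenius_solution {Q E : V →L[ℂ] V} {S : ℂ → V →L[ℂ] V} {k : ℝ} (hk : k < 1)
    (hQ : NonResonant Q k) (hS : AnalyticAt ℂ S 0) :
    ∃ r > 0, ∃ Ψ : ℂ × ℂ → V →L[ℂ] V,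
      AnalyticOnNhd ℂ Ψ (Metric.ball 0 r ×ˢ Metric.ball 0 r) ∧ Ψ 0 = 1 ∧
      (∀ v ∈ Metric.ball (0 : ℂ) r ×ˢ Metric.ball (0 : ℂ) r, IsUnit (Ψ v)) ∧
      ∀ ζ lam : ℂ, ‖Complex.exp ζ‖ < r → ‖lam * Complex.exp ((1 - k : ℝ) * ζ)‖ < r →
        HasDerivAt (fun ζ => Ψ (Complex.exp ζ, lam * Complex.exp ((1 - k : ℝ) * ζ)))
          (gaugedCoeff Q E S k lam ζ * Ψ (Complex.exp ζ, lam * Complex.exp ((1 - k : ℝ) * ζ))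
            + Ψ (Complex.exp ζ, lam * Complex.exp ((1 - k : ℝ) * ζ)) * Q) ζ := by
  obtain ⟨C, hC, hR⟩ := exists_uniform_resolvent hk hQ
  obtain ⟨y, hy, hCy⟩ : ∃ y : ℝ, 0 < y ∧ C * (y * ‖E‖) < 1 := by
    refine ⟨1 / (C * ‖E‖ + 1), by positivity, ?_⟩
    have : C * (1 / (C * ‖E‖ + 1) * ‖E‖) = (C * ‖E‖) / (C * ‖E‖ + 1) := by ring
    rw [this, div_lt_one (by positivity)]
    linarith
  -- With `u = λ z^(1-k)` the term `z λ z⁻ᵏ E` is `u E`, so `β` is the constant `-E`. It need not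
  -- vanish at `0`, hence the smallness of `y`.
  obtain ⟨x, hx, G, hG, hG0, -, hGd⟩ := exists_bivariate_flow (P := commutatorCLM Q) (c := 1 - k)
    (C := C) (α := fun z => -(z • (E + S z))) (β := fun _ => -E)
    ((analyticAt_id.smul (analyticAt_const.add hS)).neg) analyticAt_const (by simp) (by simp) hC hy
    (by simpa using hCy) (fun p hp _ X => hR p hp X)
  have hcont : ContinuousAt G 0 :=
    (hG 0 ⟨by simpa using hx, by simpa using hy⟩).continuousAt
  have hunit : ∀ᶠ v in 𝓝 (0 : ℂ × ℂ), IsUnit (G v) := by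
    refine hcont.eventually_mem (Units.isOpen.mem_nhds ?_)
    rw [hG0]; exact isUnit_one
  obtain ⟨ε, hε, hεu⟩ := Metric.eventually_nhds_iff_ball.1 hunit
  let r := min ε (min x y)
  have hr : 0 < r := lt_min hε (lt_min hx hy)
  have hrx : r ≤ x := (min_le_right _ _).trans (min_le_left _ _)
  have hry : r ≤ y := (min_le_right _ _).trans (min_le_right _ _)
  refine ⟨r, hr, G, hG.mono (Set.prod_mono (Metric.ball_subset_ball hrx)
    (Metric.ball_subset_ball hry)), hG0, fun v hv => hεu v ?_, fun ζ lam h1 h2 => ?_⟩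
  · rw [ball_prod_same] at hv
    exact Metric.ball_subset_ball (min_le_left _ _) hv
  · have h3 := hGd (Complex.exp ζ) (lam * Complex.exp ((1 - k : ℝ) * ζ)) (h1.trans_le hrx)
      (h2.trans_le hry)
    -- The curve `ζ ↦ (z, λ z^(1-k))` is an orbit of the flow, so the derivative at time `0` is
    -- transported to `ζ`.
    have h4 := HasDerivAt.comp_sub_const (x := ζ) (a := ζ) (by rw [sub_self]; exact h3)
    convert! h4 using 1
    · funext ζ'
      rw [← Complex.exp_add, sub_add_cancel, mul_left_comm, ← Complex.exp_add, ← mul_add,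
        sub_add_cancel]
    · set Y := G (Complex.exp ζ, lam * Complex.exp ((1 - k : ℝ) * ζ))
      have h5 : Complex.exp ((1 - k : ℝ) * ζ) = Complex.exp ζ * Complex.exp (-(k : ℂ) * ζ) := by
        rw [← Complex.exp_add]; congr 1; push_cast; ring
      have h6 : gaugedCoeff Q E S k lam ζ = -(Complex.exp ζ • (E + S (Complex.exp ζ)))
          + (lam * Complex.exp ((1 - k : ℝ) * ζ)) • -E - Q := by
        rw [gaugedCoeff, h5]
        module
      rw [h6, commutatorCLM_apply, sub_mul]
      abel

end Frobenius

/-! ### Eigenvectors of `exp (2πi Q)` and the kernel of `Q`. -/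

section Kernel

variable {V : Type*} [NormedAddCommGroup V] [NormedSpace ℂ V] [FiniteDimensional ℂ V]

lemma exp_apply_of_apply_eq_smul {T : V →L[ℂ] V} {x : V} {μ : ℂ} (h : T x = μ • x) :
    NormedSpace.exp T x = Complex.exp μ • x := by
  have h1 : ∀ n : ℕ, (T ^ n) x = μ ^ n • x := fun n => by
    induction n with
    | zero => simp
    | succ n ih => rw [pow_succ, clm_mul_apply, h, map_smul, ih, smul_smul, pow_succ']
  have h2 := (NormedSpace.exp_series_hasSum_exp' (𝕂 := ℂ) T)
  have h3 := (ContinuousLinearMap.apply ℂ V x).hasSum h2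
  have h4 := (NormedSpace.exp_series_hasSum_exp' (𝕂 := ℂ) μ).smul_const x
  rw [← Complex.exp_eq_exp_ℂ] at h4
  refine h3.unique (h4.congr_fun fun n => ?_)
  simp [h1, smul_smul]

lemma exp_apply_of_sq_eq_zero {T : V →L[ℂ] V} {x : V} (h : T (T x) = 0) :
    NormedSpace.exp T x = x + T x := by
  have h1 : ∀ n : ℕ, (T ^ (n + 2)) x = 0 := fun n => by
    rw [pow_add, pow_two, clm_mul_apply,
      clm_mul_apply, h, map_zero]
  have h2 := (ContinuousLinearMap.apply ℂ V x).hasSum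
    (NormedSpace.exp_series_hasSum_exp' (𝕂 := ℂ) T)
  have h3 : HasSum (fun n : ℕ => ContinuousLinearMap.apply ℂ V x ((n.factorial⁻¹ : ℂ) • T ^ n))
      (∑ n ∈ Finset.range 2, ContinuousLinearMap.apply ℂ V x ((n.factorial⁻¹ : ℂ) • T ^ n)) := by
    refine hasSum_sum_of_ne_finset_zero fun n hn => ?_
    obtain ⟨m, rfl⟩ := Nat.exists_eq_add_of_le (not_lt.1 (Finset.mem_range.not.1 hn))
    rw [add_comm]
    simp [h1]
  have h4 := h2.unique h3
  simpa [Finset.sum_range_succ] using h4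

/-- If no nonzero eigenvalue of `Q` has the form `m + n k`, then the eigenvectors of
`exp (2πi Q)` of eigenvalue `exp (2πi n k)` lie in the kernel of `Q`. -/
theorem apply_eq_zero_of_exp_apply {Q : V →L[ℂ] V} {k : ℝ} {n : ℤ}
    (hQ : ∀ ν : ℂ, Module.End.HasEigenvalue (Q : V →ₗ[ℂ] V) ν → ∀ m : ℤ, ν = m + n * k → ν = 0)
    {v : V} (hv : NormedSpace.exp ((2 * Real.pi * Complex.I) • Q) v
      = Complex.exp (2 * Real.pi * Complex.I * (n * k)) • v) : Q v = 0 := by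
  set c := Complex.exp (2 * Real.pi * Complex.I * (n * k)) with hc
  set T := NormedSpace.exp ((2 * Real.pi * Complex.I) • Q) with hT
  have hcomm : T * Q = Q * T :=
    (((Commute.refl Q).smul_left (2 * Real.pi * Complex.I : ℂ)).exp_left)
  let W : Submodule ℂ V := LinearMap.ker ((T : V →ₗ[ℂ] V) - c • LinearMap.id)
  have hW : ∀ x, x ∈ W ↔ T x = c • x := fun x => by
    simp [W, sub_eq_zero]
  have hQW : ∀ x ∈ W, (Q : V →ₗ[ℂ] V) x ∈ W := fun x hx => by
    rw [hW] at hx ⊢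
    have := congrArg (fun Y : V →L[ℂ] V => Y x) hcomm
    simp only [clm_mul_apply] at this
    change T (Q x) = c • Q x
    rw [this, hx, map_smul]
  let QW : Module.End ℂ W := (Q : V →ₗ[ℂ] V).restrict hQW
  -- Induction on the length of a Jordan chain inside the `c`-eigenspace `W` of `exp (2πi Q)`. For a
  -- true eigenvector, `exp (2πi ν) = c` makes `ν` of the form `m + n k`, so `ν = 0`.
  have key : ∀ (ν : ℂ) (j : ℕ) (x : V), x ∈ W →
      (((Q : Module.End ℂ V) - algebraMap ℂ _ ν) ^ j) x = 0 → Q x = 0 := by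
    intro ν j
    induction j with
    | zero => intro x _ hx; rw [show x = 0 from hx, map_zero]
    | succ j ih =>
      intro x hxW hx
      rw [pow_succ, Module.End.mul_apply] at hx
      set y := ((Q : Module.End ℂ V) - algebraMap ℂ _ ν) x with hy
      have hy' : y = Q x - ν • x := rfl
      have hyW : y ∈ W := W.sub_mem (hQW x hxW) (W.smul_mem _ hxW)
      have hQy := ih y hyW hx
      by_cases hy0 : y = 0
      · rw [hy0, eq_comm, sub_eq_zero] at hy'
        by_cases hx0 : x = 0
        · rw [hx0, map_zero]
        have hexp : T x = Complex.exp (2 * Real.pi * Complex.I * ν) • x :=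
          exp_apply_of_apply_eq_smul (by
            rw [_root_.smul_apply, hy', smul_smul])
        rw [(hW x).1 hxW] at hexp
        have h1 : c = Complex.exp (2 * Real.pi * Complex.I * ν) := smul_left_injective ℂ hx0 hexp
        obtain ⟨m, hm⟩ := Complex.exp_eq_exp_iff_exists_int.1 h1
        have h2 : ν = ((-m : ℤ) : ℂ) + n * k := by
          have : (2 * Real.pi * Complex.I : ℂ) ≠ 0 := Complex.two_pi_I_ne_zero
          apply mul_left_cancel₀ this
          push_cast
          linear_combination -hm
        have h3 := hQ ν (Module.End.hasEigenvalue_of_hasEigenvector (x := x)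
          ⟨Module.End.mem_eigenspace_iff.2 hy', hx0⟩) _ h2
        rw [hy', h3, zero_smul]
      -- A longer chain is impossible: `Q y = 0` gives `ν = 0` and `c = 1`, whereas `exp (2πi Q) x =
      -- x + 2πi y` with `y ≠ 0`.
      · have hν : ν = 0 := by
          have h1 : ∀ j : ℕ, (((Q : Module.End ℂ V) - algebraMap ℂ _ ν) ^ j) y
              = (-ν) ^ j • y := fun j => by
            induction j with
            | zero => simp
            | succ j ih' =>
              rw [pow_succ, Module.End.mul_apply]
              have : ((Q : Module.End ℂ V) - algebraMap ℂ _ ν) y = (-ν) • y := by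
                change Q y - ν • y = _
                rw [hQy, zero_sub, neg_smul]
              rw [this, map_smul, ih', smul_smul, pow_succ']
          rw [h1] at hx
          rcases smul_eq_zero.1 hx with h | h
          · exact neg_eq_zero.1 (eq_zero_of_pow_eq_zero h)
          · exact absurd h hy0
        rw [hν, zero_smul, sub_zero] at hy'
        have hTx : T x = x + (2 * Real.pi * Complex.I : ℂ) • y := by
          rw [hT, exp_apply_of_sq_eq_zero]
          · rw [_root_.smul_apply, ← hy']
          · change (2 * Real.pi * Complex.I : ℂ) • Q ((2 * Real.pi * Complex.I : ℂ) • Q x) = 0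
            rw [← hy', map_smul, hQy, smul_zero, smul_zero]
        have hTy : T y = y := by
          rw [hT, exp_apply_of_sq_eq_zero] <;> simp [hQy]
        rw [(hW y).1 hyW] at hTy
        have hc1 : c = 1 := smul_left_injective ℂ hy0 (by simpa using hTy)
        rw [(hW x).1 hxW, hc1, one_smul, left_eq_add] at hTx
        exact absurd ((smul_eq_zero.1 hTx).resolve_left Complex.two_pi_I_ne_zero) hy0
  have htop : (⊤ : Submodule ℂ W) ≤ LinearMap.ker QW := by
    rw [← Module.End.iSup_maxGenEigenspace_eq_top QW]
    refine iSup_le fun ν x hx => ?_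
    obtain ⟨j, hj⟩ := (Module.End.mem_maxGenEigenspace _ _ _).1 hx
    have hcoe : ∀ (j : ℕ) (x : W), ((((QW - ν • 1) ^ j) x : W) : V)
        = (((Q : Module.End ℂ V) - algebraMap ℂ _ ν) ^ j) x := fun j => by
      induction j with
      | zero => intro x; rfl
      | succ j ih =>
        intro x
        rw [pow_succ, pow_succ, Module.End.mul_apply, Module.End.mul_apply, ih]
        rfl
    have := key ν j x x.2 (by rw [← hcoe, hj]; rfl)
    exact LinearMap.mem_ker.2 (Subtype.ext this)
  have hvW : v ∈ W := (hW v).2 hv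
  have := htop (x := ⟨v, hvW⟩) trivial
  exact congrArg Subtype.val (LinearMap.mem_ker.1 this)

end Kernel

/-! ### The gauged system: domains, local and global solutions, dependence on the parameter. -/

lemma analyticAt_clm_apply {X V : Type*} [NormedAddCommGroup X] [NormedSpace ℂ X]
    [NormedAddCommGroup V] [NormedSpace ℂ V] {A : X → V →L[ℂ] V} {f : X → V} {x : X}
    (hA : AnalyticAt ℂ A x) (hf : AnalyticAt ℂ f x) : AnalyticAt ℂ (fun y => A y (f y)) x :=
  AnalyticAt.fun_comp (g := fun p : (V →L[ℂ] V) × V => p.1 p.2)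
    (f := fun y => (A y, f y))
    ((ContinuousLinearMap.id ℂ (V →L[ℂ] V)).analyticAt_bilinear (A x, f x)) (hA.prod hf)

lemma inverse_apply_apply {V : Type*} [NormedAddCommGroup V] [NormedSpace ℂ V] {A : V →L[ℂ] V}
    (hA : IsUnit A) (v : V) : Ring.inverse A (A v) = v := by
  rw [← clm_mul_apply, Ring.inverse_mul_cancel _ hA]; rfl

lemma apply_inverse_apply {V : Type*} [NormedAddCommGroup V] [NormedSpace ℂ V] {A : V →L[ℂ] V}
    (hA : IsUnit A) (v : V) : A (Ring.inverse A v) = v := by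
  rw [← clm_mul_apply, Ring.mul_inverse_cancel _ hA]; rfl

/-- A differential equation `φ' = -(Q + z ((1 + λ z⁻ᵏ) E + S(z))) φ` in the coordinate `ζ`,
`z = exp ζ`, with trivial monodromy at the singular points of `S`. -/
structure GaugedSystem (V : Type v) [NormedAddCommGroup V] [NormedSpace ℂ V] where
  /-- the residue at `z = 0` -/
  Q : V →L[ℂ] V
  /-- the coefficient of the parameter -/
  E : V →L[ℂ] V
  /-- the part with poles -/
  S : ℂ → V →L[ℂ] V
  /-- the exponent -/
  k : ℝ
  /-- the singular points -/
  sing : Finset ℂ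
  k_lt_one : k < 1
  zero_notMem : (0 : ℂ) ∉ sing
  analytic : AnalyticOnNhd ℂ S {z | z ∉ sing}
  nonResonant : NonResonant Q k
  trivialMonodromy : ∀ lam ζ₀ : ℂ, Complex.exp ζ₀ ∈ sing →
    ∃ ε > 0, ∀ ζ₁ ∈ Metric.ball ζ₀ ε \ {ζ₀}, ∀ w : V, ∃ ψ : ℂ → V, ψ ζ₁ = w ∧
      IsSolution (gaugedCoeff Q E S k lam) ψ (Metric.ball ζ₀ ε \ {ζ₀})

namespace GaugedSystem

variable {V : Type v} [NormedAddCommGroup V] [NormedSpace ℂ V] (G : GaugedSystem V)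

/-- The lifts of the singular points. -/
def lifts : Set ℂ := {ζ | Complex.exp ζ ∈ G.sing}

/-- The coefficient of the equation. -/
def coeff (lam ζ : ℂ) : V →L[ℂ] V := gaugedCoeff G.Q G.E G.S G.k lam ζ

/-- The coordinates `(z, λ z^(1-k))`. -/
def point (lam ζ : ℂ) : ℂ × ℂ := (Complex.exp ζ, lam * Complex.exp ((1 - G.k : ℝ) * ζ))

/-- The half plane where both coordinates `(z, λ z^(1-k))` are less than `r`. -/
def halfPlane (r : ℝ) (lam : ℂ) : Set ℂ :=
  {ζ | ‖Complex.exp ζ‖ < r ∧ ‖lam * Complex.exp ((1 - G.k : ℝ) * ζ)‖ < r}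

lemma isClosed_lifts : IsClosed G.lifts :=
  (G.sing.finite_toSet.isClosed).preimage Complex.continuous_exp

lemma countable_lifts : G.lifts.Countable :=
  G.sing.finite_toSet.countable.preimage_cexp

lemma isOpen_compl_lifts : IsOpen G.liftsᶜ := G.isClosed_lifts.isOpen_compl

lemma isPreconnected_compl_lifts : IsPreconnected G.liftsᶜ := by
  have := isPreconnected_convex_diff_countable convex_univ isOpen_univ G.countable_lifts
  rwa [← Set.compl_eq_univ_sdiff] at this

lemma isOpen_notMem_sing : IsOpen {z | z ∉ G.sing} :=
  (G.sing.finite_toSet.isClosed).isOpen_compl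

/-- The coefficient at `λ = 0`. -/
def coeffZero (ζ : ℂ) : V →L[ℂ] V := -(G.Q + Complex.exp ζ • (G.E + G.S (Complex.exp ζ)))

/-- The coefficient of `λ`. -/
def coeffOne (ζ : ℂ) : V →L[ℂ] V :=
  -((Complex.exp ζ * Complex.exp (-(G.k : ℂ) * ζ)) • G.E)

lemma coeff_eq (lam ζ : ℂ) : G.coeff lam ζ = G.coeffZero ζ + lam • G.coeffOne ζ := by
  simp only [coeff, gaugedCoeff, coeffZero, coeffOne]
  module

lemma analyticAt_coeffZero {ζ : ℂ} (hζ : ζ ∉ G.lifts) : AnalyticAt ℂ G.coeffZero ζ := by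
  have h1 : AnalyticAt ℂ (fun ζ => G.S (Complex.exp ζ)) ζ :=
    AnalyticAt.fun_comp (g := G.S) (G.analytic _ hζ) analyticAt_cexp
  exact (analyticAt_const.add (analyticAt_cexp.smul (analyticAt_const.add h1))).neg

lemma analyticAt_coeffOne (ζ : ℂ) : AnalyticAt ℂ G.coeffOne ζ := by
  have h1 : AnalyticAt ℂ (fun ζ => Complex.exp ζ * Complex.exp (-(G.k : ℂ) * ζ)) ζ := by
    fun_prop
  exact (h1.smul analyticAt_const).neg

lemma continuousOn_coeff (lam : ℂ) : ContinuousOn (G.coeff lam) G.liftsᶜ := fun ζ hζ => by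
  have h : ContinuousAt (fun ζ => G.coeffZero ζ + lam • G.coeffOne ζ) ζ :=
    (G.analyticAt_coeffZero hζ).continuousAt.add
      ((G.analyticAt_coeffOne ζ).continuousAt.const_smul lam)
  exact (h.congr (Eventually.of_forall fun ζ => (G.coeff_eq lam ζ).symm)).continuousWithinAt

/-- Since `k < 1`, both conditions are upper bounds on `Re ζ`. -/
lemma convex_halfPlane (r : ℝ) (lam : ℂ) : Convex ℝ (G.halfPlane r lam) := by
  let I : Set ℝ := {t | Real.exp t < r ∧ ‖lam‖ * Real.exp ((1 - G.k) * t) < r}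
  have hI : IsLowerSet I := fun a b hab ha => by
    have hk := sub_pos.2 G.k_lt_one
    refine ⟨(Real.exp_le_exp.2 hab).trans_lt ha.1, lt_of_le_of_lt ?_ ha.2⟩
    gcongr
  have h := hI.ordConnected.convex (𝕜 := ℝ) |>.linear_preimage Complex.reLm
  convert! h using 1
  ext ζ
  simp [halfPlane, I, Complex.norm_exp]

lemma tendsto_point (lam : ℂ) :
    Tendsto (G.point lam) (comap Complex.re atBot) (𝓝 0) := by
  have h1 : Tendsto (fun ζ : ℂ => ((1 - G.k : ℝ) : ℂ) * ζ) (comap Complex.re atBot)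
      (comap Complex.re atBot) := by
    rw [tendsto_comap_iff]
    have : (Complex.re ∘ fun ζ : ℂ => ((1 - G.k : ℝ) : ℂ) * ζ) = fun ζ => (1 - G.k) * ζ.re := by
      funext ζ; simp only [Function.comp, Complex.re_ofReal_mul]
    rw [this]
    exact tendsto_comap.const_mul_atBot (sub_pos.2 G.k_lt_one)
  have h2 := (Complex.tendsto_exp_comap_re_atBot.comp h1).const_mul lam
  rw [mul_zero] at h2
  exact Complex.tendsto_exp_comap_re_atBot.prodMk_nhds h2

lemma eventually_halfPlane {r : ℝ} (hr : 0 < r) (lam : ℂ) :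
    ∀ᶠ ζ in comap Complex.re atBot, ζ ∈ G.halfPlane r lam := by
  have := (G.tendsto_point lam).eventually_mem (Metric.ball_mem_nhds 0 hr)
  filter_upwards [this] with ζ hζ
  rw [mem_ball_zero_iff, Prod.norm_def, max_lt_iff] at hζ
  exact hζ

instance neBot_comap_re : (comap Complex.re atBot).NeBot :=
  comap_neBot fun s hs => by
    obtain ⟨t, ht⟩ := NeBot.nonempty_of_mem inferInstance hs
    exact ⟨(t : ℂ), by simpa using ht⟩

lemma halfPlane_subset {r : ℝ} {lam lam' : ℂ} (h : ‖lam‖ ≤ ‖lam'‖) :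
    G.halfPlane r lam' ⊆ G.halfPlane r lam := fun ζ hζ => by
  refine ⟨hζ.1, lt_of_le_of_lt ?_ hζ.2⟩
  rw [norm_mul, norm_mul]
  gcongr

/-- The data of a normalized Frobenius solution on the polydisc of radius `r`. -/
structure IsFrobenius (r : ℝ) (Ψ : ℂ × ℂ → V →L[ℂ] V) : Prop where
  pos : 0 < r
  analytic : AnalyticOnNhd ℂ Ψ (Metric.ball 0 r ×ˢ Metric.ball 0 r)
  map_zero : Ψ 0 = 1
  isUnit : ∀ v ∈ Metric.ball (0 : ℂ) r ×ˢ Metric.ball (0 : ℂ) r, IsUnit (Ψ v)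
  hasDerivAt : ∀ lam, ∀ ζ ∈ G.halfPlane r lam, HasDerivAt (fun ζ => Ψ (G.point lam ζ))
    (G.coeff lam ζ * Ψ (G.point lam ζ) + Ψ (G.point lam ζ) * G.Q) ζ
  notMem : ∀ z : ℂ, ‖z‖ < r → z ∉ G.sing

section FiniteDim

variable [FiniteDimensional ℂ V]

theorem exists_isFrobenius : ∃ r Ψ, G.IsFrobenius r Ψ := by
  obtain ⟨r, hr, Ψ, h1, h2, h3, h4⟩ := exists_frobenius_solution (E := G.E) G.k_lt_one
    G.nonResonant (G.analytic 0 G.zero_notMem)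
  obtain ⟨ε, hε, hε'⟩ := Metric.isOpen_iff.1 G.isOpen_notMem_sing 0 G.zero_notMem
  have hsub : Metric.ball (0 : ℂ) (min r ε) ⊆ Metric.ball 0 r :=
    Metric.ball_subset_ball (min_le_left _ _)
  refine ⟨min r ε, Ψ, lt_min hr hε, h1.mono (Set.prod_mono hsub hsub), h2,
    fun v hv => h3 v (Set.prod_mono hsub hsub hv), fun lam ζ hζ => ?_, fun z hz => ?_⟩
  · exact h4 ζ lam (hζ.1.trans_le (min_le_left _ _)) (hζ.2.trans_le (min_le_left _ _))
  · exact hε' (by simpa using hz.trans_le (min_le_right _ _))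

variable {G} {r : ℝ} {Ψ : ℂ × ℂ → V →L[ℂ] V}

omit [FiniteDimensional ℂ V] in
lemma IsFrobenius.point_mem {lam ζ : ℂ} (hζ : ζ ∈ G.halfPlane r lam) :
    G.point lam ζ ∈ Metric.ball (0 : ℂ) r ×ˢ Metric.ball (0 : ℂ) r :=
  ⟨mem_ball_zero_iff.2 hζ.1, mem_ball_zero_iff.2 hζ.2⟩

omit [FiniteDimensional ℂ V] in
lemma IsFrobenius.halfPlane_subset_compl (h : G.IsFrobenius r Ψ) (lam : ℂ) :
    G.halfPlane r lam ⊆ G.liftsᶜ := fun _ hζ => h.notMem _ hζ.1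

/-- The solutions `Ψ exp (-ζ Q) v`. -/
lemma IsFrobenius.isSolution (h : G.IsFrobenius r Ψ) (lam : ℂ) (v : V) :
    IsSolution (G.coeff lam)
      (fun ζ => Ψ (G.point lam ζ) (NormedSpace.exp (ζ • (-G.Q)) v)) (G.halfPlane r lam) := by
  intro ζ hζ
  have h1 := h.hasDerivAt lam ζ hζ
  have h2 := (hasDerivAt_exp_smul_const' (𝕂 := ℂ) (-G.Q) ζ).clm_apply (hasDerivAt_const ζ v)
  rw [_root_.map_zero, add_zero] at h2
  have h3 := h1.clm_apply h2
  convert! h3 using 1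
  simp only [add_apply, clm_mul_apply, neg_apply, map_neg]
  abel

/-- On the kernel of `Q` the factor `exp (-ζ Q)` is trivial: no powers or logarithms of `z` appear.
-/
lemma IsFrobenius.isSolution_of_apply_eq_zero (h : G.IsFrobenius r Ψ) (lam : ℂ) {v : V}
    (hv : G.Q v = 0) :
    IsSolution (G.coeff lam) (fun ζ => Ψ (G.point lam ζ) v) (G.halfPlane r lam) := by
  have h1 := h.isSolution lam v
  have h2 : ∀ ζ : ℂ, NormedSpace.exp (ζ • (-G.Q)) v = v := fun ζ => by
    have := exp_apply_of_apply_eq_smul (T := ζ • (-G.Q)) (x := v) (μ := 0) (by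
      simp [hv])
    simpa using this
  simpa only [h2] using h1

omit [FiniteDimensional ℂ V] in
lemma IsFrobenius.tendsto (h : G.IsFrobenius r Ψ) (lam : ℂ) (v : V) :
    Tendsto (fun ζ => Ψ (G.point lam ζ) v) (comap Complex.re atBot) (𝓝 v) := by
  have h0 : (0 : ℂ × ℂ) ∈ Metric.ball (0 : ℂ) r ×ˢ Metric.ball (0 : ℂ) r :=
    ⟨Metric.mem_ball_self h.pos, Metric.mem_ball_self h.pos⟩
  have h1 : Tendsto (fun p => Ψ p v) (𝓝 0) (𝓝 (Ψ 0 v)) :=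
    ((h.analytic 0 h0).continuousAt.clm_apply continuousAt_const)
  rw [h.map_zero] at h1
  exact h1.comp (G.tendsto_point lam)

variable (G) in
/-- Invertible local propagators at the regular points, analytic in the parameter. -/
theorem exists_propagator {ζ₀ : ℂ} (hζ₀ : ζ₀ ∉ G.lifts) (y : ℝ) :
    ∃ ε > 0, Metric.ball ζ₀ ε ⊆ G.liftsᶜ ∧ ∃ U : ℂ × ℂ → V →L[ℂ] V,
      AnalyticOnNhd ℂ U (Metric.ball ζ₀ ε ×ˢ Metric.ball 0 y) ∧
      (∀ p ∈ Metric.ball ζ₀ ε ×ˢ Metric.ball (0 : ℂ) y, IsUnit (U p)) ∧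
      (∀ lam, U (ζ₀, lam) = 1) ∧
      ∀ lam ∈ Metric.ball (0 : ℂ) y, ∀ v : V,
        IsSolution (G.coeff lam) (fun ζ => U (ζ, lam) v) (Metric.ball ζ₀ ε) := by
  obtain ⟨ε₁, hε₁, U, hU, hU1, hUd⟩ := exists_local_propagator (G.analyticAt_coeffZero hζ₀)
    (G.analyticAt_coeffOne ζ₀) (y := |y| + 1) (by positivity)
  obtain ⟨ε₂, hε₂, hε₂'⟩ := Metric.isOpen_iff.1 G.isOpen_compl_lifts ζ₀ hζ₀
  have hy : Metric.closedBall (0 : ℂ) |y| ⊆ Metric.ball 0 (|y| + 1) :=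
    Metric.closedBall_subset_ball (by linarith)
  have hy' : Metric.ball (0 : ℂ) y ⊆ Metric.closedBall 0 |y| :=
    Metric.ball_subset_closedBall.trans (Metric.closedBall_subset_closedBall (le_abs_self y))
  have hopen : IsOpen ((Metric.ball ζ₀ ε₁ ×ˢ Metric.ball (0 : ℂ) (|y| + 1)) ∩
      U ⁻¹' {A | IsUnit A}) :=
    hU.continuousOn.isOpen_inter_preimage (Metric.isOpen_ball.prod Metric.isOpen_ball)
      Units.isOpen
  -- Compactness of the closed disc of parameters gives one neighbourhood of `ζ₀` on which `U` is
  -- invertible for all of them.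
  obtain ⟨u, w, hu, -, hu', hw', huw⟩ := generalized_tube_lemma
    (isCompact_singleton (x := ζ₀)) (isCompact_closedBall (0 : ℂ) |y|) hopen (by
      rintro ⟨a, lam⟩ ⟨ha, hlam⟩
      obtain rfl : a = ζ₀ := ha
      refine ⟨⟨Metric.mem_ball_self hε₁, hy hlam⟩, ?_⟩
      change IsUnit (U (a, lam))
      rw [hU1]; exact isUnit_one)
  obtain ⟨ε₃, hε₃, hε₃'⟩ := Metric.isOpen_iff.1 hu ζ₀ (hu' rfl)
  have hs1 : Metric.ball ζ₀ (min ε₁ (min ε₂ ε₃)) ⊆ Metric.ball ζ₀ ε₁ :=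
    Metric.ball_subset_ball (min_le_left _ _)
  have hs2 : Metric.ball ζ₀ (min ε₁ (min ε₂ ε₃)) ⊆ Metric.ball ζ₀ ε₂ :=
    Metric.ball_subset_ball ((min_le_right _ _).trans (min_le_left _ _))
  have hs3 : Metric.ball ζ₀ (min ε₁ (min ε₂ ε₃)) ⊆ Metric.ball ζ₀ ε₃ :=
    Metric.ball_subset_ball ((min_le_right _ _).trans (min_le_right _ _))
  refine ⟨min ε₁ (min ε₂ ε₃), lt_min hε₁ (lt_min hε₂ hε₃), hs2.trans hε₂', U,
    hU.mono (Set.prod_mono hs1 (hy'.trans hy)), fun p hp => ?_, hU1, fun lam hlam v ζ hζ => ?_⟩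
  · exact (huw ⟨hε₃' (hs3 hp.1), hw' (hy' hp.2)⟩).2
  · have h1 := (hUd ζ (hs1 hζ) lam (hy (hy' hlam))).clm_apply (hasDerivAt_const ζ v)
    rw [_root_.map_zero, add_zero, ← coeff_eq] at h1
    exact h1

variable (G) in
/-- Every initial value problem has a global solution. -/
theorem exists_solution (lam : ℂ) {c : ℂ} (hc : c ∉ G.lifts) (w : V) :
    ∃ ψ : ℂ → V, ψ c = w ∧ IsSolution (G.coeff lam) ψ G.liftsᶜ := by
  have : CompleteSpace V := FiniteDimensional.complete ℂ V
  refine exists_global_solution G.isClosed_lifts G.countable_lifts (G.continuousOn_coeff lam)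
    (fun ζ₀ => ?_) hc w
  by_cases hζ₀ : ζ₀ ∈ G.lifts
  · obtain ⟨ε, hε, h⟩ := G.trivialMonodromy lam ζ₀ hζ₀
    have hsub : Metric.ball ζ₀ ε \ G.lifts ⊆ Metric.ball ζ₀ ε \ {ζ₀} :=
      Set.sdiff_subset_sdiff_right (Set.singleton_subset_iff.2 hζ₀)
    refine ⟨ε, hε, fun ζ₁ hζ₁ w => ?_⟩
    obtain ⟨ψ, h1, h2⟩ := h ζ₁ (hsub hζ₁) w
    exact ⟨ψ, h1, IsSolution.mono h2 hsub⟩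
  · obtain ⟨ε, hε, hsub, U, -, hU, -, hUs⟩ := G.exists_propagator hζ₀ (‖lam‖ + 1)
    have hlam : lam ∈ Metric.ball (0 : ℂ) (‖lam‖ + 1) := by simp
    refine ⟨ε, hε, fun ζ₁ hζ₁ w => ⟨fun ζ => U (ζ, lam) (Ring.inverse (U (ζ₁, lam)) w),
      apply_inverse_apply (hU _ ⟨hζ₁.1, hlam⟩) w, ?_⟩⟩
    exact (hUs lam hlam _).mono Set.sdiff_subset

variable (G) in
theorem eqOn_compl_lifts {lam : ℂ} {φ ψ : ℂ → V} (hφ : IsSolution (G.coeff lam) φ G.liftsᶜ)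
    (hψ : IsSolution (G.coeff lam) ψ G.liftsᶜ) {ζ : ℂ} (hζ : ζ ∉ G.lifts) (h : φ ζ = ψ ζ) :
    Set.EqOn φ ψ G.liftsᶜ :=
  have : CompleteSpace V := FiniteDimensional.complete ℂ V
  hφ.eqOn_of_isPreconnected G.isOpen_compl_lifts G.isPreconnected_compl_lifts
    (G.continuousOn_coeff lam) hψ hζ h

/-- A family of solutions which is analytic in the parameter at one point is jointly analytic. -/
theorem analyticOnNhd_of_differentiableOn {φ : ℂ → ℂ → V}
    (hφ : ∀ lam, IsSolution (G.coeff lam) (fun ζ => φ ζ lam) G.liftsᶜ)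
    (h : ∀ y : ℝ, ∃ ζ₁ ∉ G.lifts, DifferentiableOn ℂ (φ ζ₁) (Metric.ball 0 y)) :
    AnalyticOnNhd ℂ (fun p : ℂ × ℂ => φ p.1 p.2) (G.liftsᶜ ×ˢ Set.univ) := by
  have : CompleteSpace V := FiniteDimensional.complete ℂ V
  have hloc : ∀ y : ℝ, ∀ ζ₀ ∉ G.lifts, ∃ ε > 0, ∃ U : ℂ × ℂ → V →L[ℂ] V,
      AnalyticOnNhd ℂ U (Metric.ball ζ₀ ε ×ˢ Metric.ball 0 y) ∧
      (∀ p ∈ Metric.ball ζ₀ ε ×ˢ Metric.ball (0 : ℂ) y, IsUnit (U p)) ∧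
      Metric.ball ζ₀ ε ⊆ G.liftsᶜ ∧
      ∀ lam ∈ Metric.ball (0 : ℂ) y, ∀ ζ ∈ Metric.ball ζ₀ ε, φ ζ lam = U (ζ, lam) (φ ζ₀ lam) := by
    intro y ζ₀ hζ₀
    obtain ⟨ε, hε, hsub, U, hUa, hU, hU1, hUs⟩ := G.exists_propagator hζ₀ y
    refine ⟨ε, hε, U, hUa, hU, hsub, fun lam hlam ζ hζ => ?_⟩
    refine IsSolution.eqOn_of_convex (convex_ball ζ₀ ε) ((G.continuousOn_coeff lam).mono hsub)
      ((hφ lam).mono hsub) (hUs lam hlam (φ ζ₀ lam)) (Metric.mem_ball_self hε) ?_ hζ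
    rw [hU1]; rfl
  have hdiff : ∀ y : ℝ, ∀ ζ ∉ G.lifts, DifferentiableOn ℂ (φ ζ) (Metric.ball 0 y) := by
    intro y
    -- Invertible propagators carry differentiability in `λ` from `ζ₀` to nearby `ζ` and back, so
    -- `A` and `A'` are both open; connectedness makes `A` everything.
    let A : Set ℂ := {ζ | ζ ∉ G.lifts ∧ DifferentiableOn ℂ (φ ζ) (Metric.ball 0 y)}
    let A' : Set ℂ := {ζ | ζ ∉ G.lifts ∧ ¬ DifferentiableOn ℂ (φ ζ) (Metric.ball 0 y)}
    have hiff : ∀ ζ₀ ∉ G.lifts, ∃ ε > 0, Metric.ball ζ₀ ε ⊆ G.liftsᶜ ∧ ∀ ζ ∈ Metric.ball ζ₀ ε,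
        (DifferentiableOn ℂ (φ ζ) (Metric.ball 0 y) ↔
          DifferentiableOn ℂ (φ ζ₀) (Metric.ball 0 y)) := by
      intro ζ₀ hζ₀
      obtain ⟨ε, hε, U, hUa, hU, hsub, hφU⟩ := hloc y ζ₀ hζ₀
      refine ⟨ε, hε, hsub, fun ζ hζ => ?_⟩
      have hUd : ∀ lam ∈ Metric.ball (0 : ℂ) y,
          DifferentiableAt ℂ (fun lam => U (ζ, lam)) lam := fun lam hlam => by
        have h1 : DifferentiableAt ℂ U (ζ, lam) := (hUa _ ⟨hζ, hlam⟩).differentiableAt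
        exact h1.comp lam ((differentiableAt_const ζ).prodMk differentiableAt_id)
      constructor
      · intro hd lam hlam
        have h1 : DifferentiableWithinAt ℂ (fun lam => Ring.inverse (U (ζ, lam)) (φ ζ lam))
            (Metric.ball 0 y) lam :=
          ((hUd lam hlam).inverse (hU _ ⟨hζ, hlam⟩)).differentiableWithinAt.clm_apply (hd lam hlam)
        refine h1.congr (fun lam hlam => ?_) ?_ <;>
        · rw [hφU lam hlam ζ hζ, inverse_apply_apply (hU _ ⟨hζ, hlam⟩)]
      · intro hd lam hlam
        have h1 : DifferentiableWithinAt ℂ (fun lam => U (ζ, lam) (φ ζ₀ lam))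
            (Metric.ball 0 y) lam :=
          (hUd lam hlam).differentiableWithinAt.clm_apply (hd lam hlam)
        exact h1.congr (fun lam hlam => hφU lam hlam ζ hζ) (hφU lam hlam ζ hζ)
    have hA : IsOpen A := Metric.isOpen_iff.2 fun ζ₀ hζ₀ => by
      obtain ⟨ε, hε, hsub, hε'⟩ := hiff ζ₀ hζ₀.1
      exact ⟨ε, hε, fun ζ hζ => ⟨hsub hζ, (hε' ζ hζ).2 hζ₀.2⟩⟩
    have hA' : IsOpen A' := Metric.isOpen_iff.2 fun ζ₀ hζ₀ => by
      obtain ⟨ε, hε, hsub, hε'⟩ := hiff ζ₀ hζ₀.1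
      exact ⟨ε, hε, fun ζ hζ => ⟨hsub hζ, fun hd => hζ₀.2 ((hε' ζ hζ).1 hd)⟩⟩
    have hdisj : Disjoint A A' := Set.disjoint_left.2 fun ζ h1 h2 => h2.2 h1.2
    obtain ⟨ζ₁, hζ₁, hd⟩ := h y
    have := G.isPreconnected_compl_lifts.subset_left_of_subset_union hA hA' hdisj
      (fun ζ hζ => (em _).elim (fun hd => Or.inl ⟨hζ, hd⟩) fun hd => Or.inr ⟨hζ, hd⟩)
      ⟨ζ₁, hζ₁, hζ₁, hd⟩
    exact fun ζ hζ => (this hζ).2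
  rintro ⟨ζ₀, lam₀⟩ ⟨hζ₀, -⟩
  obtain ⟨ε, hε, U, hUa, -, -, hφU⟩ := hloc (‖lam₀‖ + 1) ζ₀ hζ₀
  have hlam₀ : lam₀ ∈ Metric.ball (0 : ℂ) (‖lam₀‖ + 1) := by simp
  have hmem : Metric.ball ζ₀ ε ×ˢ Metric.ball (0 : ℂ) (‖lam₀‖ + 1) ∈ 𝓝 (ζ₀, lam₀) :=
    (Metric.isOpen_ball.prod Metric.isOpen_ball).mem_nhds ⟨Metric.mem_ball_self hε, hlam₀⟩
  have h1 : AnalyticAt ℂ (φ ζ₀) lam₀ :=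
    (hdiff (‖lam₀‖ + 1) ζ₀ hζ₀).analyticAt (Metric.isOpen_ball.mem_nhds hlam₀)
  have h2 : AnalyticAt ℂ (fun p : ℂ × ℂ => φ ζ₀ p.2) (ζ₀, lam₀) :=
    AnalyticAt.fun_comp (g := φ ζ₀) h1 analyticAt_snd
  refine (analyticAt_clm_apply (hUa _ ⟨Metric.mem_ball_self hε, hlam₀⟩) h2).congr ?_
  filter_upwards [hmem] with p hp
  exact (hφU p.2 hp.2 p.1 hp.1).symm

end FiniteDim

end GaugedSystem

lemma exp_add_smul {V : Type*} [NormedAddCommGroup V] [NormedSpace ℂ V] [FiniteDimensional ℂ V]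
    (Q : V →L[ℂ] V) (x y : ℂ) :
    NormedSpace.exp ((x + y) • Q) = NormedSpace.exp (x • Q) * NormedSpace.exp (y • Q) := by
  have : CompleteSpace V := FiniteDimensional.complete ℂ V
  let : NormedAlgebra ℚ (V →L[ℂ] V) := NormedAlgebra.restrictScalars ℚ ℂ _
  rw [add_smul]
  exact NormedSpace.exp_add_of_commute (((Commute.refl Q).smul_left _).smul_right _)

/-! ### Existence and uniqueness of the regular solution. -/

namespace GaugedSystem

variable {V : Type v} [NormedAddCommGroup V] [NormedSpace ℂ V] (G : GaugedSystem V)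

/-- The function `ζ ↦ (z, λ z⁻ᵏ)`. -/
def curve (lam ζ : ℂ) : ℂ × ℂ := (Complex.exp ζ, lam * Complex.exp (-(G.k : ℂ) * ζ))

/-- The translation `ζ ↦ ζ + 2πi n`, compensated by `λ ↦ e^(2πikn) λ`, fixes `z` and `λ z⁻ᵏ`. This
symmetry makes solutions descend to functions of `(z, w)`. -/
lemma coeff_translate (n : ℤ) (lam ζ : ℂ) :
    G.coeff (lam * Complex.exp (G.k * (n * (2 * Real.pi * Complex.I))))
      (ζ + n * (2 * Real.pi * Complex.I)) = G.coeff lam ζ := by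
  have h1 : Complex.exp (ζ + n * (2 * Real.pi * Complex.I)) = Complex.exp ζ :=
    Complex.exp_periodic.int_mul n ζ
  have h2 : lam * Complex.exp (G.k * (n * (2 * Real.pi * Complex.I))) *
      Complex.exp (-(G.k : ℂ) * (ζ + n * (2 * Real.pi * Complex.I)))
      = lam * Complex.exp (-(G.k : ℂ) * ζ) := by
    rw [mul_assoc, ← Complex.exp_add]
    ring_nf
  rw [coeff, coeff, gaugedCoeff, gaugedCoeff, h1, h2]

lemma point_translate (n : ℤ) (lam ζ : ℂ) :
    G.point (lam * Complex.exp (G.k * (n * (2 * Real.pi * Complex.I))))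
      (ζ + n * (2 * Real.pi * Complex.I)) = G.point lam ζ := by
  have h1 : Complex.exp (ζ + n * (2 * Real.pi * Complex.I)) = Complex.exp ζ :=
    Complex.exp_periodic.int_mul n ζ
  have h2 : lam * Complex.exp (G.k * (n * (2 * Real.pi * Complex.I))) *
      Complex.exp ((1 - G.k : ℝ) * (ζ + n * (2 * Real.pi * Complex.I)))
      = lam * Complex.exp ((1 - G.k : ℝ) * ζ) := by
    have : (G.k : ℂ) * (n * (2 * Real.pi * Complex.I)) + (1 - G.k : ℝ) *
        (ζ + n * (2 * Real.pi * Complex.I))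
        = (1 - G.k : ℝ) * ζ + n * (2 * Real.pi * Complex.I) := by
      push_cast; ring
    rw [mul_assoc, ← Complex.exp_add, this]
    congr 1
    exact Complex.exp_periodic.int_mul n _
  rw [point, point, h1, h2]

lemma translate_mem_lifts (n : ℤ) (ζ : ℂ) :
    ζ + n * (2 * Real.pi * Complex.I) ∈ G.lifts ↔ ζ ∈ G.lifts := by
  have h1 : Complex.exp (ζ + n * (2 * Real.pi * Complex.I)) = Complex.exp ζ :=
    Complex.exp_periodic.int_mul n ζ
  simp only [lifts, Set.mem_ofPred_eq, h1]

lemma halfPlane_eq_preimage (r : ℝ) (lam ζ : ℂ) :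
    ζ ∈ G.halfPlane r lam ↔ ‖(G.point lam ζ).1‖ < r ∧ ‖(G.point lam ζ).2‖ < r := Iff.rfl

lemma translate_mem_halfPlane (n : ℤ) (r : ℝ) (lam ζ : ℂ) :
    ζ + n * (2 * Real.pi * Complex.I) ∈
      G.halfPlane r (lam * Complex.exp (G.k * (n * (2 * Real.pi * Complex.I)))) ↔
      ζ ∈ G.halfPlane r lam := by
  rw [halfPlane_eq_preimage, halfPlane_eq_preimage, point_translate]

variable [FiniteDimensional ℂ V]

omit [FiniteDimensional ℂ V] in
variable {G} in
lemma IsFrobenius.differentiableOn_point {r : ℝ} {Ψ : ℂ × ℂ → V →L[ℂ] V} (h : G.IsFrobenius r Ψ)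
    {y : ℝ} {ζ : ℂ} (hζ : ∀ lam ∈ Metric.ball (0 : ℂ) y, ζ ∈ G.halfPlane r lam) :
    DifferentiableOn ℂ (fun lam => Ψ (G.point lam ζ)) (Metric.ball 0 y) := fun lam hlam => by
  have h1 : DifferentiableAt ℂ Ψ (G.point lam ζ) :=
    (h.analytic _ (IsFrobenius.point_mem (hζ lam hlam))).differentiableAt
  have h2 : DifferentiableAt ℂ (fun lam => G.point lam ζ) lam :=
    (differentiableAt_const _).prodMk (differentiableAt_id.mul_const _)
  exact (h1.comp lam h2).differentiableWithinAt

-- A single `ζ` lies in the half planes of all `λ` of a disc, which allows differentiation in `λ` at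
-- fixed `ζ`.
omit [FiniteDimensional ℂ V] in
lemma exists_mem_halfPlane {r : ℝ} (hr : 0 < r) (y : ℝ) :
    ∃ ζ, ∀ lam ∈ Metric.ball (0 : ℂ) y, ζ ∈ G.halfPlane r lam := by
  obtain ⟨ζ, hζ⟩ := (G.eventually_halfPlane hr (y : ℂ)).exists
  refine ⟨ζ, fun lam hlam => G.halfPlane_subset ?_ hζ⟩
  rw [mem_ball_zero_iff] at hlam
  rw [Complex.norm_real]
  exact hlam.le.trans (le_abs_self y)

/-- The regular solution with prescribed value in the kernel of the residue. -/
theorem exists_regular_solution {χ₀ : V} (hχ₀ : G.Q χ₀ = 0) :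
    ∃ F : ℂ × ℂ → V, AnalyticOnNhd ℂ F ({z | z ∉ G.sing} ×ˢ Set.univ) ∧
      (∀ lam, IsSolution (G.coeff lam) (fun ζ => F (G.curve lam ζ)) G.liftsᶜ) ∧
      ∀ lam, Tendsto (fun ζ => F (G.curve lam ζ)) (comap Complex.re atBot) (𝓝 χ₀) := by
  obtain ⟨r, Ψ, hΨ⟩ := G.exists_isFrobenius
  have hbase : ∀ lam, ∃ c, c ∈ G.halfPlane r lam := fun lam =>
    (G.eventually_halfPlane hΨ.pos lam).exists
  choose c hc using hbase
  -- The global continuation of `Ψ χ₀`, for each `λ` separately; analyticity in `λ` is recovered in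
  -- `han` from a common point of the half planes.
  choose φ hφc hφ using fun lam => G.exists_solution lam (hΨ.halfPlane_subset_compl lam (hc lam))
    (Ψ (G.point lam (c lam)) χ₀)
  have hφΨ : ∀ lam, ∀ ζ ∈ G.halfPlane r lam, φ lam ζ = Ψ (G.point lam ζ) χ₀ := fun lam =>
    IsSolution.eqOn_of_convex (G.convex_halfPlane r lam)
      ((G.continuousOn_coeff lam).mono (hΨ.halfPlane_subset_compl lam))
      ((hφ lam).mono (hΨ.halfPlane_subset_compl lam))
      (hΨ.isSolution_of_apply_eq_zero lam hχ₀) (hc lam) (hφc lam)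
  have han : AnalyticOnNhd ℂ (fun p : ℂ × ℂ => φ p.2 p.1) (G.liftsᶜ ×ˢ Set.univ) := by
    refine analyticOnNhd_of_differentiableOn (φ := fun ζ lam => φ lam ζ) hφ fun y => ?_
    obtain ⟨ζ, hζ⟩ := G.exists_mem_halfPlane hΨ.pos (max y 1)
    have h0 : (0 : ℂ) ∈ Metric.ball (0 : ℂ) (max y 1) := by simp
    refine ⟨ζ, hΨ.halfPlane_subset_compl _ (hζ 0 h0), ?_⟩
    have hsub : Metric.ball (0 : ℂ) y ⊆ Metric.ball 0 (max y 1) :=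
      Metric.ball_subset_ball (le_max_left _ _)
    have h1 := (hΨ.differentiableOn_point hζ).mono hsub
    refine (h1.clm_apply (differentiableOn_const χ₀)).congr fun lam hlam => ?_
    exact hφΨ lam ζ (hζ lam (hsub hlam))
  have hper : ∀ (n : ℤ) (lam ζ : ℂ), ζ ∉ G.lifts →
      φ (lam * Complex.exp (G.k * (n * (2 * Real.pi * Complex.I))))
        (ζ + n * (2 * Real.pi * Complex.I)) = φ lam ζ := by
    intro n lam
    set lam' := lam * Complex.exp (G.k * (n * (2 * Real.pi * Complex.I)))
    have hsol : IsSolution (G.coeff lam) (fun ζ => φ lam' (ζ + n * (2 * Real.pi * Complex.I)))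
        G.liftsᶜ := fun ζ hζ => by
      have h1 := (hφ lam' _ (mt (G.translate_mem_lifts n ζ).1 hζ)).comp_add_const
      rw [G.coeff_translate] at h1
      exact h1
    refine G.eqOn_compl_lifts hsol (hφ lam) (hΨ.halfPlane_subset_compl lam (hc lam)) ?_
    rw [hφΨ lam' _ ((G.translate_mem_halfPlane n r lam _).2 (hc lam)), hφΨ lam _ (hc lam),
      G.point_translate]
  -- `λ = w zᵏ` inverts `w = λ z⁻ᵏ`; by `hper` the result does not depend on the branch of the
  -- logarithm.
  let F : ℂ × ℂ → V := fun p =>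
    if p.1 = 0 then χ₀ else φ (p.2 * Complex.exp (G.k * Complex.log p.1)) (Complex.log p.1)
  have hF : ∀ ζ w : ℂ, ζ ∉ G.lifts →
      F (Complex.exp ζ, w) = φ (w * Complex.exp (G.k * ζ)) ζ := fun ζ w hζ => by
    obtain ⟨n, hn⟩ := Complex.exp_eq_exp_iff_exists_int.1
      (Complex.exp_log (Complex.exp_ne_zero ζ))
    have h1 := hper n (w * Complex.exp (G.k * ζ)) ζ hζ
    simp only [F, Complex.exp_ne_zero, if_false]
    rw [hn, ← h1, mul_assoc w, ← Complex.exp_add, ← mul_add]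
  have hFφ : ∀ lam, ∀ ζ ∉ G.lifts, F (G.curve lam ζ) = φ lam ζ := fun lam ζ hζ => by
    rw [curve, hF _ _ hζ, mul_assoc, ← Complex.exp_add]
    simp
  refine ⟨F, ?_, fun lam => ?_, fun lam => ?_⟩
  · rintro ⟨z₀, w₀⟩ ⟨hz₀, -⟩
    rcases eq_or_ne z₀ 0 with rfl | hz
    · have hmem : ((0 : ℂ), (0 : ℂ) * w₀) ∈ Metric.ball (0 : ℂ) r ×ˢ Metric.ball (0 : ℂ) r := by
        simpa using hΨ.pos
      -- Here `λ z^(1-k) = z w` is small whenever `z` is, for every `w₀`; so `F` is analytic along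
      -- the whole line `z = 0`.
      have h1 : AnalyticAt ℂ (fun p : ℂ × ℂ => Ψ (p.1, p.1 * p.2) χ₀) (0, w₀) := by
        refine analyticAt_clm_apply ?_ analyticAt_const
        exact AnalyticAt.fun_comp (g := Ψ) (f := fun p : ℂ × ℂ => (p.1, p.1 * p.2))
          (hΨ.analytic _ hmem) (analyticAt_fst.prod (analyticAt_fst.mul analyticAt_snd))
      refine h1.congr ?_
      have hcont : Continuous fun p : ℂ × ℂ => (p.1, p.1 * p.2) := by fun_prop
      have hev : ∀ᶠ p in 𝓝 ((0 : ℂ), w₀),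
          (p.1, p.1 * p.2) ∈ Metric.ball (0 : ℂ) r ×ˢ Metric.ball (0 : ℂ) r :=
        hcont.continuousAt.eventually_mem
          ((Metric.isOpen_ball.prod Metric.isOpen_ball).mem_nhds hmem)
      filter_upwards [hev] with p hp
      obtain ⟨z, w⟩ := p
      rcases eq_or_ne z 0 with rfl | hz
      · have h2 : (((0 : ℂ), (0 : ℂ) * w) : ℂ × ℂ) = 0 := by simp
        simp only [F, if_true]
        rw [h2, hΨ.map_zero]; rfl
      · have hpt : G.point (w * Complex.exp (G.k * Complex.log z)) (Complex.log z)
            = (z, z * w) := by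
          rw [point, Complex.exp_log hz, mul_assoc, ← Complex.exp_add]
          have : (G.k : ℂ) * Complex.log z + (1 - G.k : ℝ) * Complex.log z = Complex.log z := by
            push_cast; ring
          rw [this, Complex.exp_log hz, mul_comm]
        have hlog : Complex.log z ∈ G.halfPlane r (w * Complex.exp (G.k * Complex.log z)) := by
          rw [halfPlane_eq_preimage, hpt]
          exact ⟨mem_ball_zero_iff.1 hp.1, mem_ball_zero_iff.1 hp.2⟩
        simp only [F, hz, if_false]
        rw [hφΨ _ _ hlog, hpt]
    -- A branch of the logarithm analytic at `z₀`, also when `z₀` is on the cut of `Complex.log`.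
    · let L : ℂ → ℂ := fun z => Complex.log z₀ + Complex.log (z / z₀)
      have hL : AnalyticAt ℂ L z₀ := by
        refine analyticAt_const.add
          (AnalyticAt.clog (f := fun z => z / z₀) (analyticAt_id.div_const) ?_)
        rw [div_self hz]
        exact Complex.one_mem_slitPlane
      have hexpL : ∀ z ≠ 0, Complex.exp (L z) = z := fun z hz' => by
        simp only [L]
        rw [Complex.exp_add, Complex.exp_log hz, Complex.exp_log (div_ne_zero hz' hz),
          mul_div_cancel₀ _ hz]
      have hmem : (L z₀, w₀ * Complex.exp (G.k * L z₀)) ∈ G.liftsᶜ ×ˢ (Set.univ : Set ℂ) := by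
        refine ⟨?_, trivial⟩
        change Complex.exp (L z₀) ∉ G.sing
        rw [hexpL _ hz]
        exact hz₀
      have hL' : AnalyticAt ℂ (fun p : ℂ × ℂ => L p.1) (z₀, w₀) :=
        AnalyticAt.fun_comp (g := L) (f := fun p : ℂ × ℂ => p.1) hL analyticAt_fst
      have h1 : AnalyticAt ℂ (fun p : ℂ × ℂ => φ (p.2 * Complex.exp (G.k * L p.1)) (L p.1))
          (z₀, w₀) :=
        AnalyticAt.fun_comp (g := fun p : ℂ × ℂ => φ p.2 p.1)
          (f := fun p : ℂ × ℂ => (L p.1, p.2 * Complex.exp (G.k * L p.1)))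
          (han _ hmem)
          (hL'.prod (analyticAt_snd.mul (analyticAt_const.mul hL').cexp))
      refine h1.congr ?_
      have hev1 : ∀ᶠ p in 𝓝 (z₀, w₀), p.1 ≠ 0 :=
        (continuous_fst.continuousAt (x := (z₀, w₀))).eventually_ne hz
      have hev2 : ∀ᶠ p in 𝓝 (z₀, w₀), p.1 ∉ G.sing :=
        (continuous_fst.continuousAt (x := (z₀, w₀))).eventually_mem
          (G.isOpen_notMem_sing.mem_nhds hz₀)
      filter_upwards [hev1, hev2] with p h1 h2
      have h3 : L p.1 ∉ G.lifts := by
        change Complex.exp (L p.1) ∉ G.sing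
        rwa [hexpL _ h1]
      have h4 := hF (L p.1) p.2 h3
      rw [hexpL _ h1] at h4
      exact h4.symm
  · intro ζ hζ
    have hev : (fun ζ => F (G.curve lam ζ)) =ᶠ[𝓝 ζ] φ lam :=
      Set.EqOn.eventuallyEq_of_mem (fun ζ hζ => hFφ lam ζ hζ) (G.isOpen_compl_lifts.mem_nhds hζ)
    change HasDerivAt _ (G.coeff lam ζ (F (G.curve lam ζ))) ζ
    rw [hFφ lam ζ hζ]
    exact (hφ lam ζ hζ).congr_of_eventuallyEq hev
  · refine (hΨ.tendsto lam χ₀).congr' ?_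
    filter_upwards [G.eventually_halfPlane hΨ.pos lam] with ζ hζ
    rw [hFφ lam ζ (hΨ.halfPlane_subset_compl lam hζ), hφΨ lam ζ hζ]

omit [FiniteDimensional ℂ V] in
/-- A quasi-periodic entire function has quasi-periodic Taylor coefficients. -/
lemma iteratedDeriv_quasiPeriodic {q : ℂ} {T : V →L[ℂ] V} {c : ℂ → V}
    (hc : Differentiable ℂ c) [CompleteSpace V] (h : ∀ lam, c (q * lam) = T (c lam)) (n : ℕ) :
    T (iteratedDeriv n c 0) = q ^ n • iteratedDeriv n c 0 := by
  have key : ∀ (n : ℕ) (lam : ℂ), q ^ n • iteratedDeriv n c (q * lam)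
      = T (iteratedDeriv n c lam) := by
    intro n
    induction n with
    | zero => intro lam; simp [h]
    | succ n ih =>
      intro lam
      have hd : Differentiable ℂ (iteratedDeriv n c) :=
        (hc.contDiff (n := (n + 1 : ℕ))).differentiable_iteratedDeriv n
          (by exact_mod_cast n.lt_succ_self)
      have h1 : HasDerivAt (fun lam => q ^ n • iteratedDeriv n c (q * lam))
          (q ^ n • (q • deriv (iteratedDeriv n c) (q * lam))) lam := by
        have h2 : HasDerivAt (fun lam : ℂ => q * lam) q lam := by
          simpa using (hasDerivAt_id lam).const_mul q
        exact ((hd (q * lam)).hasDerivAt.scomp lam h2).const_smul (q ^ n)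
      have h3 : HasDerivAt (fun lam => T (iteratedDeriv n c lam))
          (T (deriv (iteratedDeriv n c) lam)) lam :=
        T.hasFDerivAt.comp_hasDerivAt lam (hd lam).hasDerivAt
      rw [funext ih] at h1
      rw [iteratedDeriv_succ, ← h1.unique h3, smul_smul, pow_succ]
  have := key n 0
  rw [mul_zero] at this
  exact this.symm

/-- A solution which is entire in `λ`, single-valued and tends to `0` vanishes. -/
theorem eq_zero_of_tendsto_zero (h0 : Module.End.HasEigenvalue (G.Q : V →ₗ[ℂ] V) 0)
    {δ : ℂ → ℂ → V} (hδ : ∀ lam, IsSolution (G.coeff lam) (δ lam) G.liftsᶜ)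
    (hdiff : ∀ ζ ∉ G.lifts, Differentiable ℂ fun lam => δ lam ζ) {R : ℝ} (hR : 0 < R)
    (hper : ∀ lam ζ : ℂ, ‖Complex.exp ζ‖ < R →
      δ (lam * Complex.exp (G.k * (2 * Real.pi * Complex.I)))
        (ζ + 2 * Real.pi * Complex.I) = δ lam ζ)
    (hlim : ∀ lam, Tendsto (δ lam) (comap Complex.re atBot) (𝓝 0)) :
    ∀ lam, ∀ ζ ∉ G.lifts, δ lam ζ = 0 := by
  obtain ⟨r, Ψ, hΨ⟩ := G.exists_isFrobenius
  -- The coordinate of `δ` in the fundamental system `Ψ exp (-ζ Q)`; it is constant in `ζ` on the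
  -- half plane.
  let C : ℂ → ℂ → V := fun lam ζ =>
    NormedSpace.exp (ζ • G.Q) (Ring.inverse (Ψ (G.point lam ζ)) (δ lam ζ))
  have hunit : ∀ {lam ζ}, ζ ∈ G.halfPlane r lam → IsUnit (Ψ (G.point lam ζ)) := fun hζ =>
    hΨ.isUnit _ (IsFrobenius.point_mem hζ)
  have hexp : ∀ (ζ : ℂ) (v : V),
      NormedSpace.exp (ζ • (-G.Q)) (NormedSpace.exp (ζ • G.Q) v) = v := by
    intro ζ v
    rw [← clm_mul_apply, smul_neg, ← neg_smul, ← exp_add_smul, neg_add_cancel, zero_smul,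
      NormedSpace.exp_zero]
    rfl
  have hexp' : ∀ (ζ : ℂ) (v : V),
      NormedSpace.exp (ζ • G.Q) (NormedSpace.exp (ζ • (-G.Q)) v) = v := by
    intro ζ v
    rw [← clm_mul_apply, smul_neg, ← neg_smul, ← exp_add_smul, add_neg_cancel, zero_smul,
      NormedSpace.exp_zero]
    rfl
  have hrep : ∀ lam, ∀ ζ₁ ∈ G.halfPlane r lam, ∀ ζ ∈ G.halfPlane r lam,
      δ lam ζ = Ψ (G.point lam ζ) (NormedSpace.exp (ζ • (-G.Q)) (C lam ζ₁)) := by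
    intro lam ζ₁ hζ₁ ζ hζ
    refine IsSolution.eqOn_of_convex (G.convex_halfPlane r lam)
      ((G.continuousOn_coeff lam).mono (hΨ.halfPlane_subset_compl lam))
      ((hδ lam).mono (hΨ.halfPlane_subset_compl lam)) (hΨ.isSolution lam (C lam ζ₁)) hζ₁ ?_ hζ
    rw [hexp, apply_inverse_apply (hunit hζ₁)]
  have hconst : ∀ lam, ∀ ζ₁ ∈ G.halfPlane r lam, ∀ ζ ∈ G.halfPlane r lam, C lam ζ = C lam ζ₁ := by
    intro lam ζ₁ hζ₁ ζ hζ
    change NormedSpace.exp (ζ • G.Q) (Ring.inverse (Ψ (G.point lam ζ)) (δ lam ζ)) = _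
    rw [hrep lam ζ₁ hζ₁ ζ hζ, inverse_apply_apply (hunit hζ), hexp']
  choose p hp using fun lam => (G.eventually_halfPlane hΨ.pos lam).exists
  let c : ℂ → V := fun lam => C lam (p lam)
  have hcC : ∀ lam, ∀ ζ ∈ G.halfPlane r lam, c lam = C lam ζ := fun lam ζ hζ =>
    hconst lam ζ hζ (p lam) (hp lam)
  have hcd : Differentiable ℂ c := fun lam₀ => by
    obtain ⟨ζ, hζ⟩ := G.exists_mem_halfPlane hΨ.pos (‖lam₀‖ + 1)
    have hlam₀ : lam₀ ∈ Metric.ball (0 : ℂ) (‖lam₀‖ + 1) := by simp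
    have hΨd := (hΨ.differentiableOn_point hζ).differentiableAt (Metric.isOpen_ball.mem_nhds hlam₀)
    have h1 : DifferentiableAt ℂ (fun lam => C lam ζ) lam₀ :=
      (differentiableAt_const (NormedSpace.exp (ζ • G.Q))).clm_apply
        ((hΨd.inverse (hunit (hζ _ hlam₀))).clm_apply
          (hdiff ζ (hΨ.halfPlane_subset_compl _ (hζ _ hlam₀)) lam₀))
    refine h1.congr_of_eventuallyEq ?_
    filter_upwards [Metric.isOpen_ball.mem_nhds hlam₀] with lam hlam
    exact hcC lam ζ (hζ lam hlam)
  set q : ℂ := Complex.exp (G.k * (2 * Real.pi * Complex.I))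
  -- `δ` and `Ψ` are invariant under the translation, so only `exp (ζ Q)` contributes to the
  -- multiplier.
  have hquasi : ∀ lam,
      c (q * lam) = NormedSpace.exp ((2 * Real.pi * Complex.I : ℂ) • G.Q) (c lam) := by
    intro lam
    have hR' : ∀ᶠ ζ in comap Complex.re atBot, ‖Complex.exp ζ‖ < R := by
      have := Complex.tendsto_exp_comap_re_atBot.eventually_mem (Metric.ball_mem_nhds 0 hR)
      simpa using this
    obtain ⟨ζ, hζ, hζR⟩ := ((G.eventually_halfPlane hΨ.pos lam).and hR').exists
    have h1 := G.translate_mem_halfPlane 1 r lam ζ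
    have h2 := G.point_translate 1 lam ζ
    simp only [Int.cast_one, one_mul] at h1 h2
    have h3 := hcC _ _ (h1.2 hζ)
    rw [mul_comm q lam, h3, hcC lam ζ hζ]
    simp only [C]
    have h4 : NormedSpace.exp ((ζ + 2 * Real.pi * Complex.I : ℂ) • G.Q)
        = NormedSpace.exp ((2 * Real.pi * Complex.I : ℂ) • G.Q) * NormedSpace.exp (ζ • G.Q) := by
      rw [add_comm, exp_add_smul]
    rw [h2, hper lam ζ hζR, h4, clm_mul_apply]
  -- Each Taylor coefficient of `c` is an eigenvector of `exp (2πi Q)` for `exp (2πi n k)`. As `0`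
  -- is an eigenvalue, nonresonance of differences applies to single eigenvalues.
  have hQc : ∀ lam, G.Q (c lam) = 0 := by
    intro lam
    have hn : ∀ n, G.Q (iteratedDeriv n c 0) = 0 := fun n => by
      have h1 := iteratedDeriv_quasiPeriodic hcd hquasi n
      rw [← Complex.exp_nat_mul] at h1
      refine apply_eq_zero_of_exp_apply (k := G.k) (n := n) (fun ν hν m hm => ?_) (h1.trans ?_)
      · exact G.nonResonant ν 0 hν h0 m n (by rw [sub_zero, hm])
      · congr 2
        push_cast; ring
    have h1 := G.Q.hasSum (Complex.hasSum_taylorSeries_of_entire hcd 0 lam)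
    refine h1.unique ?_
    simp only [map_smul, hn, smul_zero]
    exact hasSum_zero
  have hc0 : ∀ lam, c lam = 0 := fun lam => by
    refine tendsto_nhds_unique (hΨ.tendsto lam (c lam)) ((hlim lam).congr' ?_)
    filter_upwards [G.eventually_halfPlane hΨ.pos lam] with ζ hζ
    have h2 : NormedSpace.exp (ζ • (-G.Q)) (c lam) = c lam := by
      have := exp_apply_of_apply_eq_smul (T := ζ • (-G.Q)) (x := c lam) (μ := 0) (by
        simp [hQc])
      simpa using this
    rw [hrep lam (p lam) (hp lam) ζ hζ]
    change Ψ (G.point lam ζ) (NormedSpace.exp (ζ • (-G.Q)) (c lam)) = _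
    rw [h2]
  intro lam
  have hzero : IsSolution (G.coeff lam) (fun _ => (0 : V)) G.liftsᶜ := fun ζ _ => by
    simpa using hasDerivAt_const ζ (0 : V)
  refine G.eqOn_compl_lifts (hδ lam) hzero (hΨ.halfPlane_subset_compl lam (hp lam)) ?_
  rw [hrep lam (p lam) (hp lam) (p lam) (hp lam)]
  change Ψ (G.point lam (p lam)) (NormedSpace.exp (p lam • (-G.Q)) (c lam)) = 0
  rw [hc0]
  simp

end GaugedSystem

/-! ### The principal gradation and the degree of the highest root vector. -/

section Grading

variable {ι : Type*} [Fintype ι] [DecidableEq ι] {L : Type u} [LieRing L] [LieAlgebra ℂ L]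
  {H : LieSubalgebra ℂ L} (b : LieAlgebra.Basis ι H)

/-- `ρ^∨` is defined through the inverse Cartan matrix, so pairing it with row `m` of `A` gives `1`.
The scalar `c = ±1` covers `e` and `f`. -/
lemma lie_rhoCheck_of_forall {x : L} {m : ι} {c : ℂ}
    (hx : ∀ j, ⁅b.h j, x⁆ = (c * (b.A m j : ℂ)) • x) : ⁅(rhoCheck b : L), x⁆ = c • x := by
  set B : Matrix ι ι ℂ := b.A.map (Int.cast : ℤ → ℂ) with hB
  have hdet : IsUnit B.det := by
    have h1 : B.det = ((b.A.det : ℤ) : ℂ) := by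
      rw [hB]
      exact (RingHom.map_det (Int.castRingHom ℂ) b.A).symm
    rw [h1, isUnit_iff_ne_zero, Int.cast_ne_zero]
    exact Matrix.nondegenerate_iff_det_ne_zero.1 b.nondegen
  have hrho : (rhoCheck b : L) = ∑ i, ∑ j, (B⁻¹ : Matrix ι ι ℂ) j i • b.h j := by
    simp only [rhoCheck, ← hB, AddSubmonoidClass.coe_finsetSum]
    rfl
  have hinv : ∀ i, ∑ j, B m j * (B⁻¹ : Matrix ι ι ℂ) j i = (1 : Matrix ι ι ℂ) m i := fun i => by
    rw [← Matrix.mul_nonsing_inv B hdet, Matrix.mul_apply]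
  calc ⁅(rhoCheck b : L), x⁆
      = ∑ i, ∑ j, (c * (B m j * (B⁻¹ : Matrix ι ι ℂ) j i)) • x := by
        rw [hrho, sum_lie]
        refine Finset.sum_congr rfl fun i _ => ?_
        rw [sum_lie]
        refine Finset.sum_congr rfl fun j _ => ?_
        rw [smul_lie, hx, smul_smul]
        congr 1
        simp only [hB, Matrix.map_apply]
        ring
    _ = c • x := by
        simp_rw [← Finset.sum_smul, ← Finset.mul_sum, hinv, Matrix.one_apply]
        simp

lemma lie_rhoCheck_e (i : ι) : ⁅(rhoCheck b : L), b.e i⁆ = (1 : ℂ) • b.e i :=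
  lie_rhoCheck_of_forall b (m := i) fun j => by
    rw [b.lie_h_e, one_mul, Int.cast_smul_eq_zsmul]

lemma lie_rhoCheck_f (i : ι) : ⁅(rhoCheck b : L), b.f i⁆ = (-1 : ℂ) • b.f i :=
  lie_rhoCheck_of_forall b (m := i) fun j => by
    rw [b.lie_h_f, neg_one_mul, ← Int.cast_neg, Int.cast_smul_eq_zsmul]

lemma lie_rhoCheck_cartan (h : H) : ⁅(rhoCheck b : L), (h : L)⁆ = 0 := by
  have := b.isLieAbelian_cartan
  have h1 := trivial_lie_zero H H (rhoCheck b) h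
  simpa using congrArg Subtype.val h1

/-- The eigenspaces of `ad ρ^∨`. -/
def gradedPiece (μ : ℂ) : Submodule ℂ L :=
  Module.End.eigenspace (LieAlgebra.ad ℂ L (rhoCheck b : L)) μ

lemma mem_gradedPiece {μ : ℂ} {x : L} :
    x ∈ gradedPiece b μ ↔ ⁅(rhoCheck b : L), x⁆ = μ • x := by
  rw [gradedPiece, Module.End.mem_eigenspace_iff]; rfl

lemma principalDegree_eq (d : ℤ) : principalDegree b d = gradedPiece b d := by
  ext x; rw [mem_gradedPiece]; rfl

lemma iSupIndep_gradedPiece : iSupIndep (gradedPiece b) :=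
  Module.End.eigenspaces_iSupIndep _

variable {b} in
lemma lie_mem_gradedPiece {μ ν : ℂ} {x y : L} (hx : x ∈ gradedPiece b μ)
    (hy : y ∈ gradedPiece b ν) : ⁅x, y⁆ ∈ gradedPiece b (μ + ν) := by
  rw [mem_gradedPiece] at *
  rw [leibniz_lie, hx, hy, smul_lie, lie_smul, add_smul]

variable {b} in
lemma lie_mem_iSup_gradedPiece {s t u : Set ℂ} (h : ∀ μ ∈ s, ∀ ν ∈ t, μ + ν ∈ u) {x y : L}
    (hx : x ∈ ⨆ μ ∈ s, gradedPiece b μ) (hy : y ∈ ⨆ μ ∈ t, gradedPiece b μ) :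
    ⁅x, y⁆ ∈ ⨆ μ ∈ u, gradedPiece b μ := by
  have h1 : ∀ μ ∈ s, ∀ x ∈ gradedPiece b μ,
      (⨆ ν ∈ t, gradedPiece b ν) ≤ (⨆ ν ∈ u, gradedPiece b ν).comap (LieAlgebra.ad ℂ L x) :=
    fun μ hμ x hx => iSup₂_le fun ν hν y hy =>
      (le_iSup₂ (f := fun ν (_ : ν ∈ u) => gradedPiece b ν) (μ + ν) (h μ hμ ν hν))
        (lie_mem_gradedPiece hx hy)
  have h2 : (⨆ μ ∈ s, gradedPiece b μ) ≤
      (⨆ ν ∈ u, gradedPiece b ν).comap (LieAlgebra.ad ℂ L y) :=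
    iSup₂_le fun μ hμ x hx => by
      have h3 : -⁅x, y⁆ ∈ ⨆ ν ∈ u, gradedPiece b ν := neg_mem (h1 μ hμ x hx hy)
      rwa [lie_skew] at h3
  have h3 : ⁅y, x⁆ ∈ ⨆ ν ∈ u, gradedPiece b ν := h2 hx
  rwa [← lie_skew, neg_mem_iff]

lemma gradedPiece_le_biSup {s : Set ℂ} {μ : ℂ} (hμ : μ ∈ s) :
    gradedPiece b μ ≤ ⨆ ν ∈ s, gradedPiece b ν :=
  le_iSup₂ (f := fun ν (_ : ν ∈ s) => gradedPiece b ν) μ hμ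

/-- The subalgebra spanned by the graded pieces with degrees in an additively closed set. -/
def gradedSubalgebra (s : Set ℂ) (hs : ∀ μ ∈ s, ∀ ν ∈ s, μ + ν ∈ s) : LieSubalgebra ℂ L where
  __ := ⨆ μ ∈ s, gradedPiece b μ
  lie_mem' hx hy := lie_mem_iSup_gradedPiece hs hx hy

variable {b} in
lemma mem_gradedSubalgebra {s : Set ℂ} {hs : ∀ μ ∈ s, ∀ ν ∈ s, μ + ν ∈ s} {μ : ℂ} (hμ : μ ∈ s)
    {x : L} (hx : ⁅(rhoCheck b : L), x⁆ = μ • x) : x ∈ gradedSubalgebra b s hs :=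
  gradedPiece_le_biSup b hμ ((mem_gradedPiece b).2 hx)

/-- The generators `e i` and `f i` are homogeneous of degrees `1` and `-1`, and the pieces of
integral degree span a subalgebra. -/
lemma iSup_gradedPiece_int : ⨆ μ ∈ Set.range (Int.cast : ℤ → ℂ), gradedPiece b μ = ⊤ := by
  have hs : ∀ μ ∈ Set.range (Int.cast : ℤ → ℂ), ∀ ν ∈ Set.range (Int.cast : ℤ → ℂ),
      μ + ν ∈ Set.range (Int.cast : ℤ → ℂ) := by
    rintro _ ⟨m, rfl⟩ _ ⟨n, rfl⟩
    exact ⟨m + n, Int.cast_add m n⟩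
  have h : LieSubalgebra.lieSpan ℂ L (Set.range b.e ∪ Set.range b.f)
      ≤ gradedSubalgebra b _ hs := by
    rw [LieSubalgebra.lieSpan_le]
    rintro _ (⟨i, rfl⟩ | ⟨i, rfl⟩)
    · exact mem_gradedSubalgebra (hs := hs) (μ := 1) ⟨1, Int.cast_one⟩ (lie_rhoCheck_e b i)
    · exact mem_gradedSubalgebra (hs := hs) (μ := -1) ⟨-1, by simp⟩ (lie_rhoCheck_f b i)
  rw [b.span_ef] at h
  exact eq_top_iff.2 fun x _ => h (LieSubalgebra.mem_top x)

lemma nPlus_le_iSup_gradedPiece :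
    nPlus b ≤ ⨆ μ ∈ (Int.cast : ℤ → ℂ) '' Set.Ici 1, gradedPiece b μ := by
  have hs : ∀ μ ∈ (Int.cast : ℤ → ℂ) '' Set.Ici 1, ∀ ν ∈ (Int.cast : ℤ → ℂ) '' Set.Ici 1,
      μ + ν ∈ (Int.cast : ℤ → ℂ) '' Set.Ici 1 := by
    rintro _ ⟨m, hm, rfl⟩ _ ⟨n, hn, rfl⟩
    refine ⟨m + n, ?_, Int.cast_add m n⟩
    simp only [Set.mem_Ici] at *
    omega
  have h : LieSubalgebra.lieSpan ℂ L (Set.range b.e) ≤ gradedSubalgebra b _ hs := by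
    rw [LieSubalgebra.lieSpan_le]
    rintro _ ⟨i, rfl⟩
    exact mem_gradedSubalgebra (hs := hs) (μ := 1) ⟨1, by simp, Int.cast_one⟩ (lie_rhoCheck_e b i)
  exact h

lemma gradedPiece_eq_bot_of_notMem {s : Set ℂ} (hs : ⨆ μ ∈ s, gradedPiece b μ = ⊤) {μ : ℂ}
    (hμ : μ ∉ s) : gradedPiece b μ = ⊥ := by
  have := (iSupIndep_gradedPiece b).disjoint_biSup hμ
  rwa [hs, disjoint_top] at this

variable [FiniteDimensional ℂ L]

lemma exists_gradedPiece_eq_bot : ∃ N : ℤ, ∀ d : ℤ, N < |d| → gradedPiece b d = ⊥ := by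
  have hfin : {d : ℤ | gradedPiece b d ≠ ⊥}.Finite :=
    (Module.End.finite_hasEigenvalue (LieAlgebra.ad ℂ L (rhoCheck b : L))).preimage
      (f := (Int.cast : ℤ → ℂ)) Int.cast_injective.injOn
  obtain ⟨N, hN⟩ := (hfin.image fun d => |d|).bddAbove
  refine ⟨N, fun d hd => by_contra fun h => ?_⟩
  exact absurd (hN ⟨d, h, rfl⟩) (not_le.2 hd)

-- `ad n` raises the degree by at least one and only finitely many degrees occur, so it is
-- nilpotent. This turns the finite sum in `UnipotentConj` into the full exponential.
variable {b} in
lemma ad_pow_finrank_eq_zero {n : L} (hn : n ∈ nPlus b) :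
    LieAlgebra.ad ℂ L n ^ Module.finrank ℂ L = 0 := by
  obtain ⟨N, hN⟩ := exists_gradedPiece_eq_bot b
  let F : ℤ → Submodule ℂ L := fun k => ⨆ μ ∈ (Int.cast : ℤ → ℂ) '' Set.Ici k, gradedPiece b μ
  have hstep : ∀ k, ∀ x ∈ F k, ⁅n, x⁆ ∈ F (k + 1) := fun k x hx => by
    refine lie_mem_iSup_gradedPiece ?_ (nPlus_le_iSup_gradedPiece b hn) hx
    rintro _ ⟨m, hm, rfl⟩ _ ⟨m', hm', rfl⟩
    refine ⟨m + m', ?_, Int.cast_add m m'⟩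
    simp only [Set.mem_Ici] at *
    omega
  have htop : F (-N) = ⊤ := by
    rw [eq_top_iff, ← iSup_gradedPiece_int b]
    refine iSup₂_le ?_
    rintro _ ⟨d, rfl⟩
    by_cases hd : -N ≤ d
    · exact gradedPiece_le_biSup b ⟨d, hd, rfl⟩
    · rw [hN d (lt_of_lt_of_le (by omega) (neg_le_abs d))]
      exact bot_le
  have hbot : ∀ k, N < k → F k = ⊥ := fun k hk => by
    refine eq_bot_iff.2 (iSup₂_le ?_)
    rintro _ ⟨d, hd, rfl⟩
    rw [hN d (lt_of_lt_of_le (hk.trans_le hd) (le_abs_self d))]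
  have hpow : ∀ (j : ℕ) (x : L), (LieAlgebra.ad ℂ L n ^ j) x ∈ F (-N + j) := by
    intro j
    induction j with
    | zero => intro x; simp [htop]
    | succ j ih =>
      intro x
      rw [pow_succ', Module.End.mul_apply]
      have := hstep _ _ (ih x)
      rw [add_assoc] at this
      exact_mod_cast this
  have hnil : LieAlgebra.ad ℂ L n ^ (2 * N.toNat + 1) = 0 := by
    ext x
    have := hpow (2 * N.toNat + 1) x
    rw [hbot _ (by push_cast; omega)] at this
    exact (Submodule.mem_bot ℂ).1 this
  exact LinearMap.ext fun x => by
    have h1 := Module.End.ker_pow_le_ker_pow_finrank (LieAlgebra.ad ℂ L n) (2 * N.toNat + 1)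
    have h2 : x ∈ LinearMap.ker (LieAlgebra.ad ℂ L n ^ (2 * N.toNat + 1)) := by
      rw [hnil]; simp
    exact h1 h2

/-- The elements annihilated by all `ad (e i)`. -/
def singularSpace : Submodule ℂ L := ⨅ i, LinearMap.ker (LieAlgebra.ad ℂ L (b.e i))

omit [DecidableEq ι] [FiniteDimensional ℂ L] in
lemma mem_singularSpace {x : L} : x ∈ singularSpace b ↔ ∀ i, ⁅b.e i, x⁆ = 0 := by
  simp [singularSpace]

omit [DecidableEq ι] [FiniteDimensional ℂ L] in
variable {b} in
lemma lie_mem_singularSpace {x : L} (h : H) (hx : x ∈ singularSpace b) :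
    ⁅(h : L), x⁆ ∈ singularSpace b := by
  rw [mem_singularSpace] at *
  intro i
  have h1 : ⁅(h : L), b.e i⁆ = b.baseSupp i h • b.e i := (b.baseSupp_apply_smul_e i h).symm
  rw [leibniz_lie, hx, lie_zero, add_zero, ← lie_skew (b.e i) (h : L), neg_lie, h1,
    smul_lie, hx, smul_zero, neg_zero]

variable [LieAlgebra.IsSimple ℂ L]

omit [DecidableEq ι] [FiniteDimensional ℂ L] in
/-- A nonzero subspace which is stable under the Cartan subalgebra and consists of elements
annihilated by all `ad (e i)` generates the whole Lie algebra under the operators `ad (f i)`. -/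
lemma eq_top_of_lie_f_mem {K P : Submodule ℂ L} (hK : K ≠ ⊥) (hKe : K ≤ singularSpace b)
    (hKh : ∀ (h : H), ∀ x ∈ K, ⁅(h : L), x⁆ ∈ K) (hKP : K ≤ P)
    (hP : ∀ i, ∀ x ∈ P, ⁅b.f i, x⁆ ∈ P) : P = ⊤ := by
  let S : Set (Submodule ℂ L) := {P | K ≤ P ∧ ∀ i, ∀ x ∈ P, ⁅b.f i, x⁆ ∈ P}
  -- The smallest subspace containing `K` and stable under all `ad (f i)`. The part `U'` of `U` that
  -- `h j` and `e j` map into `U` has the same two properties, by the commutation relations; so `U`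
  -- is an ideal, and simplicity applies.
  let U : Submodule ℂ L := sInf S
  have hKU : K ≤ U := le_sInf fun P hP => hP.1
  have hUf : ∀ i, ∀ x ∈ U, ⁅b.f i, x⁆ ∈ U := fun i x hx => by
    rw [Submodule.mem_sInf] at *
    exact fun P hP => hP.2 i x (hx P hP)
  let U' : Submodule ℂ L := U ⊓ ⨅ j, (U.comap (LieAlgebra.ad ℂ L (b.h j)) ⊓
    U.comap (LieAlgebra.ad ℂ L (b.e j)))
  have hU' : ∀ {x}, x ∈ U' ↔ x ∈ U ∧ ∀ j, ⁅b.h j, x⁆ ∈ U ∧ ⁅b.e j, x⁆ ∈ U := by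
    intro x
    simp [U', Submodule.mem_iInf]
  have hUU' : U ≤ U' := by
    refine sInf_le ⟨fun x hx => ?_, fun i x hx => ?_⟩
    · refine hU'.2 ⟨hKU hx, fun j => ⟨hKU (hKh (b.h' j) x hx), ?_⟩⟩
      rw [(mem_singularSpace b).1 (hKe hx) j]
      exact zero_mem _
    · obtain ⟨h1, h2⟩ := hU'.1 hx
      refine hU'.2 ⟨hUf i x h1, fun j => ⟨?_, ?_⟩⟩
      · rw [leibniz_lie, b.lie_h_f, ← Int.cast_smul_eq_zsmul ℂ, smul_lie]
        exact add_mem (U.smul_mem _ (hUf i x h1)) (hUf i _ (h2 j).1)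
      · rw [leibniz_lie]
        refine add_mem ?_ (hUf i _ (h2 j).2)
        rcases eq_or_ne j i with rfl | hij
        · rw [(b.sl2 j).lie_e_f]; exact (h2 j).1
        · rw [b.lie_e_f_ne j i hij, zero_lie]; exact zero_mem _
  let N : LieSubalgebra ℂ L :=
    { carrier := {y | ∀ x ∈ U, ⁅y, x⁆ ∈ U}
      add_mem' := fun h1 h2 x hx => by rw [add_lie]; exact add_mem (h1 x hx) (h2 x hx)
      zero_mem' := fun x _ => by rw [zero_lie]; exact zero_mem _
      smul_mem' := fun c y h x hx => by rw [smul_lie]; exact U.smul_mem _ (h x hx)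
      lie_mem' := fun h1 h2 x hx => by
        rw [lie_lie]; exact sub_mem (h1 _ (h2 x hx)) (h2 _ (h1 x hx)) }
  have hN : LieSubalgebra.lieSpan ℂ L (Set.range b.e ∪ Set.range b.f) ≤ N := by
    rw [LieSubalgebra.lieSpan_le]
    rintro _ (⟨i, rfl⟩ | ⟨i, rfl⟩)
    · exact fun x hx => ((hU'.1 (hUU' hx)).2 i).2
    · exact fun x hx => hUf i x hx
  rw [b.span_ef] at hN
  let I : LieIdeal ℂ L := { U with lie_mem := fun {y x} hx => hN (LieSubalgebra.mem_top y) x hx }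
  have hI : (I : Submodule ℂ L) = U := rfl
  rcases LieAlgebra.IsSimple.eq_bot_or_eq_top I with h | h
  · refine absurd (eq_bot_iff.2 (hKU.trans ?_)) hK
    rw [← hI, h]; rfl
  · rw [eq_top_iff]
    have h1 : (⊤ : Submodule ℂ L) = U := by rw [← hI, h]; rfl
    rw [h1]
    exact sInf_le ⟨hKP, hP⟩

omit [FiniteDimensional ℂ L] in
lemma gradedPiece_zero_ne_bot : gradedPiece b 0 ≠ ⊥ := by
  have : Nontrivial L := by
    by_contra h
    rw [not_nontrivial_iff_subsingleton] at h
    exact LieAlgebra.IsSimple.non_abelian (R := ℂ) (L := L) ⟨fun _ _ => Subsingleton.elim _ _⟩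
  have hne : Nonempty ι := by
    by_contra h
    rw [not_nonempty_iff] at h
    have h1 := b.span_ef
    rw [Set.range_eq_empty, Set.range_eq_empty, Set.union_empty, LieSubalgebra.span_empty] at h1
    obtain ⟨x, hx⟩ := exists_ne (0 : L)
    have h2 : x ∈ (⊥ : LieSubalgebra ℂ L) := h1 ▸ LieSubalgebra.mem_top x
    exact hx (LieSubalgebra.mem_bot x |>.1 h2)
  obtain ⟨i⟩ := hne
  refine fun h => b.linInd.ne_zero i ?_
  rw [← Submodule.mem_bot ℂ, ← h, mem_gradedPiece, zero_smul]
  exact lie_rhoCheck_cartan b (b.h' i)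

-- A singular vector of degree `μ` generates everything under the `ad (f i)`, which lower the degree
-- by one; so all degrees are of the form `μ - n`. As degree `0` occurs, `μ` is a natural number,
-- and it is the largest degree.
omit [FiniteDimensional ℂ L] in
lemma eq_of_singularSpace_inf_ne_bot {μ : ℂ} (hμ : singularSpace b ⊓ gradedPiece b μ ≠ ⊥) :
    μ = ((coxeterNumber b : ℤ) - 1 : ℤ) := by
  let s : Set ℂ := Set.range fun n : ℕ => μ - n
  have htop : ⨆ ν ∈ s, gradedPiece b ν = ⊤ := by
    have h0 : μ ∈ s := ⟨0, by simp⟩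
    refine eq_top_of_lie_f_mem b hμ inf_le_left (fun h x hx => ⟨lie_mem_singularSpace h hx.1, ?_⟩)
      (inf_le_right.trans (gradedPiece_le_biSup b h0)) fun i x hx => ?_
    · have := lie_mem_gradedPiece ((mem_gradedPiece b).2
        ((lie_rhoCheck_cartan b h).trans (zero_smul ℂ _).symm)) hx.2
      rwa [zero_add] at this
    · have hf : b.f i ∈ ⨆ ν ∈ ({-1} : Set ℂ), gradedPiece b ν :=
        gradedPiece_le_biSup b (Set.mem_singleton (-1 : ℂ))
          ((mem_gradedPiece b).2 (lie_rhoCheck_f b i))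
      refine lie_mem_iSup_gradedPiece (fun ν hν ν' hν' => ?_) hf hx
      obtain ⟨n, rfl⟩ := hν'
      rw [Set.mem_singleton_iff.1 hν]
      exact ⟨n + 1, by push_cast; ring⟩
  have hmem : ∀ ν, gradedPiece b ν ≠ ⊥ → ∃ n : ℕ, μ - n = ν := fun ν hν =>
    by_contra fun h => hν (gradedPiece_eq_bot_of_notMem b htop h)
  obtain ⟨m, hm⟩ := hmem 0 (gradedPiece_zero_ne_bot b)
  have hμm : μ = m := sub_eq_zero.1 hm
  have hgr : IsGreatest {d : ℕ | principalDegree b (d : ℤ) ≠ ⊥} m := by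
    refine ⟨fun h => hμ ?_, fun d hd => ?_⟩
    · rw [principalDegree_eq, Int.cast_natCast, ← hμm] at h
      rw [h, inf_bot_eq]
    · rw [Set.mem_ofPred_eq, principalDegree_eq, Int.cast_natCast] at hd
      obtain ⟨n, hn⟩ := hmem d hd
      have : m = d + n := by
        have h1 : (m : ℂ) = d + n := by rw [← hμm, ← hn]; ring
        exact_mod_cast h1
      omega
  rw [coxeterNumber, hgr.csSup_eq, hμm]
  push_cast
  ring

/-- The singular space is `ad ρ^∨`-stable, hence the sum of its homogeneous parts. In particular
`e_θ` has degree `h^∨ - 1`, as the gauge transformation requires. -/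
theorem singularSpace_le : singularSpace b ≤ principalDegree b ((coxeterNumber b : ℤ) - 1) := by
  have htop : ⨆ μ, gradedPiece b μ = ⊤ := by
    rw [eq_top_iff, ← iSup_gradedPiece_int b]
    exact iSup₂_le fun μ _ => le_iSup (gradedPiece b) μ
  have h1 := Submodule.inf_iSup_genEigenspace (p := singularSpace b)
    (f := LieAlgebra.ad ℂ L (rhoCheck b : L))
    (fun x hx => lie_mem_singularSpace (rhoCheck b) hx) 1
  change singularSpace b ⊓ (⨆ μ, gradedPiece b μ) = ⨆ μ, singularSpace b ⊓ gradedPiece b μ at h1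
  rw [htop, inf_top_eq] at h1
  rw [h1, principalDegree_eq]
  refine iSup_le fun μ => ?_
  by_cases hμ : singularSpace b ⊓ gradedPiece b μ = ⊥
  · rw [hμ]; exact bot_le
  · rw [← eq_of_singularSpace_inf_ne_bot b hμ]
    exact inf_le_right

end Grading

/-! ### Exponentials in a representation, and eigenvalues of conjugate elements. -/

section Representation

variable {ι : Type*} [Fintype ι] [DecidableEq ι] {L : Type u} [LieRing L] [LieAlgebra ℂ L]
  {H : LieSubalgebra ℂ L} (b : LieAlgebra.Basis ι H)
  {V : Type v} [NormedAddCommGroup V] [NormedSpace ℂ V] [FiniteDimensional ℂ V]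
  [LieRingModule L V] [LieModule ℂ L V]

variable (L V) in
/-- The representation by continuous linear maps. -/
def rep : L →ₗ[ℂ] V →L[ℂ] V :=
  (LinearMap.toContinuousLinearMap : (V →ₗ[ℂ] V) ≃ₗ[ℂ] V →L[ℂ] V).toLinearMap ∘ₗ
    (LieModule.toEnd ℂ L V : L →ₗ[ℂ] Module.End ℂ V)

@[simp] lemma rep_apply (x : L) (v : V) : rep L V x v = ⁅x, v⁆ := rfl

lemma rep_lie (x y : L) : rep L V ⁅x, y⁆ = rep L V x * rep L V y - rep L V y * rep L V x := by
  ext v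
  exact lie_lie x y v

lemma expRho_eq (ζ : ℂ) : expRho V b ζ = NormedSpace.exp (ζ • rep L V (rhoCheck b : L)) := rfl

lemma expRho_add (x y : ℂ) : expRho V b (x + y) = expRho V b x * expRho V b y :=
  exp_add_smul _ x y

lemma expRho_zero : expRho V b 0 = 1 := by
  rw [expRho_eq, zero_smul, NormedSpace.exp_zero]

lemma expRho_neg_apply (ζ : ℂ) (v : V) : expRho V b (-ζ) (expRho V b ζ v) = v := by
  rw [← clm_mul_apply, ← expRho_add, neg_add_cancel, expRho_zero]; rfl

lemma expRho_apply_neg (ζ : ℂ) (v : V) : expRho V b ζ (expRho V b (-ζ) v) = v := by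
  simpa using expRho_neg_apply b (-ζ) v

lemma hasDerivAt_expRho (ζ : ℂ) :
    HasDerivAt (expRho V b) (rep L V (rhoCheck b : L) * expRho V b ζ) ζ := by
  have : CompleteSpace V := FiniteDimensional.complete ℂ V
  exact hasDerivAt_exp_smul_const' (𝕂 := ℂ) (rep L V (rhoCheck b : L)) ζ

-- `x` intertwines `ζ ρ^∨ + ζ μ` with `ζ ρ^∨`, hence also their exponentials: conjugation by
-- `z^(ρ^∨)` multiplies `x` by `z^μ`.
variable {b} in
lemma expRho_mul_rep {μ : ℂ} {x : L} (hx : ⁅(rhoCheck b : L), x⁆ = μ • x) (ζ : ℂ) :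
    expRho V b ζ * rep L V x = Complex.exp (μ * ζ) • (rep L V x * expRho V b ζ) := by
  have : CompleteSpace V := FiniteDimensional.complete ℂ V
  let : NormedAlgebra ℚ (V →L[ℂ] V) := NormedAlgebra.restrictScalars ℚ ℂ _
  set R := rep L V (rhoCheck b : L)
  have h1 : SemiconjBy (rep L V x) (ζ • R + (μ * ζ) • (1 : V →L[ℂ] V)) (ζ • R) := by
    have h2 := rep_lie (V := V) (rhoCheck b : L) x
    rw [hx, map_smul] at h2
    have h3 : R * rep L V x = rep L V x * R + μ • rep L V x := by rw [h2]; abel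
    rw [SemiconjBy, smul_mul_assoc, h3, mul_add, mul_smul_comm, mul_smul_comm, mul_one, smul_add,
      smul_smul, mul_comm ζ μ]
  have h4 : NormedSpace.exp (ζ • R + (μ * ζ) • (1 : V →L[ℂ] V))
      = Complex.exp (μ * ζ) • NormedSpace.exp (ζ • R) := by
    rw [NormedSpace.exp_add_of_commute ((Commute.one_right _).smul_right _)]
    ext v
    rw [clm_mul_apply, exp_apply_of_apply_eq_smul (x := v) (μ := μ * ζ) (by simp), map_smul]
    rfl
  have h5 := h1.exp_right
  rw [h4, SemiconjBy, mul_smul_comm] at h5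
  exact h5.symm

/-- The exponential of a nilpotent inner derivation is implemented by conjugation. -/
lemma exp_rep_mul_rep {n : L} {M : ℕ} (hn : LieAlgebra.ad ℂ L n ^ M = 0) (x : L) :
    rep L V (∑ m ∈ Finset.range M, ((m.factorial : ℂ)⁻¹) • ((LieAlgebra.ad ℂ L n) ^ m) x) *
      NormedSpace.exp (rep L V n) = NormedSpace.exp (rep L V n) * rep L V x := by
  have : CompleteSpace V := FiniteDimensional.complete ℂ V
  set N := rep L V n with hN
  let a : ℕ → V →L[ℂ] V := fun m => rep L V ((LieAlgebra.ad ℂ L n ^ m) x)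
  have ha : ∀ m, a (m + 1) = N * a m - a m * N := fun m => by
    simp only [a]
    rw [pow_succ', Module.End.mul_apply, LieAlgebra.ad_apply, rep_lie]
  have haM : a M = 0 := by simp [a, hn]
  -- The image of `exp (t ad n) x`. It solves `X' = [N, X]`, so `exp (-t N) X(t) exp (t N)` is
  -- constant.
  let X : ℂ → V →L[ℂ] V := fun t => ∑ m ∈ Finset.range M, (t ^ m / m.factorial) • a m
  have hX : ∀ t, HasDerivAt X (N * X t - X t * N) t := fun t => by
    have h1 : HasDerivAt X (∑ m ∈ Finset.range M, ((m * t ^ (m - 1)) / m.factorial : ℂ) • a m) t :=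
      HasDerivAt.fun_sum fun m _ => by
        exact ((hasDerivAt_pow m t).div_const (m.factorial : ℂ)).smul_const (a m)
    convert! h1 using 1
    have h2 := Finset.sum_range_succ (fun m : ℕ => ((m * t ^ (m - 1)) / m.factorial : ℂ) • a m) M
    rw [haM, smul_zero, add_zero, Finset.sum_range_succ'] at h2
    simp only [X]
    rw [← h2, Finset.mul_sum, Finset.sum_mul, ← Finset.sum_sub_distrib]
    simp only [Nat.cast_zero, zero_mul, zero_div, zero_smul, add_zero, Nat.add_sub_cancel]
    refine Finset.sum_congr rfl fun m _ => ?_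
    have h3 : ((m + 1 : ℕ) * t ^ m / (m + 1).factorial : ℂ) = t ^ m / m.factorial := by
      rw [Nat.factorial_succ, Nat.cast_mul, mul_div_mul_left]
      exact_mod_cast m.succ_ne_zero
    rw [h3, ha, smul_sub, mul_smul_comm, smul_mul_assoc]
  let Y : ℂ → V →L[ℂ] V := fun t =>
    NormedSpace.exp (t • (-N)) * X t * NormedSpace.exp (t • N)
  have hY : ∀ t, HasDerivAt Y 0 t := fun t => by
    have h1 := ((hasDerivAt_exp_smul_const (𝕂 := ℂ) (-N) t).mul (hX t)).mul
      (hasDerivAt_exp_smul_const' (𝕂 := ℂ) N t)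
    convert! h1 using 1
    rw [Pi.mul_apply]
    noncomm_ring
  have h01 : Y 1 = Y 0 := is_const_of_deriv_eq_zero (fun t => (hY t).differentiableAt)
    (fun t => (hY t).deriv) 1 0
  have hX1 : X 1 = rep L V
      (∑ m ∈ Finset.range M, ((m.factorial : ℂ)⁻¹) • ((LieAlgebra.ad ℂ L n) ^ m) x) := by
    simp only [X, a, map_sum, map_smul, one_pow, one_div]
  have hX0 : X 0 = rep L V x := by
    rcases M with _ | M
    · have : x = 0 := by simpa using congrArg (fun T => T x) hn
      simp [X, this]
    · simp only [X]
      rw [Finset.sum_range_succ']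
      simp [a]
  rw [← hX1, ← hX0]
  have h2 : NormedSpace.exp N * NormedSpace.exp (-N) = 1 := by
    have := exp_add_smul N 1 (-1)
    rw [add_neg_cancel, zero_smul, NormedSpace.exp_zero, one_smul, neg_smul, one_smul] at this
    exact this.symm
  have h3 : NormedSpace.exp (-N) * X 1 * NormedSpace.exp N = X 0 := by
    simpa [Y, NormedSpace.exp_zero] using h01
  rw [← h3, ← mul_assoc, ← mul_assoc, h2, one_mul]

/-- An element and its conjugate by the unipotent group have the same eigenvalues. -/
lemma hasEigenvalue_of_unipotentConj [FiniteDimensional ℂ L] {x y : L} (h : UnipotentConj b x y)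
    {μ : ℂ} (hμ : Module.End.HasEigenvalue (LieModule.toEnd ℂ L V y) μ) :
    Module.End.HasEigenvalue (LieModule.toEnd ℂ L V x) μ := by
  obtain ⟨n, hn, rfl⟩ := h
  obtain ⟨v, hv⟩ := hμ.exists_hasEigenvector
  have h1 := exp_rep_mul_rep (V := V) (ad_pow_finrank_eq_zero hn) x
  set y := ∑ m ∈ Finset.range (Module.finrank ℂ L),
    ((m.factorial : ℂ)⁻¹) • ((LieAlgebra.ad ℂ L n) ^ m) x
  set N := rep L V n
  have h2 : ∀ w, NormedSpace.exp N (NormedSpace.exp (-N) w) = w := fun w => by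
    have := exp_add_smul N 1 (-1)
    rw [add_neg_cancel, zero_smul, NormedSpace.exp_zero, one_smul, neg_smul, one_smul] at this
    rw [← clm_mul_apply, ← this]; rfl
  have h3 : ∀ w, NormedSpace.exp (-N) (NormedSpace.exp N w) = w := fun w => by
    have := exp_add_smul N (-1) 1
    rw [neg_add_cancel, zero_smul, NormedSpace.exp_zero, one_smul, neg_smul, one_smul] at this
    rw [← clm_mul_apply, ← this]; rfl
  refine Module.End.hasEigenvalue_of_hasEigenvector (x := NormedSpace.exp (-N) v)
    ⟨Module.End.mem_eigenspace_iff.2 ?_, fun h0 => hv.2 ?_⟩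
  · have h4 := congrArg (fun T => T (NormedSpace.exp (-N) v)) h1
    simp only [clm_mul_apply, h2, rep_apply] at h4
    have h5 : ⁅y, v⁆ = μ • v := hv.apply_eq_smul
    rw [h5] at h4
    rw [LieModule.toEnd_apply_apply, ← h3 ⁅x, _⁆, ← h4, map_smul]
  · rw [← h2 v, h0, map_zero]

/-- The eigenvalues of `f + ℓ`, for `ℓ` in the Cartan subalgebra, are eigenvalues of `ℓ`. -/
lemma hasEigenvalue_of_principalF_add (l : H) {μ : ℂ}
    (hμ : Module.End.HasEigenvalue (LieModule.toEnd ℂ L V (principalF b + (l : L))) μ) :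
    Module.End.HasEigenvalue (LieModule.toEnd ℂ L V (l : L)) μ := by
  -- For `s ≠ 0`, conjugation by `exp (ζ ρ^∨)` with `exp (-ζ) = s` takes `f + ℓ` to `s f + ℓ`, so
  -- `μ` stays an eigenvalue; by continuity of the determinant it still is one at `s = 0`.
  let T : ℂ → V →L[ℂ] V := fun s => rep L V (s • principalF b + (l : L)) - μ • 1
  have hdet0 : ∀ s ≠ 0, (T s).det = 0 := fun s hs => by
    obtain ⟨v, hv⟩ := hμ.exists_hasEigenvector
    have hf : ⁅(rhoCheck b : L), principalF b⁆ = (-1 : ℂ) • principalF b := by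
      rw [principalF, lie_sum, Finset.smul_sum]
      exact Finset.sum_congr rfl fun i _ => lie_rhoCheck_f b i
    have hl : ⁅(rhoCheck b : L), (l : L)⁆ = (0 : ℂ) • (l : L) := by
      rw [zero_smul]; exact lie_rhoCheck_cartan b l
    set ζ := Complex.log s⁻¹ with hζ
    have hexp : Complex.exp (-1 * ζ) = s := by
      rw [neg_one_mul, Complex.exp_neg, Complex.exp_log (inv_ne_zero hs), inv_inv]
    have h1 : T s (expRho V b ζ v) = 0 := by
      have h2 := congrArg (fun T => T v) (expRho_mul_rep (V := V) hf ζ)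
      have h3 := congrArg (fun T => T v) (expRho_mul_rep (V := V) hl ζ)
      simp only [clm_mul_apply, hexp, zero_mul, Complex.exp_zero, one_smul,
        _root_.smul_apply] at h2 h3
      have h4 : ⁅principalF b + (l : L), v⁆ = μ • v := hv.apply_eq_smul
      have h5 : T s (expRho V b ζ v) = s • rep L V (principalF b) (expRho V b ζ v)
          + rep L V (l : L) (expRho V b ζ v) - μ • expRho V b ζ v := by
        simp only [T, map_add, map_smul]; rfl
      rw [h5, ← h2, ← h3, ← map_add, ← map_smul, ← map_sub]
      simp only [rep_apply]
      rw [← add_lie, h4, sub_self, map_zero]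
    have h6 : expRho V b ζ v ≠ 0 := fun h0 => hv.2 (by
      rw [← expRho_neg_apply b ζ v, h0, map_zero])
    by_contra hne
    have h7 := LinearMap.isUnit_iff_isUnit_det (T s : V →ₗ[ℂ] V) |>.2 (isUnit_iff_ne_zero.2 hne)
    rw [LinearMap.isUnit_iff_ker_eq_bot] at h7
    have h8 : expRho V b ζ v ∈ LinearMap.ker (T s : V →ₗ[ℂ] V) := h1
    rw [h7] at h8
    exact h6 ((Submodule.mem_bot ℂ).1 h8)
  have hcont : Continuous fun s => (T s).det := by
    refine ContinuousLinearMap.continuous_det.comp ?_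
    simp only [T, map_add, map_smul]
    fun_prop
  have hzero : (T 0).det = 0 := by
    have h1 : Tendsto (fun s => (T s).det) (𝓝[≠] 0) (𝓝 (T 0).det) :=
      (hcont.tendsto 0).mono_left nhdsWithin_le_nhds
    refine tendsto_nhds_unique h1 (tendsto_const_nhds.congr' ?_)
    filter_upwards [self_mem_nhdsWithin] with s hs
    exact (hdet0 s hs).symm
  have hker := LinearMap.bot_lt_ker_of_det_eq_zero (f := (T 0 : V →ₗ[ℂ] V)) hzero
  obtain ⟨v, hv, hv0⟩ := Submodule.exists_mem_ne_zero_of_ne_bot hker.ne'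
  refine Module.End.hasEigenvalue_of_hasEigenvector (x := v)
    ⟨Module.End.mem_eigenspace_iff.2 ?_, hv0⟩
  have h1 : rep L V ((0 : ℂ) • principalF b + (l : L)) v - μ • v = 0 := hv
  rw [zero_smul, zero_add, sub_eq_zero] at h1
  exact h1

omit [DecidableEq ι] in
include b in
/-- Every eigenvalue of an element of the Cartan subalgebra is the value of a weight. -/
lemma exists_isWeight (l : H) {μ : ℂ}
    (hμ : Module.End.HasEigenvalue (LieModule.toEnd ℂ L V (l : L)) μ) :
    ∃ ω : Module.Dual ℂ H, IsWeight H V ω ∧ ω l = μ := by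
  have := b.isLieAbelian_cartan
  let W : LieSubmodule ℂ H V :=
    { Module.End.eigenspace (LieModule.toEnd ℂ L V (l : L)) μ with
      lie_mem := fun {h v} hv => by
        have hv' : ⁅(l : L), v⁆ = μ • v := Module.End.mem_eigenspace_iff.1 hv
        have h0 : ⁅(l : L), (h : L)⁆ = 0 := congrArg Subtype.val (trivial_lie_zero H H l h)
        refine Module.End.mem_eigenspace_iff.2 ?_
        change ⁅(l : L), ⁅(h : L), v⁆⁆ = μ • ⁅(h : L), v⁆
        rw [leibniz_lie, h0, zero_lie, zero_add, hv', lie_smul] }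
  obtain ⟨v, hv⟩ := hμ.exists_hasEigenvector
  have : Nontrivial W := ⟨⟨⟨v, hv.1⟩, 0, fun h => hv.2 (congrArg Subtype.val h)⟩⟩
  obtain ⟨ω, hω⟩ := LieModule.exists_nontrivial_weightSpace_of_isSolvable ℂ H W
  obtain ⟨⟨w, hw⟩, hw0⟩ := exists_ne (0 : LieModule.weightSpace W ω)
  rw [LieModule.mem_weightSpace] at hw
  have hw' : ∀ h : H, ⁅(h : L), (w : V)⁆ = ω h • (w : V) := fun h => congrArg Subtype.val (hw h)
  have hwV : (w : V) ≠ 0 := fun h => hw0 (Subtype.ext (Subtype.ext h))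
  refine ⟨ω, ⟨w, hwV, hw'⟩, ?_⟩
  have h1 : ⁅(l : L), (w : V)⁆ = μ • (w : V) := Module.End.mem_eigenspace_iff.1 w.2
  exact smul_left_injective ℂ hwV ((hw' l).symm.trans h1)

end Representation

/-! ### Nonresonance from genericity, and the gauged coefficient. -/

section Translation

variable {ι : Type*} [Fintype ι] [DecidableEq ι] {L : Type u} [LieRing L] [LieAlgebra ℂ L]
  {H : LieSubalgebra ℂ L} {b : LieAlgebra.Basis ι H}
  {V : Type v} [NormedAddCommGroup V] [NormedSpace ℂ V] [FiniteDimensional ℂ V]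
  [LieRingModule L V] [LieModule ℂ L V]

lemma sgn_ne_zero (p : ZMod 2) : sgn p ≠ 0 := pow_ne_zero _ (neg_ne_zero.2 one_ne_zero)

lemma sgn_mul_self (p : ZMod 2) : sgn p * sgn p = 1 := by
  rw [sgn, ← mul_pow]; simp

lemma sgn_mul_sgn_mul (p : ZMod 2) (z : ℂ) : sgn p * (sgn p * z) = z := by
  rw [← mul_assoc, sgn_mul_self, one_mul]

lemma sgn_zero : sgn 0 = 1 := by simp [sgn]

namespace OperData

variable (D : OperData b)

/-- Eigenvalues pass from `f - ρ^∨ + r̄` to the conjugate `f + ℓ`, then to `ℓ`. Both conclusions are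
kept because `IsGeneric` compares a spectral value with the value of a weight. -/
lemma exists_isWeight_of_hasEigenvalue [FiniteDimensional ℂ L] {μ : ℂ}
    (hμ : Module.End.HasEigenvalue (LieModule.toEnd ℂ L V D.principalCoeff) μ) :
    Module.End.HasEigenvalue (LieModule.toEnd ℂ L V ((D.r - rhoCheck b : H) : L)) μ ∧
      ∃ ω : Module.Dual ℂ H, IsWeight H V ω ∧ ω (D.r - rhoCheck b) = μ := by
  have h1 := hasEigenvalue_of_unipotentConj b (V := V) D.rBar_conj hμ
  have h2 : principalF b - (rhoCheck b : L) + (D.r : L)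
      = principalF b + ((D.r - rhoCheck b : H) : L) := by
    rw [AddSubgroupClass.coe_sub]; abel
  rw [h2] at h1
  have h3 := hasEigenvalue_of_principalF_add b (D.r - rhoCheck b) h1
  exact ⟨h3, exists_isWeight b _ h3⟩

/-- For rational `k` with denominator `q`, `q (μ - ν)` is an integer. Genericity excludes positive
values, and with `μ` and `ν` exchanged also negative ones. -/
lemma nonResonant_rep [FiniteDimensional ℂ L] (hgen : IsGeneric.{u, v} b D.r D.k) {i : ι}
    (hV : IsFundamentalModule b i V) :
    NonResonant (rep L V D.principalCoeff) D.k := by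
  intro μ ν hμ hν m n h
  obtain ⟨hμ', ω, hω, rfl⟩ := D.exists_isWeight_of_hasEigenvalue (V := V) hμ
  obtain ⟨hν', ω', hω', rfl⟩ := D.exists_isWeight_of_hasEigenvalue (V := V) hν
  have h1 := hgen i V hV ω' hω' _ (Module.End.hasEigenvalue_iff_mem_spectrum.1 hμ')
  have h2 := hgen i V hV ω hω _ (Module.End.hasEigenvalue_iff_mem_spectrum.1 hν')
  set μ := ω (D.r - rhoCheck b)
  set ν := ω' (D.r - rhoCheck b)
  by_cases hk : Irrational D.k
  · by_contra hne
    refine h1.1 hk m n (fun hmn => hne ?_) h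
    obtain ⟨rfl, rfl⟩ := Prod.ext_iff.1 hmn
    simpa [sub_eq_zero] using h
  · obtain ⟨c, hc⟩ := not_not.1 hk
    have hden : (c.den : ℂ) ≠ 0 := Nat.cast_ne_zero.2 c.den_nz
    have hck : (c.den : ℂ) * (D.k : ℂ) = c.num := by
      rw [← hc]
      have := c.den_mul_eq_num
      exact_mod_cast congrArg (fun q : ℚ => (q : ℂ)) this
    have h3 : (c.den : ℂ) * (μ - ν) = ((c.den * m + n * c.num : ℤ) : ℂ) := by
      rw [h]; push_cast; rw [← hck]; ring
    set N : ℤ := c.den * m + n * c.num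
    rcases lt_trichotomy N 0 with hN | hN | hN
    · refine absurd ?_ (h2.2 c hc (-N).toNat (by omega))
      have h4 : (((-N).toNat : ℕ) : ℂ) = ((-N : ℤ) : ℂ) := by
        rw [← Int.cast_natCast, Int.toNat_of_nonneg (by omega)]
      rw [h4, Int.cast_neg, ← h3]; ring
    · rw [hN, Int.cast_zero] at h3
      exact sub_eq_zero.1 ((mul_eq_zero.1 h3).resolve_left hden)
    · refine absurd ?_ (h1.2 c hc N.toNat (by omega))
      have h4 : ((N.toNat : ℕ) : ℂ) = (N : ℂ) := by
        rw [← Int.cast_natCast, Int.toNat_of_nonneg (by omega)]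
      rw [h4, h3]

variable (V) in
/-- The residue `f - ρ^∨ + r̄ - a` at `z = 0` of the gauged equation. -/
def residue (a : ℂ) : V →L[ℂ] V := rep L V D.principalCoeff - a • 1

lemma hasEigenvalue_residue {a ν : ℂ}
    (h : Module.End.HasEigenvalue (D.residue V a : V →ₗ[ℂ] V) ν) :
    Module.End.HasEigenvalue (rep L V D.principalCoeff : V →ₗ[ℂ] V) (ν + a) := by
  obtain ⟨v, hv⟩ := h.exists_hasEigenvector
  refine Module.End.hasEigenvalue_of_hasEigenvector (x := v)
    ⟨Module.End.mem_eigenspace_iff.2 ?_, hv.2⟩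
  have h1 : rep L V D.principalCoeff v - a • v = ν • v := hv.apply_eq_smul
  change rep L V D.principalCoeff v = _
  rw [add_smul, ← h1, sub_add_cancel]

variable (V) in
/-- The polar part at the additional singularities. -/
def polarPart (p : ZMod 2) (z : ℂ) : V →L[ℂ] V :=
  sgn p • ∑ d ∈ Finset.range (coxeterNumber b), ∑ w ∈ D.sing, ∑ l ∈ Finset.range (d + 1),
    ((sgn p * z - w) ^ (d + 1 - l))⁻¹ • rep L V (D.s w d l)

/-- The additional singularities of `ℒ^{p/2}`. -/
def singImage (p : ZMod 2) : Finset ℂ := D.sing.image (sgn p * ·)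

lemma mem_singImage {p : ZMod 2} {z : ℂ} : z ∈ D.singImage p ↔ sgn p * z ∈ D.sing := by
  rw [singImage, Finset.mem_image]
  constructor
  · rintro ⟨w, hw, rfl⟩
    rwa [sgn_mul_sgn_mul]
  · exact fun h => ⟨_, h, sgn_mul_sgn_mul p z⟩

lemma analyticOnNhd_polarPart (p : ZMod 2) :
    AnalyticOnNhd ℂ (D.polarPart V p) {z | z ∉ D.singImage p} := by
  intro z hz
  refine AnalyticAt.fun_smul analyticAt_const ?_
  refine Finset.analyticAt_fun_sum _ fun d _ => ?_
  refine Finset.analyticAt_fun_sum _ fun w hw => ?_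
  refine Finset.analyticAt_fun_sum _ fun l _ => ?_
  refine AnalyticAt.fun_smul (AnalyticAt.fun_inv (by fun_prop) ?_) analyticAt_const
  refine pow_ne_zero _ fun h => hz (D.mem_singImage.2 ?_)
  rwa [sub_eq_zero.1 h]

/-- Conjugation of the coefficient by `z^(ρ^∨)`. -/
lemma exp_smul_expRho_mul_rep_coeff [FiniteDimensional ℂ L] [LieAlgebra.IsSimple ℂ L]
    (p : ZMod 2) (ζ lam : ℂ) :
    Complex.exp ζ • (expRho V b ζ * rep L V (D.coeff p ζ lam)) =
      (rep L V D.principalCoeff + rep L V (rhoCheck b : L) +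
        Complex.exp ζ • ((1 + lam * Complex.exp (-(D.k : ℂ) * ζ)) • (sgn p • rep L V D.eTheta) +
          D.polarPart V p (Complex.exp ζ))) * expRho V b ζ := by
  -- Degree `d` contributes `z^d`. With the factor `z` from `∂_ζ = z ∂_z`, this cancels `z^(-d-1)`
  -- in front of `r̄^d` and the pole of `s^d` at `0`, and leaves one factor `z` at `e_θ`.
  have hdeg : ∀ (d : ℕ) {x : L}, x ∈ principalDegree b (d : ℤ) →
      expRho V b ζ * rep L V x = Complex.exp ζ ^ d • (rep L V x * expRho V b ζ) := by
    intro d x hx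
    rw [expRho_mul_rep (μ := ((d : ℤ) : ℂ)) hx ζ, Int.cast_natCast, Complex.exp_nat_mul]
  have hf : ⁅(rhoCheck b : L), principalF b⁆ = (-1 : ℂ) • principalF b := by
    rw [principalF, lie_sum, Finset.smul_sum]
    exact Finset.sum_congr rfl fun i _ => lie_rhoCheck_f b i
  have hθ : ⁅(rhoCheck b : L), D.eTheta⁆ = ((coxeterNumber b : ℂ) - 1) • D.eTheta := by
    have := singularSpace_le b ((mem_singularSpace b).2 D.isHighestRootVector.2)
    have h1 : ⁅(rhoCheck b : L), D.eTheta⁆ = (((coxeterNumber b : ℤ) - 1 : ℤ) : ℂ) • D.eTheta :=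
      this
    simpa using h1
  set z := Complex.exp ζ with hz
  have hz0 : z ≠ 0 := Complex.exp_ne_zero ζ
  have h1 : z • (expRho V b ζ * rep L V (principalF b))
      = rep L V (principalF b) * expRho V b ζ := by
    rw [expRho_mul_rep hf, smul_smul, hz, ← Complex.exp_add]
    simp
  have h2 : ∀ d : ℕ, z • (expRho V b ζ *
      rep L V (Complex.exp (-((d : ℂ) + 1) * ζ) • D.rBar d))
        = rep L V (D.rBar d) * expRho V b ζ := by
    intro d
    rw [map_smul, mul_smul_comm, hdeg d (D.rBar_mem d).2, smul_smul, smul_smul]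
    have : z * Complex.exp (-((d : ℂ) + 1) * ζ) * z ^ d = 1 := by
      rw [hz, ← Complex.exp_nat_mul, ← Complex.exp_add, ← Complex.exp_add]
      ring_nf
      exact Complex.exp_zero
    rw [this, one_smul]
  have h3 : z • (expRho V b ζ * rep L V ((sgn p * Complex.exp ((1 - (coxeterNumber b : ℂ)) * ζ)
        * (1 + lam * Complex.exp (-(D.k : ℂ) * ζ))) • D.eTheta))
      = (z • ((1 + lam * Complex.exp (-(D.k : ℂ) * ζ)) • (sgn p • rep L V D.eTheta))) *
        expRho V b ζ := by
    rw [map_smul, mul_smul_comm, expRho_mul_rep hθ]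
    simp only [smul_smul, smul_mul_assoc]
    congr 1
    have : Complex.exp ((1 - (coxeterNumber b : ℂ)) * ζ) *
        Complex.exp (((coxeterNumber b : ℂ) - 1) * ζ) = 1 := by
      rw [← Complex.exp_add]
      ring_nf
      exact Complex.exp_zero
    linear_combination (z * sgn p * (1 + lam * Complex.exp (-(D.k : ℂ) * ζ))) * this
  have h4 : ∀ d : ℕ, z • (expRho V b ζ * rep L V (sgn p ^ (d + 1) • D.sFun d (sgn p * z)))
      = (z • (sgn p • ∑ w ∈ D.sing, ∑ l ∈ Finset.range (d + 1),
        ((sgn p * z - w) ^ (d + 1 - l))⁻¹ • rep L V (D.s w d l))) * expRho V b ζ := by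
    intro d
    have hc : z * (sgn p ^ (d + 1) * ((sgn p * z) ^ d)⁻¹ * z ^ d) = z * sgn p := by
      have := sgn_ne_zero p
      field_simp
      ring
    have hmem : ∑ w ∈ D.sing, ∑ l ∈ Finset.range (d + 1),
        ((sgn p * z - w) ^ (d + 1 - l))⁻¹ • D.s w d l ∈ principalDegree b (d : ℤ) :=
      Submodule.sum_mem _ fun w _ => Submodule.sum_mem _ fun l _ =>
        Submodule.smul_mem _ _ (D.s_mem w d l).2
    rw [sFun, map_smul, map_smul, mul_smul_comm, mul_smul_comm, hdeg d hmem]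
    simp only [smul_smul, smul_mul_assoc]
    rw [← hc]
    simp only [map_sum, map_smul]
    congr 1
    ring
  rw [coeff, map_add, map_add, map_add, map_sum, map_sum, mul_add, mul_add, mul_add, smul_add,
    smul_add, smul_add, Finset.mul_sum, Finset.mul_sum, Finset.smul_sum, Finset.smul_sum, h1, h3,
    Finset.sum_congr rfl fun d _ => h2 d, Finset.sum_congr rfl fun d _ => h4 d,
    ← Finset.sum_mul, ← Finset.sum_mul, ← add_mul, ← add_mul, ← add_mul, ← Finset.smul_sum,
    ← Finset.smul_sum, principalCoeff, map_add, map_sub, map_sum, polarPart]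
  congr 1
  rw [smul_add]
  abel

end OperData

end Translation

/-! ### The gauge transformation, and transfer to the original equation. -/

section Solutions

variable {ι : Type*} [Fintype ι] [DecidableEq ι] {L : Type u} [LieRing L] [LieAlgebra ℂ L]
  {H : LieSubalgebra ℂ L} {b : LieAlgebra.Basis ι H}
  {V : Type v} [NormedAddCommGroup V] [NormedSpace ℂ V] [FiniteDimensional ℂ V]
  [LieRingModule L V] [LieModule ℂ L V]

variable (V) (b) in
/-- The gauge transformation `z^a z^(ρ^∨)`. -/
def gauge (a ζ : ℂ) : V →L[ℂ] V := Complex.exp (a * ζ) • expRho V b ζ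

lemma gauge_gauge_neg (a ζ : ℂ) (v : V) : gauge b V a ζ (gauge b V a (-ζ) v) = v := by
  simp only [gauge, _root_.smul_apply, map_smul, expRho_apply_neg, smul_smul]
  rw [← Complex.exp_add]
  simp

lemma gauge_neg_gauge (a ζ : ℂ) (v : V) : gauge b V a (-ζ) (gauge b V a ζ v) = v := by
  simpa using gauge_gauge_neg (b := b) a (-ζ) v

lemma frobeniusForm_eq_gauge (k : ℝ) (a : ℂ) (F : ℂ × ℂ → V) (ζ lam : ℂ) :
    frobeniusForm b k a F (ζ, lam) =
      gauge b V a (-ζ) (F (Complex.exp ζ, lam * Complex.exp (-(k : ℂ) * ζ))) := by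
  simp only [frobeniusForm, gauge, _root_.smul_apply, map_smul, mul_neg, neg_mul]

lemma hasDerivAt_gauge (a ζ : ℂ) : HasDerivAt (gauge b V a)
    ((rep L V (rhoCheck b : L) + a • 1) * gauge b V a ζ) ζ := by
  have h1 : HasDerivAt (fun ζ => Complex.exp (a * ζ)) (Complex.exp (a * ζ) * a) ζ := by
    simpa using ((hasDerivAt_id ζ).const_mul a).cexp
  convert! h1.smul (hasDerivAt_expRho (V := V) b ζ) using 1
  simp only [gauge, add_mul, mul_smul_comm, smul_mul_assoc, one_mul]
  rw [smul_add, smul_smul]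

lemma gauge_mul_rhoCheck (a ζ : ℂ) :
    gauge b V a ζ * rep L V (rhoCheck b : L) = rep L V (rhoCheck b : L) * gauge b V a ζ := by
  have h := expRho_mul_rep (b := b) (V := V) (x := (rhoCheck b : L)) (μ := 0)
    (by rw [lie_self, zero_smul]) ζ
  rw [zero_mul, Complex.exp_zero, one_smul] at h
  rw [gauge, smul_mul_assoc, h, mul_smul_comm]

namespace OperData

variable (D : OperData b) [FiniteDimensional ℂ L] [LieAlgebra.IsSimple ℂ L]

variable (V) in
/-- The coefficient of the gauged equation. -/
def gaugedOper (a : ℂ) (p : ZMod 2) (lam ζ : ℂ) : V →L[ℂ] V :=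
  gaugedCoeff (D.residue V a) (sgn p • rep L V D.eTheta) (D.polarPart V p) D.k lam ζ

lemma exp_smul_gauge_mul_rep_coeff (a : ℂ) (p : ZMod 2) (ζ lam : ℂ) :
    Complex.exp ζ • (gauge b V a ζ * rep L V (D.coeff p ζ lam)) =
      (rep L V (rhoCheck b : L) + a • 1 - D.gaugedOper V a p lam ζ) * gauge b V a ζ := by
  have h := D.exp_smul_expRho_mul_rep_coeff (V := V) p ζ lam
  rw [gauge, smul_mul_assoc, smul_comm, h, mul_smul_comm]
  congr 2
  rw [gaugedOper, gaugedCoeff, residue]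
  abel

lemma hasDerivAt_gauge_apply {a : ℂ} {p : ZMod 2} {lam ζ : ℂ} {ψ : ℂ → V}
    (h : D.SolvesAt p lam ψ ζ) :
    HasDerivAt (fun ζ => gauge b V a ζ (ψ ζ))
      (D.gaugedOper V a p lam ζ (gauge b V a ζ (ψ ζ))) ζ := by
  have h1 := (hasDerivAt_gauge (V := V) (b := b) a ζ).clm_apply h
  have h2 := congrArg (fun T => T (ψ ζ)) (D.exp_smul_gauge_mul_rep_coeff (V := V) a p ζ lam)
  simp only [_root_.smul_apply, clm_mul_apply, rep_apply, _root_.sub_apply] at h2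
  convert! h1 using 1
  rw [map_neg, map_smul, h2, clm_mul_apply]
  abel

lemma solvesAt_gauge_neg {a : ℂ} {p : ZMod 2} {lam ζ : ℂ} {φ : ℂ → V}
    (h : HasDerivAt φ (D.gaugedOper V a p lam ζ (φ ζ)) ζ) :
    D.SolvesAt p lam (fun ζ => gauge b V a (-ζ) (φ ζ)) ζ := by
  have h1 := ((hasDerivAt_gauge (V := V) (b := b) a (-ζ)).scomp ζ (hasDerivAt_neg ζ)).clm_apply h
  have h2 := congrArg (fun T => gauge b V a (-ζ) (T (gauge b V a (-ζ) (φ ζ))))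
    (D.exp_smul_gauge_mul_rep_coeff (V := V) a p ζ lam)
  simp only [_root_.smul_apply, clm_mul_apply, rep_apply, map_smul, gauge_neg_gauge,
    gauge_gauge_neg] at h2
  have h3 := congrArg (fun T => T (φ ζ)) (gauge_mul_rhoCheck (V := V) (b := b) a (-ζ))
  simp only [clm_mul_apply] at h3
  rw [SolvesAt, h2]
  convert! h1 using 1
  simp only [Function.comp, _root_.sub_apply, _root_.add_apply, _root_.smul_apply, map_sub,
    map_add, h3, clm_mul_apply, map_smul, add_mul, smul_mul_assoc, one_mul,
    one_apply_eq_self, neg_smul, one_smul, _root_.neg_apply]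
  abel

-- The rotation `(z, λ) ↦ (e^s z, e^(ks) λ)` identifies the gauged equation of `ℒ^{p/2}` with that
-- of `ℒ`. It transfers the trivial monodromy, which is assumed for `ℒ`.
omit [FiniteDimensional ℂ L] [LieAlgebra.IsSimple ℂ L] in
lemma gaugedOper_add_shift (a : ℂ) (p : ZMod 2) {s : ℂ} (hs : Complex.exp s = sgn p)
    (lam ζ : ℂ) :
    D.gaugedOper V a 0 (lam * Complex.exp (D.k * s)) (ζ + s) = D.gaugedOper V a p lam ζ := by
  have h1 : Complex.exp (ζ + s) = sgn p * Complex.exp ζ := by rw [Complex.exp_add, hs, mul_comm]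
  have h2 : lam * Complex.exp (D.k * s) * Complex.exp (-(D.k : ℂ) * (ζ + s))
      = lam * Complex.exp (-(D.k : ℂ) * ζ) := by
    rw [mul_assoc, ← Complex.exp_add]
    ring_nf
  rw [gaugedOper, gaugedOper, gaugedCoeff, gaugedCoeff, h1, h2, polarPart, polarPart, sgn_zero]
  simp only [one_smul, one_mul]
  module

/-- The gauged equation. -/
def gaugedSystem (hmon : TrivialMonodromy.{u, v} D) (a : ℂ)
    (hQ : NonResonant (D.residue V a) D.k) (p : ZMod 2) : GaugedSystem V where
  Q := D.residue V a
  E := sgn p • rep L V D.eTheta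
  S := D.polarPart V p
  k := D.k
  sing := D.singImage p
  k_lt_one := D.k_lt_one
  zero_notMem := by rw [mem_singImage, mul_zero]; exact D.zero_notMem
  analytic := D.analyticOnNhd_polarPart p
  nonResonant := hQ
  trivialMonodromy := fun lam ζ₀ hζ₀ => by
    obtain ⟨s, hs⟩ : ∃ s, Complex.exp s = sgn p :=
      ⟨_, Complex.exp_log (sgn_ne_zero p)⟩
    have hmem : Complex.exp (ζ₀ + s) ∈ D.sing := by
      rwa [Complex.exp_add, hs, mul_comm, ← mem_singImage]
    obtain ⟨ε, hε, h⟩ := hmon V (lam * Complex.exp (D.k * s)) (ζ₀ + s) hmem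
    have hball : ∀ ζ ∈ Metric.ball ζ₀ ε \ {ζ₀}, ζ + s ∈ Metric.ball (ζ₀ + s) ε \ {ζ₀ + s} :=
      fun ζ hζ => ⟨by simpa using hζ.1, by simpa using hζ.2⟩
    refine ⟨ε, hε, fun ζ₁ hζ₁ w => ?_⟩
    obtain ⟨ψ, hψ, hψ'⟩ := h (ζ₁ + s) (hball ζ₁ hζ₁) (gauge b V a (-(ζ₁ + s)) w)
    refine ⟨fun ζ => gauge b V a (ζ + s) (ψ (ζ + s)), ?_, fun ζ hζ => ?_⟩
    · change gauge b V a (ζ₁ + s) (ψ (ζ₁ + s)) = w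
      rw [hψ, gauge_gauge_neg]
    · have h1 := (D.hasDerivAt_gauge_apply (a := a) (hψ' _ (hball ζ hζ))).comp_add_const
      rw [D.gaugedOper_add_shift a p hs] at h1
      exact h1

omit [LieAlgebra.IsSimple ℂ L] in
lemma nonResonant_residue (hgen : IsGeneric.{u, v} b D.r D.k) {i : ι}
    (hV : IsFundamentalModule b i V) (a : ℂ) : NonResonant (D.residue V a) D.k :=
  fun μ ν hμ hν m n h => by
    have := D.nonResonant_rep hgen hV (μ + a) (ν + a) (D.hasEigenvalue_residue hμ)
      (D.hasEigenvalue_residue hν) m n (by rw [← h]; ring)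
    exact add_right_cancel this

omit [FiniteDimensional ℂ L] [LieAlgebra.IsSimple ℂ L] in
lemma mem_cover_iff {p : ZMod 2} {ζ : ℂ} : ζ ∈ D.cover p ↔ Complex.exp ζ ∉ D.singImage p :=
  not_congr D.mem_singImage.symm

section Form

variable {a : ℂ} {p : ZMod 2} {F : ℂ × ℂ → V}

omit [FiniteDimensional ℂ L] [LieAlgebra.IsSimple ℂ L] in
lemma analyticOnNhd_frobeniusForm
    (hF : AnalyticOnNhd ℂ F ({z | z ∉ D.singImage p} ×ˢ Set.univ)) :
    AnalyticOnNhd ℂ (frobeniusForm b D.k a F) (D.cover p ×ˢ Set.univ) := by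
  rintro ⟨ζ, lam⟩ ⟨hζ, -⟩
  let c : ℂ × ℂ → ℂ × ℂ := fun x => (Complex.exp x.1, x.2 * Complex.exp (-(D.k : ℂ) * x.1))
  have hc : AnalyticAt ℂ c (ζ, lam) :=
    analyticAt_fst.cexp.prod (analyticAt_snd.mul (analyticAt_const.mul analyticAt_fst).cexp)
  have hmem : c (ζ, lam) ∈ {z | z ∉ D.singImage p} ×ˢ (Set.univ : Set ℂ) :=
    ⟨D.mem_cover_iff.1 hζ, trivial⟩
  have h1 : AnalyticAt ℂ (fun x => F (c x)) (ζ, lam) := AnalyticAt.fun_comp (hF _ hmem) hc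
  have hgauge : Differentiable ℂ (gauge b V a) := fun ζ =>
    (hasDerivAt_gauge (b := b) (V := V) a ζ).differentiableAt
  have hg : AnalyticAt ℂ (gauge b V a) (-ζ) := hgauge.analyticAt (-ζ)
  have hneg : AnalyticAt ℂ (fun x : ℂ × ℂ => -x.1) (ζ, lam) := analyticAt_fst.neg
  have h2 : AnalyticAt ℂ (fun x : ℂ × ℂ => gauge b V a (-x.1)) (ζ, lam) :=
    AnalyticAt.fun_comp (g := gauge b V a) (f := fun x : ℂ × ℂ => -x.1) (x := (ζ, lam)) hg hneg
  have h3 : frobeniusForm b D.k a F = fun x => gauge b V a (-x.1) (F (c x)) :=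
    funext fun x => frobeniusForm_eq_gauge D.k a F x.1 x.2
  rw [h3]
  exact analyticAt_clm_apply h2 h1

-- `z` and `λ z⁻ᵏ` are invariant, and `e^(2πiρ^∨)` undoes the change of `z^(-ρ^∨)`; only `z^(-a)`
-- contributes.
omit [FiniteDimensional ℂ L] [LieAlgebra.IsSimple ℂ L] in
lemma monodromy_frobeniusForm (x : ℂ × ℂ) :
    monodromy b D.k (frobeniusForm b D.k a F) x =
      Complex.exp (-(2 * Real.pi * Complex.I * a)) • frobeniusForm b D.k a F x := by
  obtain ⟨ζ, lam⟩ := x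
  simp only [monodromy, frobeniusForm]
  have h1 : Complex.exp (2 * Real.pi * Complex.I * D.k) * lam *
      Complex.exp (-(D.k : ℂ) * (ζ + 2 * Real.pi * Complex.I))
      = lam * Complex.exp (-(D.k : ℂ) * ζ) := by
    rw [mul_comm _ lam, mul_assoc, ← Complex.exp_add]
    ring_nf
  have h2 : ∀ v : V, expRho V b (2 * Real.pi * Complex.I)
      (expRho V b (-(ζ + 2 * Real.pi * Complex.I)) v) = expRho V b (-ζ) v := by
    intro v
    rw [← clm_mul_apply, ← expRho_add]
    ring_nf
  have h3 : Complex.exp (-a * (ζ + 2 * Real.pi * Complex.I))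
      = Complex.exp (-(2 * Real.pi * Complex.I * a)) * Complex.exp (-a * ζ) := by
    rw [← Complex.exp_add]
    ring_nf
  rw [h1, h2, Complex.exp_periodic ζ, h3, ← smul_smul, map_smul]

lemma frobeniusForm_mem_solutions
    (hF : AnalyticOnNhd ℂ F ({z | z ∉ D.singImage p} ×ˢ Set.univ))
    (hFs : ∀ lam, IsSolution (D.gaugedOper V a p lam)
      (fun ζ => F (Complex.exp ζ, lam * Complex.exp (-(D.k : ℂ) * ζ)))
      {ζ | Complex.exp ζ ∉ D.singImage p}) :
    frobeniusForm b D.k a F ∈ D.solutions V p := by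
  refine ⟨D.analyticOnNhd_frobeniusForm hF, fun ζ hζ lam => ?_⟩
  simp only [frobeniusForm_eq_gauge]
  exact D.solvesAt_gauge_neg (hFs lam ζ (D.mem_cover_iff.1 hζ))

/-- A solution is determined by the leading term of its Frobenius expansion. -/
lemma eqOn_of_isFrobeniusExpansion (hmon : TrivialMonodromy.{u, v} D)
    (hQ : NonResonant (D.residue V a) D.k) {χ₀ : V} (hχ₀ : D.residue V a χ₀ = 0) (hne : χ₀ ≠ 0)
    {χ χ' : ℂ × ℂ → V} (hχ : χ ∈ D.solutions V p) (hχ' : χ' ∈ D.solutions V p)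
    {F F' : ℂ × ℂ → V} (hF : IsFrobeniusExpansion b D.k a χ₀ χ F)
    (hF' : IsFrobeniusExpansion b D.k a χ₀ χ' F') :
    Set.EqOn χ' χ (D.cover p ×ˢ Set.univ) := by
  let G := D.gaugedSystem hmon a hQ p
  obtain ⟨-, ⟨R, hR, hF⟩, hFl⟩ := hF
  obtain ⟨-, ⟨R', hR', hF'⟩, hFl'⟩ := hF'
  let δ : ℂ → ℂ → V := fun lam ζ => gauge b V a ζ (χ' (ζ, lam)) - gauge b V a ζ (χ (ζ, lam))
  let Φ : ℂ × ℂ → V := fun x => F' x - F x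
  -- Near `z = 0` the expansions make `δ` a function of `(z, λ z⁻ᵏ)`. Invariance is known only
  -- there, which suffices for `eq_zero_of_tendsto_zero`.
  have hδΦ : ∀ lam ζ : ℂ, ‖Complex.exp ζ‖ < min R R' →
      δ lam ζ = Φ (Complex.exp ζ, lam * Complex.exp (-(D.k : ℂ) * ζ)) := fun lam ζ h => by
    simp only [δ, Φ]
    rw [hF ζ lam (h.trans_le (min_le_left _ _)), hF' ζ lam (h.trans_le (min_le_right _ _)),
      frobeniusForm_eq_gauge, frobeniusForm_eq_gauge, gauge_gauge_neg, gauge_gauge_neg]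
  have hQe : Module.End.HasEigenvalue (D.residue V a : V →ₗ[ℂ] V) 0 :=
    Module.End.hasEigenvalue_of_hasEigenvector (x := χ₀)
      ⟨Module.End.mem_eigenspace_iff.2 (hχ₀.trans (zero_smul ℂ _).symm), hne⟩
  have hdiff : ∀ {χ : ℂ × ℂ → V}, χ ∈ D.solutions V p → ∀ ζ ∈ D.cover p, ∀ lam,
      DifferentiableAt ℂ (fun lam => gauge b V a ζ (χ (ζ, lam))) lam := fun hχ ζ hζ lam => by
    have h1 := ((hχ.1 (ζ, lam) ⟨hζ, trivial⟩).differentiableAt).comp lam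
      ((differentiableAt_const ζ).prodMk differentiableAt_id)
    exact (differentiableAt_const _).clm_apply h1
  rintro ⟨ζ, lam⟩ ⟨hζ, -⟩
  have hδ : δ lam ζ = 0 := by
    refine G.eq_zero_of_tendsto_zero hQe (δ := δ) (fun lam => ?_) (fun ζ hζ lam => ?_)
      (lt_min hR hR') (fun lam ζ h => ?_) (fun lam => ?_) lam ζ (D.mem_cover_iff.1 hζ)
    · exact IsSolution.sub
        (fun ζ hζ => D.hasDerivAt_gauge_apply (hχ'.2 ζ (D.mem_cover_iff.2 hζ) lam))
        (fun ζ hζ => D.hasDerivAt_gauge_apply (hχ.2 ζ (D.mem_cover_iff.2 hζ) lam))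
    · exact (hdiff hχ' ζ (D.mem_cover_iff.2 hζ) lam).sub (hdiff hχ ζ (D.mem_cover_iff.2 hζ) lam)
    · have h1 : Complex.exp (ζ + 2 * Real.pi * Complex.I) = Complex.exp ζ :=
        Complex.exp_periodic ζ
      have h2 : lam * Complex.exp (D.k * (2 * Real.pi * Complex.I)) *
          Complex.exp (-(D.k : ℂ) * (ζ + 2 * Real.pi * Complex.I))
          = lam * Complex.exp (-(D.k : ℂ) * ζ) := by
        rw [mul_assoc, ← Complex.exp_add]
        ring_nf
      change δ (lam * Complex.exp (D.k * (2 * Real.pi * Complex.I))) _ = _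
      rw [hδΦ _ _ (by rwa [h1]), hδΦ _ _ h, h1, h2]
    · have h1 := (hFl' lam).sub (hFl lam)
      rw [sub_self] at h1
      refine h1.congr' ?_
      have h2 := Complex.tendsto_exp_comap_re_atBot.eventually_mem
        (Metric.ball_mem_nhds 0 (lt_min hR hR'))
      filter_upwards [h2] with ζ hζ
      exact (hδΦ lam ζ (mem_ball_zero_iff.1 hζ)).symm
  have h1 := congrArg (gauge b V a (-ζ)) (sub_eq_zero.1 hδ)
  rwa [gauge_neg_gauge, gauge_neg_gauge] at h1

end Form

end OperData

end Solutions

end KdVOper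

end

/-! ### The proposition. -/

theorem mainTheorem10 {ι : Type*} [Fintype ι] [DecidableEq ι]
    {L : Type u} [LieRing L] [LieAlgebra ℂ L] [FiniteDimensional ℂ L] [LieAlgebra.IsSimple ℂ L]
    {H : LieSubalgebra ℂ L} (b : LieAlgebra.Basis ι H) (hA : b.A.IsSimplyLaced)
    (D : KdVOper.OperData b) (hmon : KdVOper.OperData.TrivialMonodromy.{u, v} D)
    (hgen : KdVOper.IsGeneric.{u, v} b D.r D.k)
    (p : ι → ZMod 2) (hp : ∀ i j, b.A i j < 0 → p j = p i + 1)
    (i : ι) {V : Type v} [NormedAddCommGroup V] [NormedSpace ℂ V] [FiniteDimensional ℂ V]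
    [LieRingModule L V] [LieModule ℂ L V] (hV : KdVOper.IsFundamentalModule b i V)
    (ω : Module.Dual ℂ H) (hω : KdVOper.IsWeight H V ω) (χ₀ : V)
    (hχ₀ : Module.End.HasEigenvector (LieModule.toEnd ℂ L V D.principalCoeff)
      (ω (D.r - KdVOper.rhoCheck b)) χ₀) :
    ∃ χ ∈ D.solutions V (p i),
      (∃ F : ℂ × ℂ → V,
        KdVOper.IsFrobeniusExpansion b D.k (ω (D.r - KdVOper.rhoCheck b)) χ₀ χ F ∧
        AnalyticOnNhd ℂ F ({z | KdVOper.sgn (p i) * z ∉ D.sing} ×ˢ Set.univ) ∧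
        Set.EqOn χ (KdVOper.frobeniusForm b D.k (ω (D.r - KdVOper.rhoCheck b)) F)
          (D.cover (p i) ×ˢ Set.univ)) ∧
      (∀ χ' ∈ D.solutions V (p i),
        (∃ F' : ℂ × ℂ → V,
          KdVOper.IsFrobeniusExpansion b D.k (ω (D.r - KdVOper.rhoCheck b)) χ₀ χ' F') →
        Set.EqOn χ' χ (D.cover (p i) ×ˢ Set.univ)) ∧
      Set.EqOn (KdVOper.monodromy b D.k χ)
        (fun x => Complex.exp (-(2 * Real.pi * Complex.I * ω (D.r - KdVOper.rhoCheck b))) • χ x)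
        (D.cover (p i) ×ˢ Set.univ) := by
  set a := ω (D.r - KdVOper.rhoCheck b)
  have hQ := D.nonResonant_residue hgen hV a
  have hQ0 : D.residue V a χ₀ = 0 := by
    have h1 : KdVOper.rep L V D.principalCoeff χ₀ = a • χ₀ := hχ₀.apply_eq_smul
    change KdVOper.rep L V D.principalCoeff χ₀ - a • χ₀ = 0
    rw [h1, sub_self]
  obtain ⟨F, hFa, hFs, hFl⟩ := (D.gaugedSystem hmon a hQ (p i)).exists_regular_solution hQ0
  have hset : {z | KdVOper.sgn (p i) * z ∉ D.sing} = {z | z ∉ D.singImage (p i)} :=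
    Set.ext fun z => not_congr D.mem_singImage.symm
  have hmem := D.frobeniusForm_mem_solutions hFa hFs
  -- The solution is defined by the Frobenius formula, so any radius serves in place of `1`.
  have hexp : KdVOper.IsFrobeniusExpansion b D.k a χ₀ (KdVOper.frobeniusForm b D.k a F) F :=
    ⟨hFa _ ⟨(D.gaugedSystem hmon a hQ (p i)).zero_notMem, trivial⟩,
      ⟨1, one_pos, fun _ _ _ => rfl⟩, hFl⟩
  refine ⟨_, hmem, ⟨F, hexp, hset ▸ hFa, fun _ _ => rfl⟩, ?_,
    fun x _ => D.monodromy_frobeniusForm x⟩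
  rintro χ' hχ' ⟨F', hF'⟩
  exact D.eqOn_of_isFrobeniusExpansion hmon hQ hQ0 hχ₀.2 hmem hχ' hexp hF'
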